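/- Let $\lambda>0$ be real and let $\tau\in\mathbb C$. Let $S,T\in \mathrm{PSL}(2,\mathbb C)$ be represented by the matrices $$S=\begin{pmatrix}\cosh\lambda & \cosh\lambda+1\\ \cosh\lambda-1 & \cosh\lambda\end{pmatrix},\qquad T=\begin{pmatrix}\cosh(\tau/2)\coth(\lambda/2) & -\sinh(\tau/2)\\ -\sinh(\tau/2) & \cosh(\tau/2)\tanh(\lambda/2)\end{pmatrix}.$$ Let $\theta_0\in(0,\pi)$ be defined by $\cos(\theta_0/2)=\tanh\lambda$. If $\operatorname{Im}\tau\in(-\theta_0,\theta_0)$, then $G=\langle S,T\rangle$, marked by the generators $S,T$, is a quasi-Fuchsian punctured torus group. This means that $G$ is discrete in $\mathrm{PSL}(2,\mathbb C)$, that $G$ is free on $S$ and $T$, that the commutator $T^{-1}S^{-1}TS$ is parabolic, and that the limit set of $G$ (the set of all accumulation points of the action of $G$ by Möbius transformations on the Riemann sphere) is a topological circle. -/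

import Mathlib

open scoped MatrixGroups

/-- The group `PSL(2, ℂ)`, with the quotient topology inherited from `SL(2, ℂ)`. -/
abbrev PSL2C : Type := Matrix.ProjectiveSpecialLinearGroup (Fin 2) ℂ

/-- The action of `PSL(2, ℂ)` on the Riemann sphere `ℂ ∪ {∞}` by Möbius transformations,
obtained by identifying the sphere with the complex projective line. -/
noncomputable instance psl2cAction : MulAction PSL2C (OnePoint ℂ) :=
  (OnePoint.equivProjectivization ℂ).mulAction PSL2C

/-- The action is the usual one: `z ↦ (a z + b) / (c z + d)`. -/
theorem psl2c_smul_coe (A : SL(2, ℂ)) (z : ℂ) :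
    ((QuotientGroup.mk A : PSL2C) • (z : OnePoint ℂ) : OnePoint ℂ) =
      if A 1 0 * z + A 1 1 = 0 then OnePoint.infty
      else (((A 0 0 * z + A 0 1) / (A 1 0 * z + A 1 1) : ℂ) : OnePoint ℂ) :=
  OnePoint.smul_some_eq_ite (g := (A : GL (Fin 2) ℂ)) (k := z)

theorem psl2c_smul_infty (A : SL(2, ℂ)) :
    ((QuotientGroup.mk A : PSL2C) • (OnePoint.infty : OnePoint ℂ) : OnePoint ℂ) =
      if A 1 0 = 0 then OnePoint.infty else ((A 0 0 / A 1 0 : ℂ) : OnePoint ℂ) :=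
  OnePoint.smul_infty_eq_ite (A : GL (Fin 2) ℂ)

/-- The limit set of a subgroup `G` of `PSL(2, ℂ)`: the accumulation points of its action on the
Riemann sphere, that is, the points `x` such that for some `z` every neighbourhood of `x`
contains `g z` for infinitely many `g ∈ G`. -/
def kleinianLimitSet (G : Subgroup PSL2C) : Set (OnePoint ℂ) :=
  {x | ∃ z : OnePoint ℂ, ∀ U ∈ nhds x, {g : PSL2C | g ∈ G ∧ g • z ∈ U}.Infinite}

/-- An element of `PSL(2, ℂ)` is parabolic if it has exactly one fixed point in the sphere. -/
def IsParabolicPSL (g : PSL2C) : Prop := ∃! z : OnePoint ℂ, g • z = z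

/-- The pair `(S, T)` marks a punctured torus group: `S` and `T` generate a discrete group, they
generate it freely, and their commutator is parabolic. -/
structure IsPuncturedTorusGroup (S T : PSL2C) : Prop where
  discrete : DiscreteTopology (Subgroup.closure ({S, T} : Set PSL2C))
  free : Function.Injective (FreeGroup.lift ![S, T] : FreeGroup (Fin 2) →* PSL2C)
  parabolic : IsParabolicPSL (T⁻¹ * S⁻¹ * T * S)

/-- A punctured torus group is quasi-Fuchsian if its limit set is a topological circle. -/
structure IsQuasiFuchsianPuncturedTorusGroup (S T : PSL2C) : Prop
    extends IsPuncturedTorusGroup S T where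
  limitSet_circle :
    Nonempty (kleinianLimitSet (Subgroup.closure ({S, T} : Set PSL2C)) ≃ₜ Circle)

/-- The matrix of the generator `S`. -/
noncomputable def matS (lam : ℝ) : Matrix (Fin 2) (Fin 2) ℂ :=
  !![Complex.cosh lam, Complex.cosh lam + 1;
     Complex.cosh lam - 1, Complex.cosh lam]

/-- The matrix of the generator `T`; here `cosh / sinh` is `coth` and `sinh / cosh` is `tanh`. -/
noncomputable def matT (lam : ℝ) (τ : ℂ) : Matrix (Fin 2) (Fin 2) ℂ :=
  !![Complex.cosh (τ / 2) * (Complex.cosh (lam / 2) / Complex.sinh (lam / 2)),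
      -Complex.sinh (τ / 2);
     -Complex.sinh (τ / 2),
      Complex.cosh (τ / 2) * (Complex.sinh (lam / 2) / Complex.cosh (lam / 2))]

theorem det_matS (lam : ℝ) : (matS lam).det = 1 := by
  rw [matS, Matrix.det_fin_two_of]
  ring

theorem det_matT (lam : ℝ) (hlam : 0 < lam) (τ : ℂ) : (matT lam τ).det = 1 := by
  have hs : Complex.sinh (lam / 2) ≠ 0 := by
    have h : Real.sinh (lam / 2) ≠ 0 := (Real.sinh_pos_iff.2 (by linarith)).ne'
    exact_mod_cast h
  have hc : Complex.cosh (lam / 2) ≠ 0 := by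
    have h : Real.cosh (lam / 2) ≠ 0 := (Real.cosh_pos _).ne'
    exact_mod_cast h
  rw [matT, Matrix.det_fin_two_of]
  have := Complex.cosh_sq_sub_sinh_sq (τ / 2)
  field_simp
  linear_combination this

/-- The generator `S ∈ PSL(2, ℂ)`. -/
noncomputable def genS (lam : ℝ) : PSL2C :=
  QuotientGroup.mk (⟨matS lam, det_matS lam⟩ : SL(2, ℂ))

/-- The generator `T ∈ PSL(2, ℂ)`. -/
noncomputable def genT (lam : ℝ) (hlam : 0 < lam) (τ : ℂ) : PSL2C :=
  QuotientGroup.mk (⟨matT lam τ, det_matT lam hlam τ⟩ : SL(2, ℂ))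

/-! Conjugate so that `S` is `z ↦ exp (2λ) z`, and write `T = e f`. Here `f` (`halfTurn`) is a real
involution independent of `τ`, and `e` (`bendTurn`) is the involution `z ↦ -exp (-τ) / z`, which
inverts `S`. Let `B` (`pantsGroup`) be the Fuchsian group generated by `± S ^ k` and `f`, and adjoin
`e`: `τ` enters only through `e`, so the result is a holomorphic family of groups indexed by a
complex parameter `σ`.

For a given `σ`, `e` exchanges the two sides of a line through `0` and `∞` inclined by `Im σ / 2`.
If `tanh λ < cos (Im σ / 2)`, every element of `B` other than `± S ^ k` carries the closed negative
side into the open positive side (`sideForm_pos_of_pants`). Ping-pong then shows that an element of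
the family outside `B` never fixes the cusp `exp λ`, whereas fixing it is independent of `σ` for
elements of `B`. So two points of the orbit of the cusp coincide for all `σ` in the strip or for
none (`motionGroup_cross`): the orbit moves holomorphically and injectively. It stays away from a
neighbourhood of the fixed point of `f` in the upper half-plane (`motionGroup_avoid`), so in a
coordinate with that point at infinity the motion is bounded.

By Harnack's inequality, distances at two parameters bound each other by Hölder estimates, and the
motion extends to closures (`holomorphic_motion_closure`). At the real parameter `Re τ` the closure
of the orbit is the extended real line, by a subdivision argument for an ideal triangle
(`closure_real_orbit`). Hence at `τ` it is a topological circle, matched with the real line by a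
compact equivariant correspondence (`exists_limit_correspondence`).

The rest is carried over from the real parameter. Ping-pong on four intervals of the real line moves
one of four fixed points a definite amount under every non-trivial word; transported through the
correspondence, this leaves no non-trivial word near the identity at `τ`, which gives discreteness
and freeness together (`exists_nhds_words`). The commutator is `(f S) ^ 2`, a real parabolic element
independent of `τ`. The circle is closed, invariant and perfect and lies in the closure of an orbit,
so it is the limit set (`kleinianLimitSet_subset`, `subset_kleinianLimitSet`). -/

/-! ### Harnack's inequality and the λ-lemma -/

open Metric in
/-- A zero-free holomorphic function on a disc is the exponential of a holomorphic function. -/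
theorem exists_exp_eq_on_ball {g : ℂ → ℂ} {c : ℂ} {R : ℝ} (hR : 0 < R)
    (hg : DifferentiableOn ℂ g (ball c R)) (h0 : ∀ z ∈ ball c R, g z ≠ 0) (a : ℂ)
    (ha : Complex.exp a = g c) :
    ∃ L : ℂ → ℂ, DifferentiableOn ℂ L (ball c R) ∧ L c = a ∧
      ∀ z ∈ ball c R, Complex.exp (L z) = g z := by
  have hd : DifferentiableOn ℂ (fun z => deriv g z / g z) (ball c R) :=
    (hg.deriv isOpen_ball).div hg h0
  obtain ⟨L, hLc, hL⟩ := hd.isExactOn_ball.with_val_at c a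
  have hLd : DifferentiableOn ℂ L (ball c R) := fun z hz =>
    (hL z hz).differentiableAt.differentiableWithinAt
  refine ⟨L, hLd, hLc, fun z hz => ?_⟩
  have hq : ∀ w ∈ ball c R, HasDerivAt (fun w => g w * Complex.exp (-L w)) 0 w := by
    intro w hw
    have h1 := (hg.differentiableAt (isOpen_ball.mem_nhds hw)).hasDerivAt
    have h2 := ((hL w hw).neg).cexp
    convert! h1.mul h2 using 1
    have := h0 w hw
    field_simp
    ring
  have hconst : g z * Complex.exp (-L z) = g c * Complex.exp (-L c) :=
    isOpen_ball.is_const_of_deriv_eq_zero (convex_ball c R).isPreconnected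
      (fun w hw => (hq w hw).differentiableAt.differentiableWithinAt)
      (fun w hw => (hq w hw).deriv) hz (mem_ball_self hR)
  rw [hLc, ← ha, ← Complex.exp_add, add_neg_cancel, Complex.exp_zero, Complex.exp_neg] at hconst
  field_simp at hconst
  exact hconst.symm

/-- The bounds for the real part of a Cayley transform. -/
theorem cayley_re_bounds {w : ℂ} {ρ : ℝ} (hρ : ρ < 1) (hw : ‖w‖ ≤ ρ) :
    (1 - ρ) / (1 + ρ) ≤ ((1 + w) / (1 - w)).re ∧
      (1 - ρ) / (1 + ρ) * ((1 + w) / (1 - w)).re ≤ 1 := by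
  have h0 : 0 ≤ ρ := (norm_nonneg w).trans hw
  have hsq : w.re ^ 2 + w.im ^ 2 = ‖w‖ ^ 2 := by
    rw [Complex.sq_norm, Complex.normSq_apply]; ring
  have hre : -‖w‖ ≤ w.re ∧ w.re ≤ ‖w‖ := abs_le.1 (Complex.abs_re_le_norm w)
  have hn := norm_nonneg w
  have hD : 0 < (1 - w.re) ^ 2 + w.im ^ 2 := by nlinarith
  have hform : ((1 + w) / (1 - w)).re = (1 - ‖w‖ ^ 2) / ((1 - w.re) ^ 2 + w.im ^ 2) := by
    rw [Complex.div_re, Complex.normSq_apply, ← hsq]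
    simp only [Complex.add_re, Complex.one_re, Complex.sub_re, Complex.add_im, Complex.one_im,
      Complex.sub_im]
    rw [← add_div]
    congr 1 <;> ring
  have hD2 : (1 - w.re) ^ 2 + w.im ^ 2 = 1 - 2 * w.re + ‖w‖ ^ 2 := by rw [← hsq]; ring
  have hp : 0 < 1 + ρ := by linarith
  rw [hD2] at hD
  rw [hform, hD2]
  constructor
  · rw [div_le_div_iff₀ hp (hD2 ▸ hD)]
    nlinarith [mul_nonneg hn h0]
  · rw [div_mul_div_comm, div_le_one (mul_pos hp hD)]
    nlinarith [mul_nonneg hn h0]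

open Metric in
/-- **Harnack's inequality** for a bounded zero-free holomorphic function on a disc. -/
theorem harnack_norm_le {g : ℂ → ℂ} {c z : ℂ} {R M : ℝ} (hM : 0 < M)
    (hg : DifferentiableOn ℂ g (ball c R)) (h0 : ∀ w ∈ ball c R, g w ≠ 0)
    (hb : ∀ w ∈ ball c R, ‖g w‖ < M) (hz : z ∈ ball c R) :
    ‖g z‖ ≤ M * (‖g c‖ / M) ^ ((R - dist z c) / (R + dist z c)) ∧
      ‖g c‖ ≤ M * (‖g z‖ / M) ^ ((R - dist z c) / (R + dist z c)) := by
  have hR : 0 < R := pos_of_mem_ball hz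
  have hc : c ∈ ball c R := mem_ball_self hR
  -- Dividing by the phase of `g c` makes `G c` a number in `(0, 1)`, so the logarithm of `G` can be
  -- given the real negative value `ℓ` at the centre.
  set G : ℂ → ℂ := fun w => g w / g c * (‖g c‖ / M : ℝ) with hG
  have hgc : 0 < ‖g c‖ := norm_pos_iff.2 (h0 c hc)
  have hGn : ∀ w, ‖G w‖ = ‖g w‖ / M := by
    intro w
    simp only [hG, norm_mul, norm_div, Complex.norm_real, Real.norm_eq_abs, abs_of_pos hM]
    rw [abs_of_pos hgc]
    field_simp
  have hGd : DifferentiableOn ℂ G (ball c R) := (hg.div_const _).mul_const _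
  have hG0 : ∀ w ∈ ball c R, G w ≠ 0 := by
    intro w hw
    rw [← norm_pos_iff, hGn]
    exact div_pos (norm_pos_iff.2 (h0 w hw)) hM
  set ℓ : ℝ := Real.log (‖g c‖ / M) with hℓ
  have hℓneg : ℓ < 0 := Real.log_neg (div_pos hgc hM) ((div_lt_one hM).2 (hb c hc))
  obtain ⟨L, hLd, hLc, hL⟩ := exists_exp_eq_on_ball hR hGd hG0 (ℓ : ℂ) (by
    rw [← Complex.ofReal_exp, hℓ, Real.exp_log (div_pos hgc hM), hG]
    simp only
    rw [div_self (h0 c hc), one_mul])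
  have hLre : ∀ w ∈ ball c R, (L w).re = Real.log (‖g w‖ / M) := by
    intro w hw
    rw [← hGn w, ← hL w hw, Complex.norm_exp, Real.log_exp]
  have hLneg : ∀ w ∈ ball c R, (L w).re < 0 := by
    intro w hw
    rw [hLre w hw]
    exact Real.log_neg (div_pos (norm_pos_iff.2 (h0 w hw)) hM) ((div_lt_one hM).2 (hb w hw))
  -- Cayley transform of the left half-plane onto the unit disc sending `ℓ` to `0`; Schwarz's lemma
  -- for `W` is Harnack's inequality for `Re L`.
  set W : ℂ → ℂ := fun w => (L w - ℓ) / (L w + ℓ) with hW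
  have hne : ∀ w ∈ ball c R, L w + ℓ ≠ 0 := by
    intro w hw h
    have := congrArg Complex.re h
    simp only [Complex.add_re, Complex.ofReal_re, Complex.zero_re] at this
    linarith [hLneg w hw]
  have hWd : DifferentiableOn ℂ W (ball c R) := (hLd.sub_const _).div (hLd.add_const _) hne
  have hWc : W c = 0 := by simp [hW, hLc]
  have hWb : ∀ w ∈ ball c R, ‖W w‖ ≤ 1 := by
    intro w hw
    simp only [hW, norm_div]
    rw [div_le_one (norm_pos_iff.2 (hne w hw)), ← sq_le_sq₀ (norm_nonneg _) (norm_nonneg _),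
      Complex.sq_norm, Complex.sq_norm, Complex.normSq_apply, Complex.normSq_apply]
    simp only [Complex.add_re, Complex.ofReal_re, Complex.sub_re, Complex.add_im,
      Complex.ofReal_im, Complex.sub_im]
    nlinarith [hLneg w hw]
  have hs : ‖W z‖ ≤ dist z c / R := by
    have := Complex.dist_le_div_mul_dist_of_mapsTo_ball (R₂ := 1) hWd
      (fun w hw => by simpa [hWc] using hWb w hw) hz
    rw [hWc, dist_zero_right] at this
    calc _ ≤ _ := this
      _ = _ := by ring
  have hρ : dist z c / R < 1 := (div_lt_one hR).2 hz
  have hcay := cayley_re_bounds hρ hs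
  have hLz : L z = ℓ * ((1 + W z) / (1 - W z)) := by
    have h1 := hne z hz
    have h2 : (1 : ℂ) - W z ≠ 0 := by
      intro h
      have h3 : ‖W z‖ = 1 := by rw [← sub_eq_zero.1 h, norm_one]
      linarith
    have h4 : (ℓ : ℂ) ≠ 0 := by exact_mod_cast hℓneg.ne
    rw [mul_div_assoc', eq_div_iff h2]
    simp only [hW]
    field_simp
    ring
  have hκ : (1 - dist z c / R) / (1 + dist z c / R) = (R - dist z c) / (R + dist z c) := by
    field_simp
  rw [hκ] at hcay
  have hre : Real.log (‖g z‖ / M) = ℓ * ((1 + W z) / (1 - W z)).re := by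
    rw [← hLre z hz, hLz, Complex.re_ofReal_mul]
  have hgz : 0 < ‖g z‖ / M := div_pos (norm_pos_iff.2 (h0 z hz)) hM
  constructor
  · rw [← div_le_iff₀' hM, ← Real.log_le_log_iff hgz (Real.rpow_pos_of_pos (div_pos hgc hM) _),
      Real.log_rpow (div_pos hgc hM), hre, mul_comm _ (Real.log _)]
    exact mul_le_mul_of_nonpos_left hcay.1 hℓneg.le
  · rw [← div_le_iff₀' hM, ← Real.log_le_log_iff (div_pos hgc hM) (Real.rpow_pos_of_pos hgz _),
      Real.log_rpow hgz, hre]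
    nlinarith [hcay.2]

open Metric in
/-- Two members of a bounded holomorphic family of functions on a disc which either agree
identically or never agree have comparable distances at any two parameters. -/
theorem holomorphic_motion_holder {ι : Type*} {F : ι → ℂ → ℂ} {c z : ℂ} {R M : ℝ} (hM : 0 < M)
    (hF : ∀ i, DifferentiableOn ℂ (F i) (ball c R)) (hb : ∀ i, ∀ w ∈ ball c R, ‖F i w‖ < M)
    (hinj : ∀ i j, ∀ w ∈ ball c R, F i w = F j w → ∀ w' ∈ ball c R, F i w' = F j w')
    (hz : z ∈ ball c R) :
    ∃ κ : ℝ, 0 < κ ∧ ∀ i j,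
      ‖F i z - F j z‖ ≤ 2 * M * (‖F i c - F j c‖ / (2 * M)) ^ κ ∧
        ‖F i c - F j c‖ ≤ 2 * M * (‖F i z - F j z‖ / (2 * M)) ^ κ := by
  have hR : 0 < R := pos_of_mem_ball hz
  have hκ : 0 < (R - dist z c) / (R + dist z c) :=
    div_pos (sub_pos.2 hz) (by have := dist_nonneg (x := z) (y := c); linarith)
  refine ⟨_, hκ, fun i j => ?_⟩
  by_cases h : F i c = F j c
  · rw [h, hinj i j c (mem_ball_self hR) h z hz]
    simp [Real.zero_rpow hκ.ne']
  · refine harnack_norm_le (g := fun w => F i w - F j w) (by positivity) ((hF i).sub (hF j)) ?_ ?_ hz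
    · intro w hw h'
      exact h (hinj i j w hw (sub_eq_zero.1 h') c (mem_ball_self hR))
    · intro w hw
      calc _ ≤ ‖F i w‖ + ‖F j w‖ := norm_sub_le _ _
        _ < _ := by linarith [hb i w hw, hb j w hw]

open Metric in
/-- The **λ-lemma**, in the form needed here: the closure of the graph of a bounded holomorphic
motion is compact, and it is the graph of an injection. -/
theorem holomorphic_motion_closure {ι : Type*} {F : ι → ℂ → ℂ} {c z : ℂ} {R M : ℝ} (hM : 0 < M)
    (hF : ∀ i, DifferentiableOn ℂ (F i) (ball c R)) (hb : ∀ i, ∀ w ∈ ball c R, ‖F i w‖ < M)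
    (hinj : ∀ i j, ∀ w ∈ ball c R, F i w = F j w → ∀ w' ∈ ball c R, F i w' = F j w')
    (hz : z ∈ ball c R) :
    IsCompact (closure (Set.range fun i => (F i c, F i z))) ∧
      Set.InjOn Prod.fst (closure (Set.range fun i => (F i c, F i z))) ∧
      Set.InjOn Prod.snd (closure (Set.range fun i => (F i c, F i z))) := by
  obtain ⟨κ, hκ, hH⟩ := holomorphic_motion_holder hM hF hb hinj hz
  have hR : 0 < R := pos_of_mem_ball hz
  set A := Set.range fun i => (F i c, F i z) with hA
  -- The two-sided Hölder bound is a closed condition on pairs of points of the graph, so it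
  -- survives in the closure, where equality of either coordinate forces equality of the other.
  have key : ∀ q ∈ closure A ×ˢ closure A,
      ‖q.1.2 - q.2.2‖ ≤ 2 * M * (‖q.1.1 - q.2.1‖ / (2 * M)) ^ κ ∧
        ‖q.1.1 - q.2.1‖ ≤ 2 * M * (‖q.1.2 - q.2.2‖ / (2 * M)) ^ κ := by
    intro q hq
    rw [← closure_prod_eq] at hq
    have hcl : IsClosed {q : (ℂ × ℂ) × (ℂ × ℂ) |
        ‖q.1.2 - q.2.2‖ ≤ 2 * M * (‖q.1.1 - q.2.1‖ / (2 * M)) ^ κ ∧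
        ‖q.1.1 - q.2.1‖ ≤ 2 * M * (‖q.1.2 - q.2.2‖ / (2 * M)) ^ κ} := by
      refine IsClosed.inter (isClosed_le (Continuous.norm (by fun_prop)) ?_)
        (isClosed_le (Continuous.norm (by fun_prop)) ?_)
      · exact continuous_const.mul (Continuous.rpow_const (by fun_prop) fun _ => Or.inr hκ.le)
      · exact continuous_const.mul (Continuous.rpow_const (by fun_prop) fun _ => Or.inr hκ.le)
    refine closure_minimal ?_ hcl hq
    rintro ⟨-, -⟩ ⟨⟨i, rfl⟩, ⟨j, rfl⟩⟩
    exact hH i j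
  refine ⟨?_, ?_, ?_⟩
  · refine Bornology.IsBounded.isCompact_closure ?_
    refine (isBounded_closedBall (x := (0 : ℂ × ℂ)) (r := M)).subset ?_
    rintro _ ⟨i, rfl⟩
    rw [mem_closedBall_zero_iff]
    exact max_le (hb i c (mem_ball_self hR)).le (hb i z hz).le
  · rintro ⟨x, y⟩ h ⟨x', y'⟩ h' (rfl : x = x')
    have := (key ((x, y), (x, y')) ⟨h, h'⟩).1
    simp only [sub_self, norm_zero, zero_div, Real.zero_rpow hκ.ne', mul_zero] at this
    rw [sub_eq_zero.1 (norm_le_zero_iff.1 this)]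
  · rintro ⟨x, y⟩ h ⟨x', y'⟩ h' (rfl : y = y')
    have := (key ((x, y), (x', y)) ⟨h, h'⟩).2
    simp only [sub_self, norm_zero, zero_div, Real.zero_rpow hκ.ne', mul_zero] at this
    rw [sub_eq_zero.1 (norm_le_zero_iff.1 this)]

/-! ### The Möbius action in homogeneous coordinates and its continuity -/

/-- The point of the Riemann sphere with homogeneous coordinates `(x : y)`. -/
noncomputable def toSphere (x y : ℂ) : OnePoint ℂ :=
  if y = 0 then OnePoint.infty else ((x / y : ℂ) : OnePoint ℂ)

theorem toSphere_one (z : ℂ) : toSphere z 1 = (z : OnePoint ℂ) := by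
  simp [toSphere]

theorem toSphere_zero_right (x : ℂ) : toSphere x 0 = OnePoint.infty := by
  simp [toSphere]

theorem exists_toSphere_eq (z : OnePoint ℂ) : ∃ x y : ℂ, (x ≠ 0 ∨ y ≠ 0) ∧ toSphere x y = z := by
  induction z using OnePoint.rec with
  | infty => exact ⟨1, 0, by simp, toSphere_zero_right 1⟩
  | coe z => exact ⟨z, 1, by simp, toSphere_one z⟩

theorem toSphere_eq_iff {x y x' y' : ℂ} (h : x ≠ 0 ∨ y ≠ 0) (h' : x' ≠ 0 ∨ y' ≠ 0) :
    toSphere x y = toSphere x' y' ↔ x * y' = x' * y := by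
  unfold toSphere
  by_cases hy : y = 0 <;> by_cases hy' : y' = 0
  · simp [hy, hy']
  · have hx : x ≠ 0 := by simpa [hy] using h
    simp [hy, hy', hx]
  · have hx : x' ≠ 0 := by simpa [hy'] using h'
    simp [hy, hy', hx]
  · simp only [hy, hy', if_false, OnePoint.coe_eq_coe]
    rw [div_eq_div_iff hy hy']

theorem toSphere_mul (c x y : ℂ) (hc : c ≠ 0) : toSphere (c * x) (c * y) = toSphere x y := by
  unfold toSphere
  by_cases hy : y = 0
  · simp [hy]
  · simp [hy, hc, mul_div_mul_left]

theorem SL2_apply_ne_zero (A : SL(2, ℂ)) {x y : ℂ} (h : x ≠ 0 ∨ y ≠ 0) :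
    A 0 0 * x + A 0 1 * y ≠ 0 ∨ A 1 0 * x + A 1 1 * y ≠ 0 := by
  by_contra! hh
  have hdet : A 0 0 * A 1 1 - A 0 1 * A 1 0 = 1 := by
    have := A.det_coe; rwa [Matrix.det_fin_two] at this
  have hx : x = 0 := by linear_combination A 1 1 * hh.1 - A 0 1 * hh.2 - x * hdet
  have hy : y = 0 := by linear_combination A 0 0 * hh.2 - A 1 0 * hh.1 - y * hdet
  simp [hx, hy] at h

theorem mk_smul_toSphere (A : SL(2, ℂ)) {x y : ℂ} (h : x ≠ 0 ∨ y ≠ 0) :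
    (QuotientGroup.mk A : PSL2C) • toSphere x y =
      toSphere (A 0 0 * x + A 0 1 * y) (A 1 0 * x + A 1 1 * y) := by
  by_cases hy : y = 0
  · subst hy
    have hx : x ≠ 0 := by simpa using h
    rw [toSphere_zero_right, psl2c_smul_infty]
    simp only [toSphere, mul_zero, add_zero, mul_eq_zero, hx, or_false]
    rw [mul_div_mul_right _ _ hx]
  · have h1 : toSphere x y = ((x / y : ℂ) : OnePoint ℂ) := by simp [toSphere, hy]
    have e0 : A 0 0 * x + A 0 1 * y = y * (A 0 0 * (x / y) + A 0 1) := by field_simp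
    have e1 : A 1 0 * x + A 1 1 * y = y * (A 1 0 * (x / y) + A 1 1) := by field_simp
    rw [h1, psl2c_smul_coe, e0, e1, toSphere_mul _ _ _ hy]
    rfl

-- The origin has to be excluded, since the ratio has no limit there. Near `(x, 0)` with `x ≠ 0` the
-- ratio leaves every disc because `r * ‖v.2‖ < ‖v.1‖` is an open condition.
open Filter Topology in
theorem continuousAt_toSphere {x y : ℂ} (h : x ≠ 0 ∨ y ≠ 0) :
    ContinuousAt (fun v : ℂ × ℂ => toSphere v.1 v.2) (x, y) := by
  by_cases hy : y = 0
  · subst hy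
    have hx : x ≠ 0 := by simpa using h
    rw [ContinuousAt, toSphere_zero_right, OnePoint.nhds_infty_eq]
    intro s hs
    rw [mem_sup] at hs
    obtain ⟨hs1, hs2⟩ := hs
    rw [mem_map, Filter.coclosedCompact_eq_cocompact,
      ← Metric.cobounded_eq_cocompact, ← comap_norm_atTop, mem_comap] at hs1
    obtain ⟨t, ht, hts⟩ := hs1
    obtain ⟨r, hr⟩ := mem_atTop_sets.1 ht
    have hev : ∀ᶠ v : ℂ × ℂ in 𝓝 (x, 0), r * ‖v.2‖ < ‖v.1‖ := by
      refine ContinuousAt.eventually_lt (f := fun v : ℂ × ℂ => r * ‖v.2‖)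
        (g := fun v : ℂ × ℂ => ‖v.1‖) (by fun_prop) (by fun_prop) ?_
      simpa using hx
    rw [mem_map]
    filter_upwards [hev] with v hv
    simp only [Set.mem_preimage, toSphere]
    split_ifs with h0
    · exact hs2
    · apply hts
      apply hr
      rw [norm_div, le_div_iff₀ (norm_pos_iff.2 h0)]
      exact hv.le
  · have : (fun v : ℂ × ℂ => ((v.1 / v.2 : ℂ) : OnePoint ℂ)) =ᶠ[𝓝 (x, y)]
        fun v => toSphere v.1 v.2 := by
      filter_upwards [(continuous_snd.continuousAt (x := (x, y))).eventually_ne hy] with v hv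
      simp [toSphere, hv]
    refine ContinuousAt.congr ?_ this
    exact OnePoint.continuous_coe.continuousAt.comp
      (ContinuousAt.div continuousAt_fst continuousAt_snd hy)

theorem Continuous.toSphere {X : Type*} [TopologicalSpace X] {f g : X → ℂ} (hf : Continuous f)
    (hg : Continuous g) (h : ∀ x, f x ≠ 0 ∨ g x ≠ 0) :
    Continuous fun x => _root_.toSphere (f x) (g x) :=
  continuous_iff_continuousAt.2 fun x =>
    ContinuousAt.comp (f := fun x => (f x, g x)) (continuousAt_toSphere (h x))
      (hf.prodMk hg).continuousAt

theorem tendsto_toSphere {ι : Type*} {l : Filter ι} {f g : ι → ℂ} {x y : ℂ}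
    (hf : Filter.Tendsto f l (nhds x)) (hg : Filter.Tendsto g l (nhds y)) (h : x ≠ 0 ∨ y ≠ 0) :
    Filter.Tendsto (fun i => toSphere (f i) (g i)) l (nhds (toSphere x y)) :=
  (continuousAt_toSphere h).tendsto.comp (hf.prodMk_nhds hg)

/-- Orbit maps of the Möbius action are continuous. -/
theorem continuous_smul_sphere (z : OnePoint ℂ) : Continuous fun g : PSL2C => g • z := by
  obtain ⟨x, y, h, rfl⟩ := exists_toSphere_eq z
  refine (QuotientGroup.isQuotientMap_mk (N := Subgroup.center SL(2, ℂ))).continuous_iff.2 ?_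
  have : ((fun g : PSL2C => g • toSphere x y) ∘ (QuotientGroup.mk : SL(2, ℂ) → PSL2C)) =
      fun A : SL(2, ℂ) => toSphere (A 0 0 * x + A 0 1 * y) (A 1 0 * x + A 1 1 * y) :=
    funext fun A => mk_smul_toSphere A h
  rw [this]
  have hc : ∀ i j, Continuous fun A : SL(2, ℂ) => A i j := fun i j =>
    (continuous_apply j).comp (Matrix.SpecialLinearGroup.continuous_apply _ continuous_id i)
  exact Continuous.toSphere (((hc _ _).mul continuous_const).add ((hc _ _).mul continuous_const))
    (((hc _ _).mul continuous_const).add ((hc _ _).mul continuous_const))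
    fun A => SL2_apply_ne_zero A h

/-- Möbius transformations are continuous. -/
instance continuousConstSMul_sphere : ContinuousConstSMul PSL2C (OnePoint ℂ) where
  continuous_const_smul g := by
    obtain ⟨A, rfl⟩ := QuotientGroup.mk_surjective g
    have hdet : A 0 0 * A 1 1 - A 0 1 * A 1 0 = 1 := by
      have := A.det_coe; rwa [Matrix.det_fin_two] at this
    have hcoe : ∀ z : ℂ, ContinuousAt
        (fun w : ℂ => (QuotientGroup.mk A : PSL2C) • (w : OnePoint ℂ)) z := by
      intro z
      have : (fun w : ℂ => (QuotientGroup.mk A : PSL2C) • (w : OnePoint ℂ)) =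
          fun w => toSphere (A 0 0 * w + A 0 1 * 1) (A 1 0 * w + A 1 1 * 1) := by
        funext w
        rw [← toSphere_one, mk_smul_toSphere A (by simp)]
      rw [this]
      refine (Continuous.toSphere (by fun_prop) (by fun_prop) fun w => ?_).continuousAt
      exact SL2_apply_ne_zero A (by simp)
    rw [OnePoint.continuous_iff]
    refine ⟨?_, continuous_iff_continuousAt.2 hcoe⟩
    rw [← toSphere_zero_right 1, mk_smul_toSphere A (by simp),
      Filter.coclosedCompact_eq_cocompact, ← Metric.cobounded_eq_cocompact]
    have hev : ∀ᶠ z : ℂ in Bornology.cobounded ℂ,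
        toSphere (A 0 0 * 1 + A 0 1 * z⁻¹) (A 1 0 * 1 + A 1 1 * z⁻¹) =
          (QuotientGroup.mk A : PSL2C) • (z : OnePoint ℂ) := by
      filter_upwards [Bornology.eventually_ne_cobounded (0 : ℂ)] with z hz
      rw [← toSphere_one z, mk_smul_toSphere A (by simp), ← toSphere_mul z _ _ hz]
      congr 1 <;> field_simp
    refine Filter.Tendsto.congr' hev ?_
    have hi : Filter.Tendsto (fun z : ℂ => z⁻¹) (Bornology.cobounded ℂ) (nhds 0) :=
      Filter.tendsto_inv₀_cobounded
    exact tendsto_toSphere (tendsto_const_nhds.add (tendsto_const_nhds.mul hi))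
      (tendsto_const_nhds.add (tendsto_const_nhds.mul hi)) (SL2_apply_ne_zero A (by simp))

/-! ### Normal form in an amalgam -/

/-- Products `e b₁ e b₂ ⋯ e bₙ` in which no `bᵢ` with `i < n` lies in `A`. -/
inductive AltWord {G : Type*} [Group G] (A B : Subgroup G) (e : G) : G → Prop
  | single {b : G} (hb : b ∈ B) : AltWord A B e (e * b)
  | cons {b r : G} (hb : b ∈ B) (hbA : b ∉ A) (hr : AltWord A B e r) : AltWord A B e (e * b * r)

/-- The normal form in an amalgam: if `e² ∈ A` and `e` normalises `A ≤ B`, every element of the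
group generated by `B` and `e` lies in `B` or is the product of an element of `B` and an
alternating word. -/
theorem exists_altWord {G : Type*} [Group G] {A B : Subgroup G} {e : G} (hAB : A ≤ B)
    (he : e * e ∈ A) (hconj : ∀ a ∈ A, e * a * e⁻¹ ∈ A) {g : G}
    (hg : g ∈ Subgroup.closure ((B : Set G) ∪ {e})) :
    g ∈ B ∨ ∃ b ∈ B, ∃ r, AltWord A B e r ∧ g = b * r := by
  have hmulB : ∀ b ∈ B, ∀ g, (g ∈ B ∨ ∃ b ∈ B, ∃ r, AltWord A B e r ∧ g = b * r) →
      (b * g ∈ B ∨ ∃ b' ∈ B, ∃ r, AltWord A B e r ∧ b * g = b' * r) := by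
    rintro b hb g (hg | ⟨b', hb', r, hr, rfl⟩)
    · exact Or.inl (B.mul_mem hb hg)
    · exact Or.inr ⟨b * b', B.mul_mem hb hb', r, hr, by rw [mul_assoc]⟩
  have hmule : ∀ g, (g ∈ B ∨ ∃ b ∈ B, ∃ r, AltWord A B e r ∧ g = b * r) →
      (e * g ∈ B ∨ ∃ b' ∈ B, ∃ r, AltWord A B e r ∧ e * g = b' * r) := by
    rintro g (hg | ⟨b, hb, r, hr, rfl⟩)
    · exact Or.inr ⟨1, B.one_mem, e * g, .single hg, by group⟩
    · by_cases hbA : b ∈ A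
      -- Here `e b e = (e b e⁻¹) (e e)` lies in `A`, so the new `e` cancels against the leading `e`
      -- of the alternating word.
      · have h1 : (e * b * e⁻¹) * (e * e) ∈ B :=
          B.mul_mem (hAB (hconj b hbA)) (hAB he)
        cases hr with
        | @single b' hb' =>
          left
          have : e * (b * (e * b')) = (e * b * e⁻¹) * (e * e) * b' := by group
          rw [this]
          exact B.mul_mem h1 hb'
        | @cons b' r' hb' _ hr' =>
          right
          exact ⟨_, B.mul_mem h1 hb', r', hr', by group⟩
      · exact Or.inr ⟨1, B.one_mem, e * b * r, .cons hb hbA hr, by group⟩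
  induction hg using Subgroup.closure_induction_left with
  | one => exact Or.inl B.one_mem
  | mul_left x hx y _ ih =>
    rcases hx with hx | hx
    · exact hmulB x hx _ ih
    · rw [Set.mem_singleton_iff.1 hx]
      exact hmule _ ih
  | inv_mul_cancel x hx y _ ih =>
    rcases hx with hx | hx
    · exact hmulB _ (B.inv_mem hx) _ ih
    · rw [Set.mem_singleton_iff.1 hx]
      have : e⁻¹ * y = (e * e)⁻¹ * (e * y) := by group
      rw [this]
      exact hmulB _ (B.inv_mem (hAB he)) _ (hmule _ ih)

/-! ### The pants group and the axis of `S` -/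

/-- The real diagonal matrix `S` with eigenvalues `exp (± lam)`. -/
noncomputable def diagS (lam : ℝ) : SL(2, ℝ) :=
  ⟨!![Real.exp lam, 0; 0, Real.exp (-lam)], by
    rw [Matrix.det_fin_two_of, ← Real.exp_add]; simp⟩

/-- The half-turn exchanging `exp lam` and `exp (-lam)`. -/
noncomputable def halfTurn (lam : ℝ) (hlam : 0 < lam) : SL(2, ℝ) :=
  ⟨!![1 / Real.sinh lam, -Real.cosh lam / Real.sinh lam;
      Real.cosh lam / Real.sinh lam, -1 / Real.sinh lam], by
    have hs : Real.sinh lam ≠ 0 := (Real.sinh_pos_iff.2 hlam).ne'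
    have := Real.cosh_sq_sub_sinh_sq lam
    rw [Matrix.det_fin_two_of]
    field_simp
    linear_combination this⟩

/-- The group of the matrices `± S ^ k`. -/
noncomputable def diagGroup (lam : ℝ) : Subgroup SL(2, ℝ) where
  carrier := {h | h 0 1 = 0 ∧ h 1 0 = 0 ∧ ∃ k : ℤ, |h 0 0| = Real.exp (k * lam)}
  one_mem' := ⟨by simp, by simp, 0, by simp⟩
  mul_mem' := by
    rintro g h ⟨g1, g2, k, hk⟩ ⟨h1, h2, l, hl⟩
    refine ⟨?_, ?_, k + l, ?_⟩
    · simp [Matrix.mul_apply, Fin.sum_univ_two, g1, h1]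
    · simp [Matrix.mul_apply, Fin.sum_univ_two, g2, h2]
    · simp [Matrix.mul_apply, Fin.sum_univ_two, g1, abs_mul, hk, hl, add_mul, Real.exp_add]
  inv_mem' := by
    rintro g ⟨g1, g2, k, hk⟩
    have hdet : g 0 0 * g 1 1 = 1 := by
      have := g.det_coe; rw [Matrix.det_fin_two, g1] at this; linarith
    refine ⟨?_, ?_, -k, ?_⟩
    · simp [Matrix.SpecialLinearGroup.SL2_inv_expl, g1]
    · simp [Matrix.SpecialLinearGroup.SL2_inv_expl, g2]
    · have h1 : |g 0 0| * |g 1 1| = 1 := by rw [← abs_mul, hdet, abs_one]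
      simp only [Matrix.SpecialLinearGroup.SL2_inv_expl, Matrix.cons_val_zero]
      have h2 := Real.exp_pos (k * lam)
      rw [hk] at h1
      push_cast
      rw [neg_mul, Real.exp_neg]
      simpa using eq_inv_of_mul_eq_one_right h1

/-- The Fuchsian group generated by `S` and the half-turn. -/
noncomputable def pantsGroup (lam : ℝ) (hlam : 0 < lam) : Subgroup SL(2, ℝ) :=
  Subgroup.closure ((diagGroup lam : Set SL(2, ℝ)) ∪ {halfTurn lam hlam})

/-- The shape, up to sign, of the alternating words in `S` and the half-turn. -/
structure AltShape (lam a b c d : ℝ) : Prop where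
  a_pos : 0 < a
  b_pos : 0 < b
  c_pos : 0 < c
  d_pos : 0 < d
  ac : a < Real.exp lam * c
  ca : c < Real.exp lam * a
  bd : b < Real.exp lam * d
  db : d < Real.exp lam * b
  one_le_a : 1 ≤ Real.sinh lam * a
  one_le_d : 1 ≤ Real.sinh lam * d

theorem exp_cosh_sinh (lam : ℝ) : Real.exp lam = Real.cosh lam + Real.sinh lam :=
  (Real.cosh_add_sinh lam).symm

theorem AltShape.base {lam : ℝ} (hlam : 0 < lam) :
    AltShape lam (1 / Real.sinh lam) (Real.cosh lam / Real.sinh lam)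
      (Real.cosh lam / Real.sinh lam) (1 / Real.sinh lam) := by
  have hs := Real.sinh_pos_iff.2 hlam
  have hC := Real.one_lt_cosh.2 hlam.ne'
  have he := exp_cosh_sinh lam
  have h1 : 1 / Real.sinh lam < Real.exp lam * (Real.cosh lam / Real.sinh lam) := by
    rw [mul_div_assoc', div_lt_div_iff_of_pos_right hs, he]
    nlinarith
  have h2 : Real.cosh lam / Real.sinh lam < Real.exp lam * (1 / Real.sinh lam) := by
    rw [mul_div_assoc', div_lt_div_iff_of_pos_right hs, he]
    linarith
  exact ⟨by positivity, by positivity, by positivity, by positivity, h1, h2, h2, h1,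
    by field_simp; rfl, by field_simp; rfl⟩

/-- Multiplication by the half-turn after a nontrivial positive power of `S`. -/
theorem AltShape.step_pos {lam a b c d B : ℝ} (hlam : 0 < lam) (h : AltShape lam a b c d)
    (hB : Real.exp lam ≤ B) :
    AltShape lam ((B * a - Real.cosh lam * (B⁻¹ * c)) / Real.sinh lam)
      ((B * b - Real.cosh lam * (B⁻¹ * d)) / Real.sinh lam)
      ((Real.cosh lam * (B * a) - B⁻¹ * c) / Real.sinh lam)
      ((Real.cosh lam * (B * b) - B⁻¹ * d) / Real.sinh lam) := by
  obtain ⟨ha, hb, hc, hd, hac, hca, hbd, hdb, h1a, h1d⟩ := h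
  have hs := Real.sinh_pos_iff.2 hlam
  have hC := Real.one_lt_cosh.2 hlam.ne'
  have he := exp_cosh_sinh lam
  have hE : 0 < Real.exp lam := Real.exp_pos _
  have hcs := Real.cosh_sq_sub_sinh_sq lam
  have hB0 : 0 < B := hE.trans_le hB
  have hBi : B⁻¹ * Real.exp lam ≤ 1 := by
    rw [inv_mul_le_iff₀ hB0]; linarith
  have hBi0 : 0 < B⁻¹ := inv_pos.2 hB0
  have hca' : B⁻¹ * c < a := by
    calc B⁻¹ * c < B⁻¹ * (Real.exp lam * a) := by gcongr
      _ = B⁻¹ * Real.exp lam * a := by ring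
      _ ≤ 1 * a := by gcongr
      _ = a := one_mul a
  have hdb' : B⁻¹ * d < b := by
    calc B⁻¹ * d < B⁻¹ * (Real.exp lam * b) := by gcongr
      _ = B⁻¹ * Real.exp lam * b := by ring
      _ ≤ 1 * b := by gcongr
      _ = b := one_mul b
  have hBa : Real.exp lam * a ≤ B * a := by gcongr
  have hBb : Real.exp lam * b ≤ B * b := by gcongr
  have hDd : d < B * b := hdb.trans_le hBb
  -- This serves the bound `one_le_d`: since `exp (-λ) = cosh λ - sinh λ` and `d < B b`, one gets
  -- `cosh λ * (B b) - B⁻¹ d > sinh λ * d`.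
  have hd2 : B⁻¹ * d ≤ (Real.cosh lam - Real.sinh lam) * d := by
    rw [Real.cosh_sub_sinh, Real.exp_neg]
    gcongr
  have hc' : 0 < B⁻¹ * c := by positivity
  have hd' : 0 < B⁻¹ * d := by positivity
  generalize B⁻¹ * c = c' at *
  generalize B⁻¹ * d = d' at *
  generalize B * a = A at *
  generalize B * b = D at *
  generalize Real.cosh lam = C at *
  generalize hsd : Real.sinh lam = s at *
  rw [he] at hBa hBb
  clear hB hBi hac hca hbd hdb hE
  -- In `k1` to `k4`, `x` is an entry of the top row, `y` is `B⁻¹` times the entry below it and `z`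
  -- is `B` times `x`. Both columns obey the same inequalities, so each bound is proved once.
  have k1 : ∀ x y z : ℝ, 0 < x → y < x → (C + s) * x ≤ z → s * x ≤ z - C * y := by
    intro x y z hx hy hz
    nlinarith
  have k2 : ∀ x y z : ℝ, 0 < x → y < x → (C + s) * x ≤ z → s * x ≤ C * z - y := by
    intro x y z hx hy hz
    nlinarith [mul_pos hs hx, mul_pos (sub_pos.2 hC) hx]
  have k3 : ∀ x y z : ℝ, 0 < x → 0 < y → y < x → (C + s) * x ≤ z →
      z - C * y < (C + s) * (C * z - y) := by
    intro x y z hx hy0 hy hz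
    have : (C + s) * (C * z - y) - (z - C * y) = s * ((C + s) * z - y) := by
      linear_combination (-z) * hcs + 2 * z * hcs
    have hxz : x ≤ z := by nlinarith
    have h2 : y < (C + s) * z := by nlinarith [hx.trans_le hxz]
    nlinarith [mul_pos hs (sub_pos.2 h2)]
  have k4 : ∀ x y z : ℝ, 0 < x → 0 < y → y < x → (C + s) * x ≤ z →
      C * z - y < (C + s) * (z - C * y) := by
    intro x y z hx hy0 hy hz
    have : (C + s) * (z - C * y) - (C * z - y) = s * (z - (C + s) * y) := by
      linear_combination y * hcs - 2 * y * hcs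
    have h2 : (C + s) * y < z := by nlinarith
    nlinarith [mul_pos hs (sub_pos.2 h2)]
  have m : ∀ u v : ℝ, u < (C + s) * v → u / s < Real.exp lam * (v / s) := by
    intro u v huv
    rw [he, mul_div_assoc', div_lt_div_iff_of_pos_right hs]
    exact huv
  have hsa := mul_pos hs ha
  have hsb := mul_pos hs hb
  refine ⟨div_pos (hsa.trans_le (k1 _ _ _ ha hca' hBa)) hs,
    div_pos (hsb.trans_le (k1 _ _ _ hb hdb' hBb)) hs,
    div_pos (hsa.trans_le (k2 _ _ _ ha hca' hBa)) hs,
    div_pos (hsb.trans_le (k2 _ _ _ hb hdb' hBb)) hs,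
    m _ _ (k3 _ _ _ ha hc' hca' hBa), m _ _ (k4 _ _ _ ha hc' hca' hBa),
    m _ _ (k3 _ _ _ hb hd' hdb' hBb), m _ _ (k4 _ _ _ hb hd' hdb' hBb), ?_, ?_⟩
  · rw [hsd, mul_div_cancel₀ _ hs.ne']
    exact h1a.trans (k1 _ _ _ ha hca' hBa)
  · rw [hsd, mul_div_cancel₀ _ hs.ne']
    refine h1d.trans ?_
    nlinarith [mul_lt_mul_of_pos_left hDd (zero_lt_one.trans hC)]

theorem AltShape.symm {lam a b c d : ℝ} (h : AltShape lam a b c d) : AltShape lam d c b a :=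
  ⟨h.d_pos, h.c_pos, h.b_pos, h.a_pos, h.db, h.bd, h.ca, h.ac, h.one_le_d, h.one_le_a⟩

/-- An element of `pantsGroup` has the shape of an alternating word, up to sign. -/
def IsAltMatrix (lam : ℝ) (h : SL(2, ℝ)) : Prop :=
  ∃ a b c d ε : ℝ, AltShape lam a b c d ∧ (ε = 1 ∨ ε = -1) ∧
    h 0 0 = ε * a ∧ h 0 1 = -(ε * b) ∧ h 1 0 = ε * c ∧ h 1 1 = -(ε * d)

theorem abs_eq_sign_mul {x y : ℝ} (h : |x| = y) : ∃ ε : ℝ, (ε = 1 ∨ ε = -1) ∧ x = ε * y := by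
  rcases abs_choice x with h' | h'
  · exact ⟨1, Or.inl rfl, by linarith⟩
  · exact ⟨-1, Or.inr rfl, by linarith⟩

/-- An element of `diagGroup` is `± diag (B, B⁻¹)` with `B = exp (k lam)`. -/
theorem diagGroup_entries {lam : ℝ} {h : SL(2, ℝ)} (hh : h ∈ diagGroup lam) :
    ∃ (k : ℤ) (ε : ℝ), (ε = 1 ∨ ε = -1) ∧ h 0 0 = ε * Real.exp (k * lam) ∧ h 0 1 = 0 ∧
      h 1 0 = 0 ∧ h 1 1 = ε * (Real.exp (k * lam))⁻¹ := by
  obtain ⟨h1, h2, k, hk⟩ := hh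
  obtain ⟨ε, hε, h3⟩ := abs_eq_sign_mul hk
  refine ⟨k, ε, hε, h3, h1, h2, ?_⟩
  have hdet : h 0 0 * h 1 1 = 1 := by
    have := h.det_coe; rw [Matrix.det_fin_two, h1] at this; linarith
  have hpos := Real.exp_pos (k * lam)
  rw [h3] at hdet
  rw [eq_comm, ← div_eq_mul_inv, div_eq_iff hpos.ne']
  rcases hε with rfl | rfl <;> linarith

theorem eq_one_or_neg_one_of_mem_zpowers {h : SL(2, ℝ)}
    (hh : h ∈ Subgroup.zpowers (-1 : SL(2, ℝ))) : h = 1 ∨ h = -1 := by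
  obtain ⟨n, rfl⟩ := hh
  rcases n.even_or_odd with hn | hn
  · left; simp [hn.neg_one_zpow]
  · right; simp [hn.neg_one_zpow]

theorem eq_pm_one_of_diag {h : SL(2, ℝ)} {ε : ℝ} (hε : ε = 1 ∨ ε = -1) (h00 : h 0 0 = ε)
    (h01 : h 0 1 = 0) (h10 : h 1 0 = 0) (h11 : h 1 1 = ε) :
    h ∈ Subgroup.zpowers (-1 : SL(2, ℝ)) := by
  rcases hε with rfl | rfl
  · have : h = 1 := by
      ext i j; fin_cases i <;> fin_cases j <;> simp [h00, h01, h10, h11]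
    rw [this]; exact Subgroup.one_mem _
  · have : h = -1 := by
      ext i j; fin_cases i <;> fin_cases j <;> simp [h00, h01, h10, h11]
    rw [this]; exact Subgroup.mem_zpowers _

/-- In the shape `± (a, -b; c, -d)`, the ratios `a / c` and `b / d` are the images of `∞` and `0`;
`AltShape` confines them to the interval `(exp (-λ), exp λ)`. A power `S ^ k` with `k ≠ 0` moves
this interval off itself, and the half-turn sends its exterior back inside. The last diagonal factor
of a word is not controlled, hence the correction `b`. -/
theorem AltWord.isAltMatrix {lam : ℝ} (hlam : 0 < lam) {h : SL(2, ℝ)}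
    (hh : AltWord (Subgroup.zpowers (-1)) (diagGroup lam) (halfTurn lam hlam) h) :
    ∃ b ∈ diagGroup lam, IsAltMatrix lam (h * b) := by
  have hs : Real.sinh lam ≠ 0 := (Real.sinh_pos_iff.2 hlam).ne'
  induction hh with
  | @single b hb =>
    refine ⟨b⁻¹, (diagGroup lam).inv_mem hb, ?_⟩
    rw [mul_inv_cancel_right]
    refine ⟨_, _, _, _, 1, AltShape.base hlam, Or.inl rfl, ?_, ?_, ?_, ?_⟩ <;>
      simp [halfTurn, neg_div]
  | @cons b r hb hbA _ ih =>
    obtain ⟨b', hb', a, c₁, c, d, ε, hsh, hε, h00, h01, h10, h11⟩ := ih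
    refine ⟨b', hb', ?_⟩
    obtain ⟨k, δ, hδ, g00, g01, g10, g11⟩ := diagGroup_entries hb
    have hE := Real.exp_pos (k * lam)
    have hk : k ≠ 0 := by
      rintro rfl
      apply hbA
      simp only [Int.cast_zero, zero_mul, Real.exp_zero, inv_one, mul_one] at g00 g11
      exact eq_pm_one_of_diag hδ g00 g01 g10 g11
    have hεδ : ε * δ = 1 ∨ ε * δ = -1 := by
      rcases hε with rfl | rfl <;> rcases hδ with rfl | rfl <;> norm_num
    have hassoc : halfTurn lam hlam * b * r * b' = halfTurn lam hlam * (b * (r * b')) := by group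
    rw [hassoc]
    have ent : ∀ i j, (halfTurn lam hlam * (b * (r * b'))) i j =
        halfTurn lam hlam i 0 * (b 0 0 * (r * b') 0 j + b 0 1 * (r * b') 1 j) +
          halfTurn lam hlam i 1 * (b 1 0 * (r * b') 0 j + b 1 1 * (r * b') 1 j) := by
      intro i j
      simp only [Matrix.SpecialLinearGroup.coe_mul, Matrix.mul_apply, Fin.sum_univ_two]
    have t00 : halfTurn lam hlam 0 0 = 1 / Real.sinh lam := rfl
    have t01 : halfTurn lam hlam 0 1 = -Real.cosh lam / Real.sinh lam := rfl
    have t10 : halfTurn lam hlam 1 0 = Real.cosh lam / Real.sinh lam := rfl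
    have t11 : halfTurn lam hlam 1 1 = -1 / Real.sinh lam := rfl
    rcases lt_or_gt_of_ne hk with hk | hk
    · have hB : Real.exp lam ≤ (Real.exp (k * lam))⁻¹ := by
        rw [← Real.exp_neg]
        apply Real.exp_le_exp.2
        have : (k : ℝ) ≤ -1 := by exact_mod_cast Int.le_sub_one_of_lt hk
        nlinarith
      -- Negative powers reduce to positive ones by conjugating with `z ↦ 1 / z`, which inverts `S`,
      -- reverses the four entries and changes the overall sign.
      refine ⟨_, _, _, _, -(ε * δ), (hsh.symm.step_pos hlam hB).symm, ?_, ?_, ?_, ?_, ?_⟩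
      · rcases hεδ with h | h <;> simp [h]
      all_goals
        rw [ent]
        simp only [h00, h01, h10, h11, g00, g01, g10, g11, t00, t01, t10, t11, inv_inv]
        field_simp
        ring
    · have hB : Real.exp lam ≤ Real.exp (k * lam) := by
        apply Real.exp_le_exp.2
        have : (1 : ℝ) ≤ k := by exact_mod_cast hk
        nlinarith
      refine ⟨_, _, _, _, ε * δ, hsh.step_pos hlam hB, hεδ, ?_, ?_, ?_, ?_⟩
      all_goals
        rw [ent]
        simp only [h00, h01, h10, h11, g00, g01, g10, g11, t00, t01, t10, t11]
        field_simp
        ring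

theorem halfTurn_mul_self {lam : ℝ} (hlam : 0 < lam) :
    halfTurn lam hlam * halfTurn lam hlam = -1 := by
  have hs : Real.sinh lam ≠ 0 := (Real.sinh_pos_iff.2 hlam).ne'
  have hcs := Real.cosh_sq_sub_sinh_sq lam
  have t00 : halfTurn lam hlam 0 0 = 1 / Real.sinh lam := rfl
  have t01 : halfTurn lam hlam 0 1 = -Real.cosh lam / Real.sinh lam := rfl
  have t10 : halfTurn lam hlam 1 0 = Real.cosh lam / Real.sinh lam := rfl
  have t11 : halfTurn lam hlam 1 1 = -1 / Real.sinh lam := rfl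
  ext i j
  rw [Matrix.SpecialLinearGroup.coe_mul, Matrix.mul_apply, Fin.sum_univ_two]
  fin_cases i <;> fin_cases j <;> simp only [Fin.zero_eta, Fin.mk_one, t00, t01, t10, t11] <;>
    simp <;> field_simp <;> linarith

/-- Elements of the pants group are diagonal, or alternating up to diagonal factors. -/
theorem pantsGroup_cases {lam : ℝ} (hlam : 0 < lam) {h : SL(2, ℝ)} (hh : h ∈ pantsGroup lam hlam) :
    h ∈ diagGroup lam ∨ ∃ b ∈ diagGroup lam, ∃ b' ∈ diagGroup lam, ∃ M, IsAltMatrix lam M ∧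
      h = b * M * b' := by
  have hle : Subgroup.zpowers (-1 : SL(2, ℝ)) ≤ diagGroup lam := by
    intro x hx
    rcases eq_one_or_neg_one_of_mem_zpowers hx with rfl | rfl
    · exact Subgroup.one_mem _
    · exact ⟨by simp, by simp, 0, by simp⟩
  have hconj : ∀ a ∈ Subgroup.zpowers (-1 : SL(2, ℝ)),
      halfTurn lam hlam * a * (halfTurn lam hlam)⁻¹ ∈ Subgroup.zpowers (-1 : SL(2, ℝ)) := by
    intro a ha
    rcases eq_one_or_neg_one_of_mem_zpowers ha with rfl | rfl
    · simp
    · simp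
  rcases exists_altWord hle (by rw [halfTurn_mul_self]; exact Subgroup.mem_zpowers _) hconj hh with
    h1 | ⟨b, hb, r, hr, rfl⟩
  · exact Or.inl h1
  · obtain ⟨b', hb', hM⟩ := hr.isAltMatrix hlam
    exact Or.inr ⟨b, hb, b'⁻¹, (diagGroup lam).inv_mem hb', _, hM, by group⟩

theorem mul_entries {R : Type*} [CommRing R] (g h : SL(2, R)) (i j : Fin 2) :
    (g * h) i j = g i 0 * h 0 j + g i 1 * h 1 j := by
  rw [Matrix.SpecialLinearGroup.coe_mul, Matrix.mul_apply, Fin.sum_univ_two]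

theorem sl2_det {R : Type*} [CommRing R] (h : SL(2, R)) : h 0 0 * h 1 1 - h 0 1 * h 1 0 = 1 := by
  have := h.det_coe; rwa [Matrix.det_fin_two] at this

/-- The quantitative form of the precise invariance of the axis of `S` in the pants group. -/
theorem pantsGroup_sign {lam : ℝ} (hlam : 0 < lam) {h : SL(2, ℝ)} (hh : h ∈ pantsGroup lam hlam)
    (hd : h ∉ diagGroup lam) :
    0 < h 0 0 * h 1 0 ∧ 0 < h 0 1 * h 1 1 ∧ 1 ≤ Real.sinh lam ^ 2 * -(h 0 0 * h 1 1) := by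
  obtain h1 | ⟨b, hb, b', hb', M, ⟨p, q, r, t, ε, hsh, hε, h00, h01, h10, h11⟩, rfl⟩ :=
    pantsGroup_cases hlam hh
  · exact absurd h1 hd
  obtain ⟨k, δ, hδ, g00, g01, g10, g11⟩ := diagGroup_entries hb
  obtain ⟨k', δ', hδ', g00', g01', g10', g11'⟩ := diagGroup_entries hb'
  -- The signs square to one. A left factor `diag (E, E⁻¹)` preserves the product of the two entries
  -- of a column, a right factor multiplies it by a positive square, and neither affects `h 0 0 * h
  -- 1 1`.
  have hε2 : ε * ε = 1 := by rcases hε with rfl | rfl <;> norm_num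
  have hδ2 : δ * δ = 1 := by rcases hδ with rfl | rfl <;> norm_num
  have hδ2' : δ' * δ' = 1 := by rcases hδ' with rfl | rfl <;> norm_num
  simp only [mul_entries, h00, h01, h10, h11, g00, g01, g10, g11, g00', g01', g10', g11']
  have hp := hsh.a_pos
  have hq := hsh.b_pos
  have hr := hsh.c_pos
  have ht := hsh.d_pos
  have hs := Real.sinh_pos_iff.2 hlam
  have hE := Real.exp_pos (k * lam)
  have hE' := Real.exp_pos (k' * lam)
  generalize Real.exp (k * lam) = E at *
  generalize Real.exp (k' * lam) = E' at *
  have hEE : E * E⁻¹ = 1 := mul_inv_cancel₀ hE.ne'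
  have hEE' : E' * E'⁻¹ = 1 := mul_inv_cancel₀ hE'.ne'
  refine ⟨?_, ?_, ?_⟩
  · have : 0 < (E' * E') * p * r := by positivity
    convert! this using 1
    linear_combination (p * r * E' * E' * E * E⁻¹) * (ε * ε * δ * δ * hδ2' + ε * ε * hδ2 + hε2) +
      p * r * E' * E' * hEE
  · have : 0 < (E'⁻¹ * E'⁻¹) * q * t := by positivity
    convert! this using 1
    linear_combination (q * t * E'⁻¹ * E'⁻¹ * E * E⁻¹) *
      (ε * ε * δ * δ * hδ2' + ε * ε * hδ2 + hε2) + q * t * E'⁻¹ * E'⁻¹ * hEE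
  · have : 1 ≤ (Real.sinh lam * p) * (Real.sinh lam * t) := by
      nlinarith [hsh.one_le_a, hsh.one_le_d]
    convert! this using 1
    linear_combination (Real.sinh lam ^ 2 * p * t * E * E⁻¹ * E' * E'⁻¹) *
      (ε * ε * δ * δ * hδ2' + ε * ε * hδ2 + hε2) + Real.sinh lam ^ 2 * p * t * E' * E'⁻¹ * hEE +
      Real.sinh lam ^ 2 * p * t * hEE'

/-- The orbit of the parabolic fixed point `exp lam` under the pants group is positive. -/
theorem pantsGroup_cusp_pos {lam : ℝ} (hlam : 0 < lam) {h : SL(2, ℝ)}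
    (hh : h ∈ pantsGroup lam hlam) :
    0 < (h 0 0 * Real.exp lam + h 0 1) * (h 1 0 * Real.exp lam + h 1 1) := by
  have hE1 := Real.exp_pos lam
  obtain h1 | ⟨b, hb, b', hb', M, ⟨p, q, r, t, ε, hsh, hε, h00, h01, h10, h11⟩, hinv⟩ :=
    -- The normal form is applied to the inverse, because the zero and the pole of `M⁻¹` are `b / d`
    -- and `a / c`, the ratios that `AltShape` controls; those of `M` are `b / a` and `d / c`.
    pantsGroup_cases hlam ((pantsGroup lam hlam).inv_mem hh)
  · have h2 := (diagGroup lam).inv_mem h1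
    rw [inv_inv] at h2
    obtain ⟨k, δ, hδ, g00, g01, g10, g11⟩ := diagGroup_entries h2
    rw [g00, g01, g10, g11]
    have hE := Real.exp_pos (k * lam)
    have hδ2 : δ * δ = 1 := by rcases hδ with rfl | rfl <;> norm_num
    have : (δ * Real.exp (k * lam) * Real.exp lam + 0) *
        (0 * Real.exp lam + δ * (Real.exp (k * lam))⁻¹) = Real.exp lam := by
      linear_combination Real.exp lam * hδ2 +
        δ * δ * Real.exp lam * mul_inv_cancel₀ hE.ne'
    rw [this]
    exact hE1
  · have hinv' : h = b'⁻¹ * (M⁻¹ * b⁻¹) := by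
      rw [← inv_inv h, hinv]; group
    obtain ⟨k, δ, hδ, g00, g01, g10, g11⟩ := diagGroup_entries ((diagGroup lam).inv_mem hb)
    obtain ⟨k', δ', hδ', g00', g01', g10', g11'⟩ :=
      diagGroup_entries ((diagGroup lam).inv_mem hb')
    have m00 : M⁻¹ 0 0 = M 1 1 := by simp [Matrix.SpecialLinearGroup.SL2_inv_expl]
    have m01 : M⁻¹ 0 1 = -M 0 1 := by simp [Matrix.SpecialLinearGroup.SL2_inv_expl]
    have m10 : M⁻¹ 1 0 = -M 1 0 := by simp [Matrix.SpecialLinearGroup.SL2_inv_expl]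
    have m11 : M⁻¹ 1 1 = M 0 0 := by simp [Matrix.SpecialLinearGroup.SL2_inv_expl]
    have hε2 : ε * ε = 1 := by rcases hε with rfl | rfl <;> norm_num
    have hδ2 : δ * δ = 1 := by rcases hδ with rfl | rfl <;> norm_num
    have hδ2' : δ' * δ' = 1 := by rcases hδ' with rfl | rfl <;> norm_num
    -- The diagonal factor sends the cusp to an odd power of `exp λ`, which is at least `exp λ` or
    -- at most `exp (-λ)`. It therefore lies outside the open interval containing both the zero and
    -- the pole of `M⁻¹`.
    have hk : Real.exp lam * (Real.exp (k * lam) * Real.exp lam) ≤ (Real.exp (k * lam))⁻¹ ∨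
        (Real.exp (k * lam))⁻¹ ≤ Real.exp (k * lam) := by
      rw [← Real.exp_neg, ← Real.exp_add, ← Real.exp_add]
      rcases lt_or_ge k 0 with hk | hk
      · left
        apply Real.exp_le_exp.2
        have : (k : ℝ) ≤ -1 := by exact_mod_cast Int.le_sub_one_of_lt hk
        nlinarith
      · right
        apply Real.exp_le_exp.2
        have : (0 : ℝ) ≤ k := by exact_mod_cast hk
        nlinarith
    obtain ⟨hp, hq, hr, ht, hac, hca, hbd, hdb, -, -⟩ := hsh
    have hE := Real.exp_pos (k * lam)
    have hE' := Real.exp_pos (k' * lam)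
    simp only [hinv', mul_entries, m00, m01, m10, m11, h00, h01, h10, h11, g00, g01, g10, g11,
      g00', g01', g10', g11']
    generalize Real.exp (k * lam) = E at *
    generalize Real.exp (k' * lam) = E' at *
    have hEE' : E' * E'⁻¹ = 1 := mul_inv_cancel₀ hE'.ne'
    have hEi := inv_pos.2 hE
    generalize E⁻¹ = I at *
    generalize Real.exp lam = x at *
    have key : 0 < (q * I - t * E * x) * (p * I - r * E * x) := by
      have hEx := mul_pos hE hE1
      rcases hk with hk | hk
      · have h1 : t * (E * x) < x * q * (E * x) := mul_lt_mul_of_pos_right hdb hEx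
        have h2 : r * (E * x) < x * p * (E * x) := mul_lt_mul_of_pos_right hca hEx
        have h3 : q * (x * (E * x)) ≤ q * I := mul_le_mul_of_nonneg_left hk hq.le
        have h4 : p * (x * (E * x)) ≤ p * I := mul_le_mul_of_nonneg_left hk hp.le
        exact mul_pos (by linarith) (by linarith)
      · have h1 : q * E < x * t * E := mul_lt_mul_of_pos_right hbd hE
        have h2 : p * E < x * r * E := mul_lt_mul_of_pos_right hac hE
        have h3 : q * I ≤ q * E := mul_le_mul_of_nonneg_left hk hq.le
        have h4 : p * I ≤ p * E := mul_le_mul_of_nonneg_left hk hp.le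
        exact mul_pos_of_neg_of_neg (by linarith) (by linarith)
    convert! key using 1
    linear_combination ((q * I - t * E * x) * (p * I - r * E * x) * E' * E'⁻¹) *
      (ε * ε * δ * δ * hδ2' + ε * ε * hδ2 + hε2) + (q * I - t * E * x) * (p * I - r * E * x) * hEE'

/-! ### Bending, and the side of a circle as a ping-pong domain -/

section

open Matrix ComplexConjugate

/-- The inclusion of `SL(2, ℝ)` in the group of `SL(2, ℂ)`-valued functions as constants. -/
noncomputable def constSL : SL(2, ℝ) →* (ℂ → SL(2, ℂ)) :=
  (Pi.constMonoidHom ℂ SL(2, ℂ)).comp (Matrix.SpecialLinearGroup.map Complex.ofRealHom)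

theorem constSL_apply (h : SL(2, ℝ)) (σ : ℂ) (i j : Fin 2) : constSL h σ i j = (h i j : ℂ) := rfl

/-- The half-turn `z ↦ - exp (-σ) / z`, exchanging the two sides of the axis of `S`. -/
noncomputable def bendTurn (σ : ℂ) : SL(2, ℂ) :=
  ⟨!![0, -Complex.exp (-(σ / 2)); Complex.exp (σ / 2), 0], by
    rw [Matrix.det_fin_two_of, Complex.exp_neg]
    field_simp
    ring⟩

/-- The holomorphic family of groups generated by the pants group and the bending half-turn. -/
noncomputable def motionGroup (lam : ℝ) (hlam : 0 < lam) : Subgroup (ℂ → SL(2, ℂ)) :=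
  Subgroup.closure ((((pantsGroup lam hlam).map constSL : Subgroup _) : Set (ℂ → SL(2, ℂ))) ∪
    {bendTurn})

/-- The sign of `sideForm σ v` tells on which side of the circle through `0` and `∞` the point
with homogeneous coordinates `v` lies. -/
noncomputable def sideForm (σ : ℂ) (v : Fin 2 → ℂ) : ℝ :=
  Real.cos (σ.im / 2) * (v 0 * conj (v 1)).re - Real.sin (σ.im / 2) * (v 0 * conj (v 1)).im

theorem sideForm_smul (σ μ : ℂ) (v : Fin 2 → ℂ) :
    sideForm σ (μ • v) = Complex.normSq μ * sideForm σ v := by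
  simp only [sideForm, Pi.smul_apply, smul_eq_mul, map_mul, Complex.mul_re, Complex.mul_im,
    Complex.conj_re, Complex.conj_im, Complex.normSq_apply]
  ring

theorem mulVec_apply_fin_two {R : Type*} [CommRing R] (g : Matrix (Fin 2) (Fin 2) R)
    (v : Fin 2 → R) (i : Fin 2) : (g *ᵥ v) i = g i 0 * v 0 + g i 1 * v 1 := by
  rw [Matrix.mulVec, dotProduct, Fin.sum_univ_two]

/-- With `q = v 0 * conj (v 1)`, `sideForm` is the real part of `exp (i Im σ / 2) q`. The half-turn
replaces `q` by `-exp (-i Im σ) * conj q`, so `exp (i Im σ / 2) q` becomes minus its own conjugate.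
-/
theorem sideForm_bendTurn (σ : ℂ) (v : Fin 2 → ℂ) :
    sideForm σ ((bendTurn σ).1 *ᵥ v) = -sideForm σ v := by
  have e : Complex.exp (-(σ / 2)) * conj (Complex.exp (σ / 2)) =
      Complex.exp (-(σ.im : ℂ) * Complex.I) := by
    rw [← Complex.exp_conj, ← Complex.exp_add]
    rw [map_div₀, map_ofNat]
    congr 1
    apply Complex.ext <;> simp; ring
  have h0 : ((bendTurn σ).1 *ᵥ v) 0 = -Complex.exp (-(σ / 2)) * v 1 := by
    rw [mulVec_apply_fin_two]; simp [bendTurn]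
  have h1 : ((bendTurn σ).1 *ᵥ v) 1 = Complex.exp (σ / 2) * v 0 := by
    rw [mulVec_apply_fin_two]; simp [bendTurn]
  have hq : ((bendTurn σ).1 *ᵥ v) 0 * conj (((bendTurn σ).1 *ᵥ v) 1) =
      -(Complex.exp (-(σ.im : ℂ) * Complex.I) * conj (v 0 * conj (v 1))) := by
    rw [h0, h1, ← e]
    simp only [map_mul, Complex.conj_conj]
    ring
  have hc : σ.im = 2 * (σ.im / 2) := by ring
  have hexp : Complex.exp (-(σ.im : ℂ) * Complex.I) =
      ((Real.cos (σ.im) : ℝ) : ℂ) - (Real.sin (σ.im) : ℝ) * Complex.I := by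
    rw [Complex.exp_mul_I, Complex.cos_neg, Complex.sin_neg]
    push_cast
    ring
  unfold sideForm
  rw [hq, hexp]
  generalize v 0 * conj (v 1) = q
  simp only [Complex.neg_re, Complex.neg_im, Complex.mul_re, Complex.mul_im, Complex.sub_re,
    Complex.sub_im, Complex.ofReal_re, Complex.ofReal_im, Complex.I_re, Complex.I_im,
    Complex.conj_re, Complex.conj_im]
  rw [hc, Real.cos_two_mul, Real.sin_two_mul, ← hc]
  have := Real.sin_sq_add_cos_sq (σ.im / 2)
  linear_combination (-2 * q.re * Real.cos (σ.im / 2)) * this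

/-- The effect of a real matrix on `x * conj y`. -/
theorem real_mulVec_re_im (h : SL(2, ℝ)) (σ : ℂ) (v : Fin 2 → ℂ) :
    (((constSL h σ).1 *ᵥ v) 0 * conj (((constSL h σ).1 *ᵥ v) 1)).re =
        h 0 0 * h 1 0 * Complex.normSq (v 0) + h 0 1 * h 1 1 * Complex.normSq (v 1) +
          (h 0 0 * h 1 1 + h 0 1 * h 1 0) * (v 0 * conj (v 1)).re ∧
      (((constSL h σ).1 *ᵥ v) 0 * conj (((constSL h σ).1 *ᵥ v) 1)).im =
        (v 0 * conj (v 1)).im := by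
  have hdet := sl2_det h
  have h0 : ((constSL h σ).1 *ᵥ v) 0 = h 0 0 * v 0 + h 0 1 * v 1 := by
    rw [mulVec_apply_fin_two]; rfl
  have h1 : ((constSL h σ).1 *ᵥ v) 1 = h 1 0 * v 0 + h 1 1 * v 1 := by
    rw [mulVec_apply_fin_two]; rfl
  rw [h0, h1]
  simp only [map_add, map_mul, Complex.conj_ofReal, Complex.mul_re, Complex.mul_im,
    Complex.add_re, Complex.add_im, Complex.ofReal_re, Complex.ofReal_im, Complex.conj_re,
    Complex.conj_im, Complex.normSq_apply]
  constructor
  · ring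
  · linear_combination ((v 0).im * (v 1).re - (v 0).re * (v 1).im) * hdet

theorem normSq_mul_conj (x y : ℂ) :
    (x * conj y).re ^ 2 + (x * conj y).im ^ 2 = Complex.normSq x * Complex.normSq y := by
  have := Complex.normSq_apply (x * conj y)
  rw [Complex.normSq_mul, Complex.normSq_conj] at this
  linarith

theorem sideForm_diag {lam : ℝ} {h : SL(2, ℝ)} (hh : h ∈ diagGroup lam) (σ : ℂ) (v : Fin 2 → ℂ) :
    sideForm σ ((constSL h σ).1 *ᵥ v) = sideForm σ v := by
  obtain ⟨h1, h2, -⟩ := hh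
  have hdet := sl2_det h
  have := real_mulVec_re_im h σ v
  rw [h1] at hdet
  unfold sideForm
  rw [this.1, this.2, h1, h2]
  linear_combination Real.cos (σ.im / 2) * (v 0 * conj (v 1)).re * hdet

/-- The real inequality behind the disjointness of the discs. -/
theorem disc_disjoint_aux {k l A B m X Y q₁ q₂ : ℝ} (hk : 0 < k) (hkl : k ^ 2 + l ^ 2 = 1)
    (hA : 0 < A) (hB : 0 < B) (hm : 0 < m) (hAB : A * B = m * (m + 1)) (hkm : 1 < k ^ 2 * (m + 1))
    (hX : 0 ≤ X) (hY : 0 ≤ Y) (hXY : 0 < X + Y) (hq : q₁ ^ 2 + q₂ ^ 2 = X * Y)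
    (hs : k * q₁ - l * q₂ ≤ 0) : 0 < k * (A * X + B * Y + -(2 * m + 1) * q₁) - l * q₂ := by
  -- `(s, t)` is `(q₁, q₂)` rotated by half the bending angle: `s` is the side form of the original
  -- point, and `t ^ 2 ≤ X Y`.
  set s := k * q₁ - l * q₂ with hs'
  set t := l * q₁ + k * q₂ with ht'
  have hst : s ^ 2 + t ^ 2 = X * Y := by
    rw [← hq, hs', ht']; linear_combination (q₁ ^ 2 + q₂ ^ 2) * hkl
  have hform : k * (A * X + B * Y + -(2 * m + 1) * q₁) - l * q₂ =
      k * (A * X + B * Y - 2 * l * t * (m + 1)) - s * ((2 * m + 2) * k ^ 2 - 1) := by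
    rw [hs', ht']
    linear_combination (2 * k * m * q₁ + 2 * k * q₁) * hkl
  have hpos : 0 < A * X + B * Y := by
    rcases hX.lt_or_eq with h | h
    · nlinarith [mul_pos hA h, mul_nonneg hB.le hY]
    · have : 0 < Y := by linarith
      nlinarith [mul_pos hB this]
  -- The arithmetic-geometric mean inequality gives `A X + B Y ≥ 2 √(m (m + 1) X Y)`. This beats the
  -- term in `t` because `1 < k ^ 2 (m + 1)` is the same as `l ^ 2 (m + 1) < m`.
  have hsq : (2 * l * t * (m + 1)) ^ 2 < (A * X + B * Y) ^ 2 := by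
    have h1 : 4 * (m * (m + 1)) * (X * Y) ≤ (A * X + B * Y) ^ 2 := by
      rw [← hAB]; nlinarith [sq_nonneg (A * X - B * Y)]
    have h2 : l ^ 2 * (m + 1) < m := by nlinarith
    have h3 : (2 * l * t * (m + 1)) ^ 2 = 4 * (m + 1) * (l ^ 2 * (m + 1)) * t ^ 2 := by ring
    rw [h3]
    rcases (sq_nonneg t).lt_or_eq with ht | ht
    · have h4 : 4 * (m + 1) * (l ^ 2 * (m + 1)) * t ^ 2 < 4 * (m + 1) * m * t ^ 2 := by
        gcongr
      have h5 : 4 * (m + 1) * m * t ^ 2 ≤ 4 * (m + 1) * m * (X * Y) := by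
        gcongr
        nlinarith [sq_nonneg s]
      linarith
    · rw [← ht, mul_zero]
      positivity
  have h6 := (abs_lt.1 (abs_lt_of_sq_lt_sq hsq hpos.le)).2
  rw [hform]
  have h7 : 0 < k * (A * X + B * Y - 2 * l * t * (m + 1)) := mul_pos hk (by linarith)
  nlinarith [mul_nonneg (neg_nonneg.2 hs) (show 0 ≤ (2 * m + 2) * k ^ 2 - 1 by linarith)]

theorem pants_m_pos {lam : ℝ} (hlam : 0 < lam) {h : SL(2, ℝ)}
    (h3 : 1 ≤ Real.sinh lam ^ 2 * -(h 0 0 * h 1 1)) : 0 < -(h 0 0 * h 1 1) := by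
  have hs := Real.sinh_pos_iff.2 hlam
  by_contra! hneg
  nlinarith [mul_nonneg (sq_nonneg (Real.sinh lam)) (neg_nonneg.2 hneg)]

/-- Elements of the pants group outside the stabiliser of the axis map the disc
`sideForm σ ≤ 0` off itself, provided that the bending angle is small enough. -/
theorem sideForm_pos_of_pants {lam : ℝ} (hlam : 0 < lam) {σ : ℂ}
    (hσ : Real.sinh lam < Real.cos (σ.im / 2) * Real.cosh lam) {h : SL(2, ℝ)}
    (hh : h ∈ pantsGroup lam hlam) (hd : h ∉ diagGroup lam) {v : Fin 2 → ℂ} (hv : v ≠ 0)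
    (hside : sideForm σ v ≤ 0) : 0 < sideForm σ ((constSL h σ).1 *ᵥ v) := by
  obtain ⟨h1, h2, h3⟩ := pantsGroup_sign hlam hh hd
  have hm := pants_m_pos hlam h3
  have hdet := sl2_det h
  have hs := Real.sinh_pos_iff.2 hlam
  have hC := Real.cosh_pos lam
  have hcs := Real.cosh_sq_sub_sinh_sq lam
  have hk : 0 < Real.cos (σ.im / 2) := by
    by_contra! hneg
    nlinarith [mul_nonneg (neg_nonneg.2 hneg) hC.le]
  have hre := real_mulVec_re_im h σ v
  unfold sideForm at hside ⊢
  rw [hre.1, hre.2]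
  have hbc : h 0 1 * h 1 0 = h 0 0 * h 1 1 - 1 := by linarith
  have key := disc_disjoint_aux (k := Real.cos (σ.im / 2)) (l := Real.sin (σ.im / 2))
    (A := h 0 0 * h 1 0) (B := h 0 1 * h 1 1) (m := -(h 0 0 * h 1 1))
    (X := Complex.normSq (v 0)) (Y := Complex.normSq (v 1))
    (q₁ := (v 0 * conj (v 1)).re) (q₂ := (v 0 * conj (v 1)).im) hk
    (Real.cos_sq_add_sin_sq _) h1 h2 hm
    (by linear_combination (h 0 0 * h 1 1) * hbc) ?_ (Complex.normSq_nonneg _)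
    (Complex.normSq_nonneg _) ?_ (normSq_mul_conj _ _) hside
  · convert! key using 3
    rw [hbc]; ring
  -- The angle bound enters here: `sinh² λ * m ≥ 1` gives `m + 1 ≥ coth² λ`, while `cos (Im σ / 2) >
  -- tanh λ`.
  · have hsq : Real.sinh lam ^ 2 < Real.cos (σ.im / 2) ^ 2 * Real.cosh lam ^ 2 := by
      rw [← mul_pow]; gcongr
    have h4 : Real.cosh lam ^ 2 ≤ Real.sinh lam ^ 2 * (-(h 0 0 * h 1 1) + 1) := by linarith
    have h5 : Real.sinh lam ^ 2 * 1 <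
        Real.sinh lam ^ 2 * (Real.cos (σ.im / 2) ^ 2 * (-(h 0 0 * h 1 1) + 1)) := by
      nlinarith [mul_le_mul_of_nonneg_left h4 (sq_nonneg (Real.cos (σ.im / 2)))]
    exact lt_of_mul_lt_mul_left h5 (sq_nonneg _)
  · by_contra! hle
    have n0 := Complex.normSq_nonneg (v 0)
    have n1 := Complex.normSq_nonneg (v 1)
    apply hv
    have e0 : v 0 = 0 := Complex.normSq_eq_zero.1 (by linarith)
    have e1 : v 1 = 0 := Complex.normSq_eq_zero.1 (by linarith)
    ext i
    fin_cases i
    exacts [e0, e1]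

theorem sl2_mulVec_ne_zero (g : SL(2, ℂ)) {v : Fin 2 → ℂ} (hv : v ≠ 0) : g.1 *ᵥ v ≠ 0 := by
  intro h
  apply hv
  have : (g⁻¹ * g).1 *ᵥ v = 0 := by
    rw [Matrix.SpecialLinearGroup.coe_mul, ← Matrix.mulVec_mulVec, h, Matrix.mulVec_zero]
  simpa using this

theorem mul_apply_mulVec (g h : ℂ → SL(2, ℂ)) (σ : ℂ) (v : Fin 2 → ℂ) :
    ((g * h) σ).1 *ᵥ v = (g σ).1 *ᵥ ((h σ).1 *ᵥ v) := by
  rw [Pi.mul_apply, Matrix.SpecialLinearGroup.coe_mul, Matrix.mulVec_mulVec]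

/-- The ping-pong argument. -/
theorem AltWord.sideForm_neg {lam : ℝ} (hlam : 0 < lam) {r : ℂ → SL(2, ℂ)}
    (hr : AltWord ((diagGroup lam).map constSL) ((pantsGroup lam hlam).map constSL) bendTurn r)
    {σ : ℂ} (hσ : Real.sinh lam < Real.cos (σ.im / 2) * Real.cosh lam) {v : Fin 2 → ℂ}
    (hv : ∀ h ∈ pantsGroup lam hlam, 0 < sideForm σ ((constSL h σ).1 *ᵥ v)) :
    sideForm σ ((r σ).1 *ᵥ v) < 0 := by
  have hv0 : v ≠ 0 := by
    rintro rfl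
    simpa [sideForm] using hv 1 (Subgroup.one_mem _)
  induction hr with
  | single hb =>
    obtain ⟨h, hh, rfl⟩ := hb
    rw [mul_apply_mulVec, sideForm_bendTurn]
    exact neg_lt_zero.2 (hv h hh)
  | @cons b r hb hbA _ ih =>
    obtain ⟨h, hh, rfl⟩ := hb
    rw [mul_assoc, mul_apply_mulVec, mul_apply_mulVec, sideForm_bendTurn]
    refine neg_lt_zero.2 (sideForm_pos_of_pants hlam hσ hh ?_ (sl2_mulVec_ne_zero _ hv0) ih.le)
    intro hd
    exact hbA (Subgroup.mem_map_of_mem _ hd)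

/-- The vector representing the parabolic fixed point. -/
noncomputable def cuspVec (lam : ℝ) : Fin 2 → ℂ := ![(Real.exp lam : ℂ), 1]

theorem cuspVec_ne_zero (lam : ℝ) : cuspVec lam ≠ 0 := by
  intro h
  have := congrFun h 1
  simp [cuspVec] at this

theorem sideForm_cusp_pos {lam : ℝ} (hlam : 0 < lam) {σ : ℂ}
    (hσ : Real.sinh lam < Real.cos (σ.im / 2) * Real.cosh lam) {h : SL(2, ℝ)}
    (hh : h ∈ pantsGroup lam hlam) : 0 < sideForm σ ((constSL h σ).1 *ᵥ cuspVec lam) := by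
  have hs := Real.sinh_pos_iff.2 hlam
  have hC := Real.cosh_pos lam
  have hk : 0 < Real.cos (σ.im / 2) := by
    by_contra! hneg
    nlinarith [mul_nonneg (neg_nonneg.2 hneg) hC.le]
  have h1 := pantsGroup_cusp_pos hlam hh
  have hre := real_mulVec_re_im h σ (cuspVec lam)
  unfold sideForm
  rw [hre.1, hre.2]
  simp only [cuspVec, Matrix.cons_val_zero, Matrix.cons_val_one, Complex.normSq_ofReal,
    map_one, mul_one, Complex.ofReal_re, Complex.ofReal_im, mul_zero, sub_zero]
  refine mul_pos hk ?_
  convert! h1 using 1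
  ring

/-- The dichotomy for the elements of the family: they lie in the pants group, or they move the
cusp into a translate of the disc, for every small bending angle. -/
theorem motionGroup_cases {lam : ℝ} (hlam : 0 < lam) {g : ℂ → SL(2, ℂ)}
    (hg : g ∈ motionGroup lam hlam) :
    ∃ h ∈ pantsGroup lam hlam, g = constSL h ∨
      ∃ r : ℂ → SL(2, ℂ), g = constSL h * r ∧
        ∀ σ : ℂ, Real.sinh lam < Real.cos (σ.im / 2) * Real.cosh lam →
          sideForm σ ((r σ).1 *ᵥ cuspVec lam) < 0 := by
  have hle : (diagGroup lam).map constSL ≤ (pantsGroup lam hlam).map constSL := by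
    apply Subgroup.map_mono
    intro x hx
    exact Subgroup.subset_closure (Or.inl hx)
  have hsq : (bendTurn * bendTurn : ℂ → SL(2, ℂ)) ∈ (diagGroup lam).map constSL := by
    refine ⟨-1, ⟨by simp, by simp, 0, by simp⟩, ?_⟩
    funext σ
    ext i j
    rw [Pi.mul_apply, mul_entries, constSL_apply]
    fin_cases i <;> fin_cases j <;> simp [bendTurn, ← Complex.exp_add]
  have hconj : ∀ a ∈ (diagGroup lam).map constSL,
      bendTurn * a * bendTurn⁻¹ ∈ (diagGroup lam).map constSL := by
    rintro _ ⟨d, hd, rfl⟩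
    refine ⟨d⁻¹, (diagGroup lam).inv_mem hd, ?_⟩
    rw [eq_mul_inv_iff_mul_eq]
    obtain ⟨h1, h2, -⟩ := hd
    funext σ
    ext i j
    rw [Pi.mul_apply, Pi.mul_apply, mul_entries, mul_entries]
    simp only [constSL_apply]
    fin_cases i <;> fin_cases j <;>
      simp [bendTurn, Matrix.SpecialLinearGroup.SL2_inv_expl, h1, h2, mul_comm]
  rcases exists_altWord hle hsq hconj hg with ⟨h, hh, rfl⟩ | ⟨_, ⟨h, hh, rfl⟩, r, hr, rfl⟩
  · exact ⟨h, hh, Or.inl rfl⟩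
  · exact ⟨h, hh, Or.inr ⟨r, rfl, fun σ hσ =>
      hr.sideForm_neg hlam hσ fun h hh => sideForm_cusp_pos hlam hσ hh⟩⟩

/-! ### Injectivity and holomorphy of the motion of the cusp -/

/-- The determinant of two vectors of the plane. -/
def cross {R : Type*} [CommRing R] (v w : Fin 2 → R) : R := v 0 * w 1 - w 0 * v 1

theorem cross_mulVec {R : Type*} [CommRing R] (g : SL(2, R)) (v w : Fin 2 → R) :
    cross (g.1 *ᵥ v) (g.1 *ᵥ w) = cross v w := by
  simp only [cross, mulVec_apply_fin_two]
  linear_combination (v 0 * w 1 - w 0 * v 1) * sl2_det g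

theorem eq_smul_of_cross_eq_zero {K : Type*} [Field K] {v w : Fin 2 → K} (hv : v ≠ 0) (hw : w ≠ 0)
    (h : cross v w = 0) : ∃ μ : K, μ ≠ 0 ∧ v = μ • w := by
  have h' : v 0 * w 1 = w 0 * v 1 := sub_eq_zero.1 h
  obtain ⟨μ, hμ⟩ : ∃ μ : K, v = μ • w := by
    by_cases h1 : w 1 = 0
    · have h0 : w 0 ≠ 0 := by
        intro h0; apply hw; ext i; fin_cases i; exacts [h0, h1]
      have hv1 : v 1 = 0 := by
        rw [h1, mul_zero] at h'
        exact (mul_eq_zero.1 h'.symm).resolve_left h0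
      refine ⟨v 0 / w 0, ?_⟩
      ext i; fin_cases i
      · simp [h0]
      · simp [h1, hv1]
    · refine ⟨v 1 / w 1, ?_⟩
      ext i; fin_cases i
      · simp only [Fin.zero_eta, Pi.smul_apply, smul_eq_mul]
        field_simp
        linear_combination h'
      · simp [h1]
  refine ⟨μ, ?_, hμ⟩
  rintro rfl
  exact hv (by rw [hμ, zero_smul])

theorem inv_mulVec_mulVec (g : SL(2, ℂ)) (v : Fin 2 → ℂ) : (g⁻¹).1 *ᵥ (g.1 *ᵥ v) = v := by
  rw [Matrix.mulVec_mulVec, ← Matrix.SpecialLinearGroup.coe_mul]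
  simp

theorem constSL_inv_mulVec (h : SL(2, ℝ)) (σ : ℂ) (v : Fin 2 → ℂ) :
    (constSL h⁻¹ σ).1 *ᵥ ((constSL h σ).1 *ᵥ v) = v := by
  rw [map_inv]
  exact inv_mulVec_mulVec _ _

/-- An element of the family fixing the cusp for one small bending angle fixes it for all. -/
theorem motionGroup_fix {lam : ℝ} (hlam : 0 < lam) {g : ℂ → SL(2, ℂ)}
    (hg : g ∈ motionGroup lam hlam) {σ σ' : ℂ}
    (hσ : Real.sinh lam < Real.cos (σ.im / 2) * Real.cosh lam)
    (h : cross ((g σ).1 *ᵥ cuspVec lam) (cuspVec lam) = 0) :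
    cross ((g σ').1 *ᵥ cuspVec lam) (cuspVec lam) = 0 := by
  obtain ⟨k, hk, rfl | ⟨r, rfl, hr⟩⟩ := motionGroup_cases hlam hg
  · exact h
  -- The factor `r` puts the cusp on the negative side, but if `constSL k * r` fixes the cusp at
  -- `σ`, then `r` sends it to its image under `k⁻¹`, which is on the positive side.
  · exfalso
    obtain ⟨μ, hμ, hμ'⟩ := eq_smul_of_cross_eq_zero (sl2_mulVec_ne_zero _ (cuspVec_ne_zero lam))
      (cuspVec_ne_zero lam) h
    rw [mul_apply_mulVec] at hμ'
    have h1 : (r σ).1 *ᵥ cuspVec lam = μ • ((constSL k⁻¹ σ).1 *ᵥ cuspVec lam) := by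
      rw [← Matrix.mulVec_smul, ← hμ', constSL_inv_mulVec]
    have h2 := hr σ hσ
    rw [h1, sideForm_smul] at h2
    have h3 := sideForm_cusp_pos hlam hσ ((pantsGroup lam hlam).inv_mem hk)
    have := Complex.normSq_pos.2 hμ
    nlinarith [mul_pos this h3]

/-- Apply `motionGroup_fix` to `g'⁻¹ g`. This is the injectivity required of a holomorphic motion;
`σ'` need not lie in the strip. -/
theorem motionGroup_cross {lam : ℝ} (hlam : 0 < lam) {g g' : ℂ → SL(2, ℂ)}
    (hg : g ∈ motionGroup lam hlam) (hg' : g' ∈ motionGroup lam hlam) {σ σ' : ℂ}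
    (hσ : Real.sinh lam < Real.cos (σ.im / 2) * Real.cosh lam)
    (h : cross ((g σ).1 *ᵥ cuspVec lam) ((g' σ).1 *ᵥ cuspVec lam) = 0) :
    cross ((g σ').1 *ᵥ cuspVec lam) ((g' σ').1 *ᵥ cuspVec lam) = 0 := by
  have key : ∀ ρ, cross (((g'⁻¹ * g) ρ).1 *ᵥ cuspVec lam) (cuspVec lam) =
      cross ((g ρ).1 *ᵥ cuspVec lam) ((g' ρ).1 *ᵥ cuspVec lam) := by
    intro ρ
    rw [← cross_mulVec (g' ρ), ← mul_apply_mulVec, mul_inv_cancel_left]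
  rw [← key] at h ⊢
  exact motionGroup_fix hlam
    ((motionGroup lam hlam).mul_mem ((motionGroup lam hlam).inv_mem hg') hg) hσ h

theorem motionGroup_differentiable {lam : ℝ} (hlam : 0 < lam) {g : ℂ → SL(2, ℂ)}
    (hg : g ∈ motionGroup lam hlam) : ∀ i j, Differentiable ℂ fun σ => g σ i j := by
  induction hg using Subgroup.closure_induction with
  | mem x hx =>
    rcases hx with ⟨h, -, rfl⟩ | hx
    · intro i j
      exact differentiable_const _
    · rw [Set.mem_singleton_iff.1 hx]
      intro i j
      fin_cases i <;> fin_cases j <;> simp [bendTurn]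
  | one =>
    intro i j
    exact differentiable_const _
  | mul x y _ _ hx hy =>
    intro i j
    simp only [Pi.mul_apply, mul_entries]
    exact ((hx _ _).mul (hy _ _)).add ((hx _ _).mul (hy _ _))
  | inv x _ hx =>
    intro i j
    fin_cases i <;> fin_cases j <;>
      simp [Matrix.SpecialLinearGroup.SL2_inv_expl] <;> exact hx _ _

/-! ### A neighbourhood that the moving orbit avoids -/

/-- The fixed point of the half-turn in the upper half-plane. -/
noncomputable def turnPoint (lam : ℝ) : ℂ :=
  ⟨1 / Real.cosh lam, Real.sinh lam / Real.cosh lam⟩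

theorem turnPoint_im_pos {lam : ℝ} (hlam : 0 < lam) : 0 < (turnPoint lam).im :=
  div_pos (Real.sinh_pos_iff.2 hlam) (Real.cosh_pos _)

theorem norm_turnPoint (lam : ℝ) : ‖turnPoint lam‖ = 1 := by
  have hC := (Real.cosh_pos lam).ne'
  have hcs := Real.cosh_sq_sub_sinh_sq lam
  rw [← sq_eq_sq₀ (norm_nonneg _) zero_le_one, Complex.sq_norm, Complex.normSq_apply]
  simp only [turnPoint]
  field_simp
  linarith

/-- A bound independent of the group element, with `N` and `x` in the roles of `|z|` and `Re z`.
After the arithmetic-geometric mean inequality the worst case is `s ^ 2 m = 1`, where `s ^ 2 √(m (m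
+ 1)) = C` and the right side becomes the left. -/
theorem avoid_aux {A B m C s N x : ℝ} (hA : 0 < A) (hB : 0 < B) (hAB : A * B = m * (m + 1))
    (hcs : C ^ 2 - s ^ 2 = 1) (hm : 1 ≤ s ^ 2 * m) (hm0 : 0 < m) (hN : 0 ≤ N)
    (hx : x ≤ N) :
    2 * C * N - (2 + s ^ 2) * x ≤ s ^ 2 * (A * N ^ 2 + B + -(2 * m + 1) * x) := by
  set r := Real.sqrt (m * (m + 1)) with hr
  have hr2 : r ^ 2 = m * (m + 1) := Real.sq_sqrt (by positivity)
  have hr0 : 0 ≤ r := Real.sqrt_nonneg _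
  have h1 : 2 * r * N ≤ A * N ^ 2 + B := by
    apply le_of_sq_le_sq _ (by positivity)
    have : (2 * r * N) ^ 2 = 4 * (A * B) * N ^ 2 := by rw [hAB, ← hr2]; ring
    rw [this]
    nlinarith [sq_nonneg (A * N ^ 2 - B)]
  have h2 : C + s ^ 2 * m - 1 ≤ s ^ 2 * r := by
    apply le_of_sq_le_sq _ (by positivity)
    have e1 : (s ^ 2 * r) ^ 2 = (s ^ 2 * m) ^ 2 + (C ^ 2 - 1) * (s ^ 2 * m) := by
      rw [mul_pow, hr2]; linear_combination (-(s ^ 2 * m)) * hcs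
    rw [e1]
    nlinarith [mul_nonneg (sub_nonneg.2 hm) (sq_nonneg (C - 1))]
  have h3 : s ^ 2 * (2 * r * N) ≤ s ^ 2 * (A * N ^ 2 + B) := by gcongr
  nlinarith [mul_nonneg (sub_nonneg.2 hm) (sub_nonneg.2 hx), mul_nonneg hN (sub_nonneg.2 h2)]

/-- A neighbourhood of `turnPoint` is avoided by all the translates of the discs. -/
theorem exists_avoid {lam : ℝ} (hlam : 0 < lam) {K : ℝ}
    (hKs : K * Real.sinh lam < 1) :
    ∃ δ > 0, ∀ z : ℂ, ‖z - turnPoint lam‖ < δ → 0 < z.im ∧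
      ∀ h ∈ pantsGroup lam hlam, ∀ σ : ℂ, 0 < Real.cos (σ.im / 2) →
        |Real.sin (σ.im / 2)| ≤ K * Real.cos (σ.im / 2) →
          0 < sideForm σ ((constSL h σ).1 *ᵥ ![z, 1]) := by
  have hs := Real.sinh_pos_iff.2 hlam
  have hC := Real.one_lt_cosh.2 hlam.ne'
  have hC0 := Real.cosh_pos lam
  have hcs := Real.cosh_sq_sub_sinh_sq lam
  -- Three open conditions at `turnPoint`. The second handles diagonal `h`, the third is the worst
  -- case in `avoid_aux` for all other `h`; at `turnPoint` itself each of the two amounts to `K sinh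
  -- λ < 1`.
  have ev : ∀ᶠ z in nhds (turnPoint lam), 0 < z.im ∧ K * z.im < z.re ∧
      K * Real.sinh lam ^ 2 * z.im <
        2 * Real.cosh lam * ‖z‖ - (2 + Real.sinh lam ^ 2) * z.re := by
    have c1 : ContinuousAt (fun z : ℂ => z.im) (turnPoint lam) := Complex.continuous_im.continuousAt
    have c2 : ContinuousAt (fun z : ℂ => z.re) (turnPoint lam) := Complex.continuous_re.continuousAt
    have c3 : ContinuousAt (fun z : ℂ => ‖z‖) (turnPoint lam) := continuous_norm.continuousAt
    refine (continuousAt_const.eventually_lt c1 (turnPoint_im_pos hlam)).and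
      (((continuousAt_const.mul c1).eventually_lt c2 ?_).and
        ((continuousAt_const.mul c1).eventually_lt
          ((continuousAt_const.mul c3).sub (continuousAt_const.mul c2)) ?_))
    · change K * (turnPoint lam).im < (turnPoint lam).re
      simp only [turnPoint]
      rw [mul_div_assoc', div_lt_div_iff_of_pos_right hC0]
      exact hKs
    · change K * Real.sinh lam ^ 2 * (turnPoint lam).im < 2 * Real.cosh lam * ‖turnPoint lam‖ -
        (2 + Real.sinh lam ^ 2) * (turnPoint lam).re
      rw [norm_turnPoint]
      simp only [turnPoint]
      have : 2 * Real.cosh lam * 1 - (2 + Real.sinh lam ^ 2) * (1 / Real.cosh lam) =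
          Real.sinh lam ^ 2 / Real.cosh lam := by
        field_simp
        linarith
      rw [this, mul_div_assoc', div_lt_div_iff_of_pos_right hC0]
      nlinarith [mul_pos (pow_pos hs 2) (sub_pos.2 hKs)]
  obtain ⟨δ, hδ, hδ'⟩ := Metric.eventually_nhds_iff.1 ev
  refine ⟨δ, hδ, fun z hz => ?_⟩
  obtain ⟨him, h1, h2⟩ := hδ' (by rwa [dist_eq_norm])
  refine ⟨him, fun h hh σ hcos hsin => ?_⟩
  have hsin' : Real.sin (σ.im / 2) * z.im ≤ K * Real.cos (σ.im / 2) * z.im :=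
    mul_le_mul_of_nonneg_right ((le_abs_self _).trans hsin) him.le
  by_cases hd : h ∈ diagGroup lam
  · rw [sideForm_diag hd]
    simp only [sideForm, Matrix.cons_val_zero, Matrix.cons_val_one, map_one, mul_one]
    nlinarith [mul_pos hcos (sub_pos.2 h1)]
  · obtain ⟨e1, e2, e3⟩ := pantsGroup_sign hlam hh hd
    have hm := pants_m_pos hlam e3
    have hdet := sl2_det h
    have hre := real_mulVec_re_im h σ ![z, 1]
    have hbc : h 0 1 * h 1 0 = h 0 0 * h 1 1 - 1 := by linarith
    unfold sideForm
    rw [hre.1, hre.2]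
    simp only [Matrix.cons_val_zero, Matrix.cons_val_one, map_one, mul_one]
    have key := avoid_aux (m := -(h 0 0 * h 1 1)) e1 e2
      (by linear_combination (h 0 0 * h 1 1) * hbc) hcs e3 hm (norm_nonneg z)
      (Complex.re_le_norm z)
    rw [Complex.normSq_eq_norm_sq]
    have key2 : Real.sinh lam ^ 2 * (K * z.im) < Real.sinh lam ^ 2 *
        (h 0 0 * h 1 0 * ‖z‖ ^ 2 + h 0 1 * h 1 1 +
          (h 0 0 * h 1 1 + h 0 1 * h 1 0) * z.re) := by
      have e4 : h 0 0 * h 1 1 + h 0 1 * h 1 0 = -(2 * -(h 0 0 * h 1 1) + 1) := by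
        rw [hbc]; ring
      rw [e4]
      linarith
    have key3 := lt_of_mul_lt_mul_left key2 (sq_nonneg _)
    nlinarith [mul_pos hcos (sub_pos.2 key3)]

/-- The image of the point with homogeneous coordinates `v` under a Möbius transformation sending
`w` to `∞` and the real line to the unit circle. -/
noncomputable def discCoord (w : ℂ) (v : Fin 2 → ℂ) : ℂ :=
  (v 0 - conj w * v 1) / (v 0 - w * v 1)

theorem discCoord_eq_iff {w : ℂ} (hw : w.im ≠ 0) {v v' : Fin 2 → ℂ} (hv : v 0 - w * v 1 ≠ 0)
    (hv' : v' 0 - w * v' 1 ≠ 0) : discCoord w v = discCoord w v' ↔ cross v v' = 0 := by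
  have hww : w - conj w ≠ 0 := by
    intro h
    have := congrArg Complex.im h
    simp only [Complex.sub_im, Complex.conj_im, Complex.zero_im] at this
    apply hw; linarith
  rw [discCoord, discCoord, div_eq_div_iff hv hv', ← sub_eq_zero]
  have : (v 0 - conj w * v 1) * (v' 0 - w * v' 1) - (v' 0 - conj w * v' 1) * (v 0 - w * v 1) =
      -(w - conj w) * cross v v' := by
    simp only [cross]; ring
  rw [this, mul_eq_zero, neg_eq_zero]
  simp [hww]

/-- An orbit point is real if it comes from the pants group, and otherwise lies in a pants translate
of the negative side. The neighbourhood in `exists_avoid` misses both, with a `δ` independent of `g`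
and `σ`; this uniformity bounds the motion in `discCoord`. -/
theorem motionGroup_avoid {lam : ℝ} (hlam : 0 < lam) {K : ℝ}
    (hKs : K * Real.sinh lam < 1) :
    ∃ δ > 0, ∀ g ∈ motionGroup lam hlam, ∀ σ : ℂ,
      Real.sinh lam < Real.cos (σ.im / 2) * Real.cosh lam →
      |Real.sin (σ.im / 2)| ≤ K * Real.cos (σ.im / 2) →
      δ * ‖((g σ).1 *ᵥ cuspVec lam) 1‖ ≤
        ‖((g σ).1 *ᵥ cuspVec lam) 0 - turnPoint lam * ((g σ).1 *ᵥ cuspVec lam) 1‖ := by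
  obtain ⟨δ, hδ, hav⟩ := exists_avoid hlam hKs
  refine ⟨δ, hδ, fun g hg σ hσ hsin => ?_⟩
  have hC := Real.cosh_pos lam
  have hs := Real.sinh_pos_iff.2 hlam
  have hcos : 0 < Real.cos (σ.im / 2) := by
    by_contra! hneg
    nlinarith [mul_nonneg (neg_nonneg.2 hneg) hC.le]
  by_contra! hlt
  set v := (g σ).1 *ᵥ cuspVec lam with hv
  have hv1 : v 1 ≠ 0 := by
    intro h
    rw [h, norm_zero, mul_zero δ] at hlt
    exact absurd hlt (not_lt.2 (norm_nonneg _))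
  have hz : ‖v 0 / v 1 - turnPoint lam‖ < δ := by
    have : v 0 / v 1 - turnPoint lam = (v 0 - turnPoint lam * v 1) / v 1 := by field_simp
    rw [this, norm_div, div_lt_iff₀ (norm_pos_iff.2 hv1)]
    exact hlt
  obtain ⟨him, hpos⟩ := hav _ hz
  have hvz : v = v 1 • ![v 0 / v 1, 1] := by
    ext i; fin_cases i
    · simp [mul_div_cancel₀ _ hv1]
    · simp
  obtain ⟨h, hh, rfl | ⟨r, rfl, hr⟩⟩ := motionGroup_cases hlam hg
  · have e0 : v 0 = ((h 0 0 * Real.exp lam + h 0 1 : ℝ) : ℂ) := by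
      rw [hv, mulVec_apply_fin_two]; simp [constSL_apply, cuspVec]
    have e1 : v 1 = ((h 1 0 * Real.exp lam + h 1 1 : ℝ) : ℂ) := by
      rw [hv, mulVec_apply_fin_two]; simp [constSL_apply, cuspVec]
    rw [e0, e1, ← Complex.ofReal_div, Complex.ofReal_im] at him
    exact him.false
  · have h1 := hpos h⁻¹ ((pantsGroup lam hlam).inv_mem hh) σ hcos hsin
    have h2 := hr σ hσ
    have h3 : (r σ).1 *ᵥ cuspVec lam = (constSL h⁻¹ σ).1 *ᵥ v := by
      rw [hv, mul_apply_mulVec, constSL_inv_mulVec]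
    rw [h3, hvz, Matrix.mulVec_smul, sideForm_smul] at h2
    have := Complex.normSq_pos.2 hv1
    nlinarith [mul_pos this h1]

/-- The orbit of the cusp moves by a bounded holomorphic motion in the coordinate `discCoord`;
hence the closure of the graph comparing the orbits of the groups with parameters `t` and `τ` is
compact and its two projections are injective. -/
theorem orbit_graph_closure {lam : ℝ} (hlam : 0 < lam) {θ : ℝ} (hθ : θ ∈ Set.Ioo 0 Real.pi)
    (hcos : Real.cos (θ / 2) = Real.tanh lam) {τ : ℂ} (hτ : |τ.im| < θ) :
    let A := Set.range fun g : motionGroup lam hlam =>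
      (discCoord (turnPoint lam) ((g.1 τ.re).1 *ᵥ cuspVec lam),
        discCoord (turnPoint lam) ((g.1 τ).1 *ᵥ cuspVec lam))
    (∀ g ∈ motionGroup lam hlam, ∀ σ : ℂ, |σ.im| ≤ |τ.im| → ((g σ).1 *ᵥ cuspVec lam) 0 -
      turnPoint lam * ((g σ).1 *ᵥ cuspVec lam) 1 ≠ 0) ∧
    IsCompact (closure A) ∧ Set.InjOn Prod.fst (closure A) ∧ Set.InjOn Prod.snd (closure A) := by
  intro A
  -- The disc of radius `R` about `Re τ` contains `τ`, at distance `|Im τ|` from the centre, and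
  -- stays in a strip narrower than `|Im σ| < θ`.
  obtain ⟨R, hR1, hR2⟩ := exists_between hτ
  have hs := Real.sinh_pos_iff.2 hlam
  have hC := Real.cosh_pos lam
  have hcs := Real.cosh_sq_sub_sinh_sq lam
  have hpi := Real.pi_pos
  have hR0 : 0 < R := (abs_nonneg _).trans_lt hR1
  have hcosR : Real.sinh lam / Real.cosh lam < Real.cos (R / 2) := by
    rw [← Real.tanh_eq_sinh_div_cosh, ← hcos]
    exact Real.cos_lt_cos_of_nonneg_of_le_pi (by linarith) (by linarith [hθ.2]) (by linarith)
  have hcosR0 : 0 < Real.cos (R / 2) := (div_pos hs hC).trans hcosR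
  have hsinR0 : 0 < Real.sin (R / 2) := Real.sin_pos_of_pos_of_lt_pi (by linarith)
    (by linarith [hθ.2])
  rw [div_lt_iff₀ hC] at hcosR
  have hK : 0 ≤ Real.tan (R / 2) := by rw [Real.tan_eq_sin_div_cos]; positivity
  have hKs : Real.tan (R / 2) * Real.sinh lam < 1 := by
    rw [Real.tan_eq_sin_div_cos, div_mul_eq_mul_div, div_lt_one hcosR0]
    have hsc := Real.sin_sq_add_cos_sq (R / 2)
    -- `sin² (R / 2) cosh² λ = cosh² λ - cos² (R / 2) cosh² λ < cosh² λ - sinh² λ = 1`.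
    have h1 : Real.sin (R / 2) * Real.cosh lam < 1 := by
      by_contra! hge
      have : Real.sinh lam ^ 2 < (Real.cos (R / 2) * Real.cosh lam) ^ 2 := by gcongr
      nlinarith
    have h2 : Real.sin (R / 2) * Real.sinh lam * Real.cosh lam < Real.cos (R / 2) * Real.cosh lam := by
      nlinarith
    exact lt_of_mul_lt_mul_right h2 hC.le
  have hstrip : ∀ σ : ℂ, |σ.im| < R → Real.sinh lam < Real.cos (σ.im / 2) * Real.cosh lam ∧
      |Real.sin (σ.im / 2)| ≤ Real.tan (R / 2) * Real.cos (σ.im / 2) := by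
    intro σ hσ
    have hab : |σ.im / 2| = |σ.im| / 2 := by rw [abs_div, abs_two]
    have h0 := abs_nonneg σ.im
    have hle : Real.cos (R / 2) ≤ Real.cos (σ.im / 2) := by
      rw [← Real.cos_abs (σ.im / 2), hab]
      exact Real.cos_le_cos_of_nonneg_of_le_pi (by linarith) (by linarith [hθ.2]) (by linarith)
    refine ⟨hcosR.trans_le (by gcongr), ?_⟩
    rw [Real.tan_eq_sin_div_cos, div_mul_eq_mul_div, le_div_iff₀ hcosR0]
    have hsin : |Real.sin (σ.im / 2)| = Real.sin |σ.im / 2| :=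
      (Real.abs_sin_eq_sin_abs_of_abs_le_pi (by rw [hab]; linarith [hθ.2]))
    rw [hsin, ← Real.cos_abs (σ.im / 2)]
    have := Real.sin_nonneg_of_nonneg_of_le_pi (x := R / 2 - |σ.im / 2|)
      (by rw [hab]; linarith) (by rw [hab]; linarith [hθ.2])
    rw [Real.sin_sub] at this
    linarith
  obtain ⟨δ, hδ, hav⟩ := motionGroup_avoid hlam hKs
  have hav' : ∀ g ∈ motionGroup lam hlam, ∀ σ : ℂ, |σ.im| < R → ((g σ).1 *ᵥ cuspVec lam) 0 -
      turnPoint lam * ((g σ).1 *ᵥ cuspVec lam) 1 ≠ 0 := by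
    intro g hg σ hσ h0
    have h1 := hav g hg σ (hstrip σ hσ).1 (hstrip σ hσ).2
    rw [h0, norm_zero] at h1
    have h2 : ((g σ).1 *ᵥ cuspVec lam) 1 = 0 := by
      rw [← norm_le_zero_iff]
      by_contra! hlt
      nlinarith [mul_pos hδ hlt]
    rw [h2, mul_zero, sub_zero] at h0
    refine sl2_mulVec_ne_zero (g σ) (cuspVec_ne_zero lam) ?_
    ext i; fin_cases i
    exacts [h0, h2]
  have hball : ∀ σ ∈ Metric.ball (τ.re : ℂ) R, |σ.im| < R := by
    intro σ hσ
    have h1 := Complex.abs_im_le_norm (σ - τ.re)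
    rw [Complex.sub_im, Complex.ofReal_im, sub_zero] at h1
    exact h1.trans_lt (by rwa [Metric.mem_ball, dist_eq_norm] at hσ)
  refine ⟨fun g hg σ hσ => hav' g hg σ (hσ.trans_lt hR1), ?_⟩
  have hw := (turnPoint_im_pos hlam).ne'
  refine holomorphic_motion_closure (R := R)
    (F := fun g : motionGroup lam hlam => fun σ =>
      discCoord (turnPoint lam) ((g.1 σ).1 *ᵥ cuspVec lam))
    -- With `w` the turn point, `discCoord w v = 1 + (w - conj w) * v 1 / (v 0 - w * v 1)`, and the
    -- last quotient is at most `1 / δ` in norm; the final `1` makes the bound strict.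
    (M := 1 + ‖turnPoint lam - conj (turnPoint lam)‖ / δ + 1) (by positivity) ?_ ?_ ?_ ?_
  · intro g σ hσ
    have hd := motionGroup_differentiable hlam g.2
    have hd' : ∀ i, Differentiable ℂ fun σ => ((g.1 σ).1 *ᵥ cuspVec lam) i := by
      intro i
      simp only [mulVec_apply_fin_two]
      exact ((hd _ _).mul_const _).add ((hd _ _).mul_const _)
    exact ((((hd' 0).sub ((hd' 1).const_mul _)) σ).div (((hd' 0).sub ((hd' 1).const_mul _)) σ)
      (hav' g.1 g.2 σ (hball σ hσ))).differentiableWithinAt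
  · intro g σ hσ
    have h1 := hav' g.1 g.2 σ (hball σ hσ)
    have h2 := hav g.1 g.2 σ (hstrip σ (hball σ hσ)).1 (hstrip σ (hball σ hσ)).2
    simp only [discCoord]
    generalize ((g.1 σ).1 *ᵥ cuspVec lam) 0 = x at *
    generalize ((g.1 σ).1 *ᵥ cuspVec lam) 1 = y at *
    have e : (x - conj (turnPoint lam) * y) / (x - turnPoint lam * y) =
        1 + (turnPoint lam - conj (turnPoint lam)) * (y / (x - turnPoint lam * y)) := by
      rw [mul_div_assoc', one_add_div h1]
      congr 1
      ring
    rw [e]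
    have h3 : ‖y / (x - turnPoint lam * y)‖ ≤ 1 / δ := by
      rw [norm_div, div_le_div_iff₀ (norm_pos_iff.2 h1) hδ]
      linarith
    calc _ ≤ ‖(1 : ℂ)‖ + ‖(turnPoint lam - conj (turnPoint lam)) * (y / (x - turnPoint lam * y))‖ :=
          norm_add_le _ _
      _ ≤ 1 + ‖turnPoint lam - conj (turnPoint lam)‖ * (1 / δ) := by
          rw [norm_one, norm_mul]; gcongr
      _ < _ := by rw [mul_one_div]; linarith
  · intro g g' σ hσ h σ' hσ'
    rw [discCoord_eq_iff hw (hav' g.1 g.2 _ (hball _ hσ)) (hav' g'.1 g'.2 _ (hball _ hσ))] at h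
    rw [discCoord_eq_iff hw (hav' g.1 g.2 _ (hball _ hσ')) (hav' g'.1 g'.2 _ (hball _ hσ'))]
    exact motionGroup_cross hlam g.2 g'.2 (hstrip σ (hball σ hσ)).1 h
  · rw [Metric.mem_ball, dist_eq_norm]
    have : τ - τ.re = (τ.im : ℂ) * Complex.I := by
      apply Complex.ext <;> simp
    rw [this, norm_mul, Complex.norm_I, mul_one, Complex.norm_real]
    exact hR1

/-! ### Density of the orbit at real parameters -/

/-- A family of cones in the plane, closed under a subdivision of bounded geometry, shrinks to
every direction it contains. -/
theorem cone_subdivision {𝒮 : Set ((Fin 2 → ℝ) × (Fin 2 → ℝ))} {κ L₁ L₂ : ℝ} (hκ : 0 < κ)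
    (hL₁ : 0 < L₁) (hdet : ∀ q ∈ 𝒮, L₁ ≤ |cross q.1 q.2| ∧ |cross q.1 q.2| ≤ L₂)
    (hsub : ∀ q ∈ 𝒮, ∃ α β : ℝ, κ ≤ α ∧ κ ≤ β ∧ (q.1, α • q.1 + β • q.2) ∈ 𝒮 ∧
      (α • q.1 + β • q.2, q.2) ∈ 𝒮)
    {X Y ξ : Fin 2 → ℝ} (hXY : (X, Y) ∈ 𝒮) {a b : ℝ} (ha : 0 ≤ a) (hb : 0 ≤ b)
    (hξ : ξ = a • X + b • Y) :
    ∃ ℓ : (Fin 2 → ℝ) →ₗ[ℝ] ℝ, ∀ ε > 0, ∃ q ∈ 𝒮, 0 < ℓ q.1 ∧ |cross q.1 ξ| ≤ ε * ℓ q.1 := by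
  have hD : cross X Y ≠ 0 := abs_pos.1 (hL₁.trans_le (hdet _ hXY).1)
  have hL₂ : 0 < L₂ := hL₁.trans_le ((hdet _ hXY).1.trans (hdet _ hXY).2)
  -- The functional equal to `1` on both initial generators measures the length of later vectors.
  let ℓ : (Fin 2 → ℝ) →ₗ[ℝ] ℝ :=
    { toFun := fun v => (cross v Y + cross X v) / cross X Y
      map_add' := fun v w => by simp only [cross, Pi.add_apply]; ring
      map_smul' := fun c v => by
        simp only [cross, Pi.smul_apply, smul_eq_mul, RingHom.id_apply]; ring }
  have hℓX : ℓ X = 1 := by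
    change (cross X Y + cross X X) / cross X Y = 1
    have : cross X X = 0 := by simp [cross]
    rw [this, add_zero, div_self hD]
  have hℓY : ℓ Y = 1 := by
    change (cross Y Y + cross X Y) / cross X Y = 1
    have : cross Y Y = 0 := by simp [cross]
    rw [this, zero_add, div_self hD]
  have hκ2 : 0 < 4 * κ ^ 2 * L₁ / L₂ := by positivity
  -- `m` is an invariant lower bound for `ℓ`: a new vertex has `ℓ ≥ κ (ℓ P + ℓ Q) ≥ 2 κ √(ℓ P * ℓ Q)
  -- ≥ 2 κ √(L₁ / L₂)`.
  obtain ⟨m, hm0, hm1, hm2⟩ : ∃ m : ℝ, 0 < m ∧ m ≤ 1 ∧ m ^ 2 ≤ 4 * κ ^ 2 * L₁ / L₂ := by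
    refine ⟨min 1 (4 * κ ^ 2 * L₁ / L₂), lt_min one_pos hκ2, min_le_left _ _, ?_⟩
    have h1 := min_le_left 1 (4 * κ ^ 2 * L₁ / L₂)
    have h2 := min_le_right 1 (4 * κ ^ 2 * L₁ / L₂)
    have h3 := lt_min one_pos hκ2
    nlinarith
  set c := κ * m ^ 2 / L₂ with hc
  have hc0 : 0 < c := by positivity
  -- The quotient `ℓ P * ℓ Q / |cross P Q|` grows by at least `c` at each subdivision. Replacing `P`
  -- by `Z = α P + β Q` adds `β (ℓ Q) ^ 2 / |cross Z Q| ≥ κ m ^ 2 / L₂`, and symmetrically for `Q`.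
  have main : ∀ n : ℕ, ∃ q ∈ 𝒮, ∃ a b : ℝ, 0 ≤ a ∧ 0 ≤ b ∧ ξ = a • q.1 + b • q.2 ∧ m ≤ ℓ q.1 ∧
      m ≤ ℓ q.2 ∧ (1 / L₂ + n * c) * |cross q.1 q.2| ≤ ℓ q.1 * ℓ q.2 := by
    intro n
    induction n with
    | zero =>
      refine ⟨(X, Y), hXY, a, b, ha, hb, hξ, by rw [hℓX]; exact hm1, by rw [hℓY]; exact hm1, ?_⟩
      simp only [hℓX, hℓY, Nat.cast_zero, zero_mul, add_zero, mul_one]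
      rw [one_div_mul_eq_div, div_le_one hL₂]
      exact (hdet _ hXY).2
    | succ n ih =>
      obtain ⟨⟨P, Q⟩, hq, a, b, ha, hb, hξ', hP, hQ, hn⟩ := ih
      obtain ⟨α, β, hα, hβ, hs1, hs2⟩ := hsub _ hq
      simp only at hξ' hP hQ hn hs1 hs2
      have hα0 := hκ.trans_le hα
      have hβ0 := hκ.trans_le hβ
      have hZ : ℓ (α • P + β • Q) = α * ℓ P + β * ℓ Q := by
        rw [map_add, map_smul, map_smul, smul_eq_mul, smul_eq_mul]
      have hP0 := hm0.trans_le hP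
      have hQ0 := hm0.trans_le hQ
      have hcn : 0 ≤ (n : ℝ) * c := by positivity
      have hZm : m ≤ ℓ (α • P + β • Q) := by
        rw [hZ]
        have h1 : κ * (ℓ P + ℓ Q) ≤ α * ℓ P + β * ℓ Q := by
          nlinarith [mul_le_mul_of_nonneg_right hα hP0.le, mul_le_mul_of_nonneg_right hβ hQ0.le]
        refine le_trans ?_ h1
        apply le_of_sq_le_sq _ (by positivity)
        have h2 : L₁ / L₂ ≤ ℓ P * ℓ Q := by
          refine le_trans ?_ hn
          rw [div_eq_mul_one_div, mul_comm]
          exact mul_le_mul (by linarith) (hdet _ hq).1 hL₁.le (by positivity)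
        calc m ^ 2 ≤ 4 * κ ^ 2 * L₁ / L₂ := hm2
          _ = κ ^ 2 * (4 * (L₁ / L₂)) := by ring
          _ ≤ κ ^ 2 * (4 * (ℓ P * ℓ Q)) := by gcongr
          _ ≤ (κ * (ℓ P + ℓ Q)) ^ 2 := by nlinarith [sq_nonneg (κ * (ℓ P - ℓ Q))]
      have hcX : cross P (α • P + β • Q) = β * cross P Q := by
        simp only [cross, Pi.add_apply, Pi.smul_apply, smul_eq_mul]; ring
      have hcY : cross (α • P + β • Q) Q = α * cross P Q := by
        simp only [cross, Pi.add_apply, Pi.smul_apply, smul_eq_mul]; ring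
      have hinc : ∀ x D : ℝ, m ≤ x → D ≤ L₂ → c * D ≤ κ * x ^ 2 := by
        intro x D hx hD
        calc c * D ≤ c * L₂ := by gcongr
          _ = κ * m ^ 2 := by rw [hc]; field_simp
          _ ≤ κ * x ^ 2 := by gcongr
      -- compare `ξ` with the ray through the new vertex
      rcases le_total (a * β) (b * α) with hab | hab
      · refine ⟨_, hs2, a / α, b - a / α * β, by positivity, ?_, ?_, hZm, hQ, ?_⟩
        · rw [sub_nonneg, div_mul_eq_mul_div, div_le_iff₀ hα0]; exact hab
        · rw [hξ']
          ext i
          simp only [Pi.add_apply, Pi.smul_apply, smul_eq_mul]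
          field_simp
          ring
        · have h1 := hinc _ _ hQ (hdet _ hs2).2
          simp only at h1 ⊢
          rw [hcY, abs_mul, abs_of_pos hα0] at h1 ⊢
          rw [hZ]
          push_cast
          nlinarith [mul_le_mul_of_nonneg_left hn hα0.le,
            mul_le_mul_of_nonneg_right hβ (sq_nonneg (ℓ Q))]
      · refine ⟨_, hs1, a - b / β * α, b / β, ?_, by positivity, ?_, hP, hZm, ?_⟩
        · rw [sub_nonneg, div_mul_eq_mul_div, div_le_iff₀ hβ0]; exact hab
        · rw [hξ']
          ext i
          simp only [Pi.add_apply, Pi.smul_apply, smul_eq_mul]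
          field_simp
          ring
        · have h1 := hinc _ _ hP (hdet _ hs1).2
          simp only at h1 ⊢
          rw [hcX, abs_mul, abs_of_pos hβ0] at h1 ⊢
          rw [hZ]
          push_cast
          nlinarith [mul_le_mul_of_nonneg_left hn hβ0.le,
            mul_le_mul_of_nonneg_right hα (sq_nonneg (ℓ P))]
  refine ⟨ℓ, fun ε hε => ?_⟩
  -- From `b * ℓ Q ≤ ℓ ξ` and `n c |cross P Q| ≤ ℓ P * ℓ Q` it follows that `|cross P ξ| = b |cross
  -- P Q|` is at most `ℓ ξ * ℓ P / (n c)`.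
  obtain ⟨n, hn⟩ := exists_nat_gt (ℓ ξ / (ε * c))
  rw [div_lt_iff₀ (by positivity)] at hn
  obtain ⟨⟨P, Q⟩, hq, a, b, ha, hb, hξ', hP, hQ, hn'⟩ := main n
  simp only at hξ' hP hQ hn'
  have hP0 := hm0.trans_le hP
  have hQ0 := hm0.trans_le hQ
  refine ⟨_, hq, hP0, ?_⟩
  have hcr : cross P ξ = b * cross P Q := by
    rw [hξ']; simp only [cross, Pi.add_apply, Pi.smul_apply, smul_eq_mul]; ring
  have hℓξ : ℓ ξ = a * ℓ P + b * ℓ Q := by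
    rw [hξ', map_add, map_smul, map_smul, smul_eq_mul, smul_eq_mul]
  simp only
  rw [hcr, abs_mul, abs_of_nonneg hb]
  set D := |cross P Q|
  have hD0 : 0 ≤ D := abs_nonneg _
  have h1 : b * ℓ Q ≤ ℓ ξ := by rw [hℓξ]; linarith [mul_nonneg ha hP0.le]
  have h2 : (n * c) * D ≤ ℓ P * ℓ Q :=
    le_trans (mul_le_mul_of_nonneg_right (by linarith [one_div_pos.2 hL₂]) hD0) hn'
  by_contra! hlt
  have hb0 : 0 < b * D := (by positivity : 0 < ε * ℓ P).trans hlt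
  have h3 : ε * ℓ P * (ℓ Q * (n * c)) ≤ b * D * (ℓ Q * (n * c)) := by gcongr
  have h4 : b * D * (ℓ Q * (n * c)) = (b * ℓ Q) * ((n * c) * D) := by ring
  have h5 : (b * ℓ Q) * ((n * c) * D) ≤ (b * ℓ Q) * (ℓ P * ℓ Q) := by gcongr
  have h6 : (b * ℓ Q) * (ℓ P * ℓ Q) ≤ ℓ ξ * (ℓ P * ℓ Q) := by gcongr
  have h7 : ℓ ξ * (ℓ P * ℓ Q) < n * (ε * c) * (ℓ P * ℓ Q) := by gcongr
  linarith

theorem exists_cone_coords {P Q ξ : Fin 2 → ℝ} (h : cross P Q < 0) (h1 : cross P ξ ≤ 0)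
    (h2 : 0 ≤ cross Q ξ) : ∃ a b : ℝ, 0 ≤ a ∧ 0 ≤ b ∧ ξ = a • P + b • Q := by
  refine ⟨cross Q ξ / -cross P Q, -cross P ξ / -cross P Q, div_nonneg h2 (by linarith),
    div_nonneg (by linarith) (by linarith), ?_⟩
  have h0 : cross P Q ≠ 0 := h.ne
  ext i
  simp only [Pi.add_apply, Pi.smul_apply, smul_eq_mul]
  field_simp
  fin_cases i <;> simp only [cross, Fin.zero_eta, Fin.mk_one] <;> ring

/-- A linear map exchanging two vectors up to sign acts on a third one as prescribed by the
determinants. -/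
theorem mulVec_third (E : Matrix (Fin 2) (Fin 2) ℝ) {P Q R : Fin 2 → ℝ} (h : cross P Q ≠ 0)
    (hP : E *ᵥ P = -Q) (hQ : E *ᵥ Q = P) :
    E *ᵥ R = (cross P R / cross P Q) • P + (cross Q R / cross P Q) • Q := by
  have hR : R = (cross R Q / cross P Q) • P + (cross P R / cross P Q) • Q := by
    ext i
    simp only [Pi.add_apply, Pi.smul_apply, smul_eq_mul]
    field_simp
    fin_cases i <;> simp only [cross, Fin.zero_eta, Fin.mk_one] <;> ring
  have hs : cross R Q = -cross Q R := by simp only [cross]; ring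
  conv_lhs => rw [hR, Matrix.mulVec_add, Matrix.mulVec_smul, Matrix.mulVec_smul, hP, hQ, hs]
  rw [neg_div, smul_neg, neg_smul, neg_neg, add_comm]

/-- The orbit of a vertex of an ideal triangle under a group of real matrices containing the
half-turns about the sides of the triangle accumulates at every direction. -/
theorem triangle_orbit_dense {H : Subgroup SL(2, ℝ)} {E₁ E₂ E₃ : SL(2, ℝ)} (hE₁ : E₁ ∈ H)
    (hE₂ : E₂ ∈ H) (hE₃ : E₃ ∈ H) (hneg : -1 ∈ H) {U₁ U₂ U₃ : Fin 2 → ℝ}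
    (h12 : cross U₁ U₂ < 0) (h23 : cross U₂ U₃ < 0) (h13 : cross U₁ U₃ < 0)
    (e31 : E₃.1 *ᵥ U₁ = -U₂) (e32 : E₃.1 *ᵥ U₂ = U₁) (e12 : E₁.1 *ᵥ U₂ = -U₃)
    (e13 : E₁.1 *ᵥ U₃ = U₂) (e21 : E₂.1 *ᵥ U₁ = -U₃) (e23 : E₂.1 *ᵥ U₃ = U₁)
    {ξ : Fin 2 → ℝ} :
    ∃ ℓ : (Fin 2 → ℝ) →ₗ[ℝ] ℝ, ∀ ε > 0, ∃ h ∈ H, ℓ (h.1 *ᵥ U₂) ≠ 0 ∧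
      |cross (h.1 *ᵥ U₂) ξ| ≤ ε * |ℓ (h.1 *ᵥ U₂)| := by
  -- The translates of the sides. The sign in `(U₃, -U₁)` makes the rays `U₁, U₂, U₃, -U₁` turn in
  -- one direction through a half-plane. A half-turn about a side carries the triangle across it,
  -- and the third vertex of its image subdivides the cone on that side, with coefficients that are
  -- ratios of the three determinants.
  set 𝒮 : Set ((Fin 2 → ℝ) × (Fin 2 → ℝ)) := {q | ∃ h ∈ H, q = (h.1 *ᵥ U₁, h.1 *ᵥ U₂) ∨
    q = (h.1 *ᵥ U₂, h.1 *ᵥ U₃) ∨ q = (h.1 *ᵥ U₃, -(h.1 *ᵥ U₁))} with h𝒮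
  set L₁ := min (-cross U₁ U₂) (min (-cross U₂ U₃) (-cross U₁ U₃)) with hL₁
  set L₂ := max (-cross U₁ U₂) (max (-cross U₂ U₃) (-cross U₁ U₃)) with hL₂
  have a1 : L₁ ≤ -cross U₁ U₂ := min_le_left _ _
  have a2 : L₁ ≤ -cross U₂ U₃ := (min_le_right _ _).trans (min_le_left _ _)
  have a3 : L₁ ≤ -cross U₁ U₃ := (min_le_right _ _).trans (min_le_right _ _)
  have b1 : -cross U₁ U₂ ≤ L₂ := le_max_left _ _
  have b2 : -cross U₂ U₃ ≤ L₂ := (le_max_left _ _).trans (le_max_right _ _)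
  have b3 : -cross U₁ U₃ ≤ L₂ := (le_max_right _ _).trans (le_max_right _ _)
  have hL₁0 : 0 < L₁ := lt_min (by linarith) (lt_min (by linarith) (by linarith))
  have hL₂0 : 0 < L₂ := hL₁0.trans_le (a1.trans b1)
  have cneg : ∀ v w : Fin 2 → ℝ, cross v (-w) = -cross v w := by
    intro v w; simp only [cross, Pi.neg_apply]; ring
  have csymm : ∀ v w : Fin 2 → ℝ, cross v w = -cross w v := by
    intro v w; simp only [cross]; ring
  have ratio : ∀ x y : ℝ, L₁ ≤ -x → x < 0 → y < 0 → -y ≤ L₂ → L₁ / L₂ ≤ x / y := by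
    intro x y hx hx0 hy hy2
    rw [← neg_div_neg_eq x y]
    exact div_le_div₀ (by linarith) hx (by linarith) hy2
  have hmul : ∀ (h E : SL(2, ℝ)) (v : Fin 2 → ℝ), (h * E).1 *ᵥ v = h.1 *ᵥ (E.1 *ᵥ v) := by
    intro h E v
    rw [Matrix.SpecialLinearGroup.coe_mul, Matrix.mulVec_mulVec]
  have hnegm : ∀ (h E : SL(2, ℝ)) (v : Fin 2 → ℝ),
      (-1 * (h * E)).1 *ᵥ v = -(h.1 *ᵥ (E.1 *ᵥ v)) := by
    intro h E v
    rw [neg_one_mul, Matrix.SpecialLinearGroup.coe_neg, Matrix.neg_mulVec, hmul]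
  have hsub : ∀ q ∈ 𝒮, ∃ α β : ℝ, L₁ / L₂ ≤ α ∧ L₁ / L₂ ≤ β ∧ (q.1, α • q.1 + β • q.2) ∈ 𝒮 ∧
      (α • q.1 + β • q.2, q.2) ∈ 𝒮 := by
    rintro _ ⟨h, hh, rfl | rfl | rfl⟩
    · have hz := mulVec_third (R := U₃) E₃.1 h12.ne e31 e32
      have hz' := congrArg (h.1 *ᵥ ·) hz
      simp only [Matrix.mulVec_add, Matrix.mulVec_smul] at hz'
      refine ⟨_, _, ratio _ _ a3 h13 h12 b1, ratio _ _ a2 h23 h12 b1, ?_, ?_⟩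
      · rw [← hz']
        exact ⟨h * E₃, H.mul_mem hh hE₃, Or.inr (Or.inl (by rw [hmul, hmul, e32]))⟩
      · rw [← hz']
        exact ⟨h * E₃, H.mul_mem hh hE₃, Or.inr (Or.inr (by
          rw [hmul, hmul, e31, Matrix.mulVec_neg, neg_neg]))⟩
    · have hz := mulVec_third (R := -U₁) E₁.1 h23.ne e12 e13
      have hz' := congrArg (h.1 *ᵥ ·) hz
      simp only [Matrix.mulVec_add, Matrix.mulVec_smul] at hz'
      have i1 : cross U₂ (-U₁) = cross U₁ U₂ := by rw [cneg, csymm, neg_neg]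
      have i2 : cross U₃ (-U₁) = cross U₁ U₃ := by rw [cneg, csymm, neg_neg]
      rw [i1, i2] at hz'
      refine ⟨_, _, ratio _ _ a1 h12 h23 b2, ratio _ _ a3 h13 h23 b2, ?_, ?_⟩
      · rw [← hz']
        exact ⟨h * E₁, H.mul_mem hh hE₁, Or.inr (Or.inr (by
          rw [hmul, hmul, e13, Matrix.mulVec_neg, Matrix.mulVec_neg]))⟩
      · rw [← hz']
        exact ⟨-1 * (h * E₁), H.mul_mem hneg (H.mul_mem hh hE₁), Or.inl (by
          rw [hnegm, hnegm, e12, Matrix.mulVec_neg, Matrix.mulVec_neg, Matrix.mulVec_neg,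
            neg_neg])⟩
    · have i1 : cross U₃ (-U₁) = cross U₁ U₃ := by rw [cneg, csymm, neg_neg]
      have i2 : cross U₃ (-U₂) = cross U₂ U₃ := by rw [cneg, csymm, neg_neg]
      have i3 : cross (-U₁) (-U₂) = cross U₁ U₂ := by
        rw [cneg, csymm, cneg, neg_neg, csymm, neg_neg]
      have hz := mulVec_third (P := U₃) (Q := -U₁) (R := -U₂) E₂.1 (by rw [i1]; exact h13.ne)
        (by rw [neg_neg, e23]) (by rw [Matrix.mulVec_neg, e21, neg_neg])
      have hz' := congrArg (h.1 *ᵥ ·) hz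
      rw [i1, i2, i3] at hz'
      simp only [Matrix.mulVec_add, Matrix.mulVec_smul] at hz'
      refine ⟨_, _, ratio _ _ a2 h23 h13 b3, ratio _ _ a1 h12 h13 b3, ?_, ?_⟩
      · rw [← Matrix.mulVec_neg, ← hz']
        exact ⟨-1 * (h * E₂), H.mul_mem hneg (H.mul_mem hh hE₂), Or.inl (by
          simp only [hnegm, e21, Matrix.mulVec_neg, neg_neg])⟩
      · rw [← Matrix.mulVec_neg, ← hz']
        exact ⟨-1 * (h * E₂), H.mul_mem hneg (H.mul_mem hh hE₂), Or.inr (Or.inl (by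
          rw [hnegm, hnegm, e23, Matrix.mulVec_neg, Matrix.mulVec_neg, Matrix.mulVec_neg]))⟩
  have hdet : ∀ q ∈ 𝒮, L₁ ≤ |cross q.1 q.2| ∧ |cross q.1 q.2| ≤ L₂ := by
    rintro _ ⟨h, -, rfl | rfl | rfl⟩
    · simp only; rw [cross_mulVec, abs_of_neg h12]; exact ⟨a1, b1⟩
    · simp only; rw [cross_mulVec, abs_of_neg h23]; exact ⟨a2, b2⟩
    · simp only
      rw [cneg, cross_mulVec, csymm, neg_neg, abs_of_neg h13]; exact ⟨a3, b3⟩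
  -- first vectors of the pairs are, up to sign, in the orbit of `U₂`
  have horb : ∀ q ∈ 𝒮, ∃ h ∈ H, q.1 = h.1 *ᵥ U₂ ∨ q.1 = -(h.1 *ᵥ U₂) := by
    rintro _ ⟨h, hh, rfl | rfl | rfl⟩
    · exact ⟨h * E₃, H.mul_mem hh hE₃, Or.inl (by rw [hmul, e32])⟩
    · exact ⟨h, hh, Or.inl rfl⟩
    · exact ⟨h * E₁, H.mul_mem hh hE₁, Or.inr (by rw [hmul, e12, Matrix.mulVec_neg, neg_neg])⟩
  have hone : ∀ v : Fin 2 → ℝ, (1 : SL(2, ℝ)).1 *ᵥ v = v := by intro v; simp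
  have hκ : 0 < L₁ / L₂ := div_pos hL₁0 hL₂0
  -- The three initial cones fill the half-plane `cross U₁ ξ ≤ 0`; any other direction is replaced
  -- by its negative.
  have hpos : ∀ ξ : Fin 2 → ℝ, cross U₁ ξ ≤ 0 → ∃ ℓ : (Fin 2 → ℝ) →ₗ[ℝ] ℝ, ∀ ε > 0,
      ∃ q ∈ 𝒮, 0 < ℓ q.1 ∧ |cross q.1 ξ| ≤ ε * ℓ q.1 := by
    intro ξ hξ
    have m1 : (U₁, U₂) ∈ 𝒮 := ⟨1, H.one_mem, Or.inl (by simp only [hone])⟩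
    have m2 : (U₂, U₃) ∈ 𝒮 := ⟨1, H.one_mem, Or.inr (Or.inl (by simp only [hone]))⟩
    have m3 : (U₃, -U₁) ∈ 𝒮 := ⟨1, H.one_mem, Or.inr (Or.inr (by simp only [hone]))⟩
    rcases le_or_gt 0 (cross U₂ ξ) with h2 | h2
    · obtain ⟨a, b, ha, hb, h⟩ := exists_cone_coords h12 hξ h2
      exact cone_subdivision hκ hL₁0 hdet hsub m1 ha hb h
    · rcases le_or_gt 0 (cross U₃ ξ) with h3 | h3
      · obtain ⟨a, b, ha, hb, h⟩ := exists_cone_coords h23 h2.le h3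
        exact cone_subdivision hκ hL₁0 hdet hsub m2 ha hb h
      · obtain ⟨a, b, ha, hb, h⟩ := exists_cone_coords (P := U₃) (Q := -U₁) (ξ := ξ)
          (by rw [cneg, csymm, neg_neg]; exact h13) h3.le
          (by rw [csymm, cneg, neg_neg, csymm]; linarith)
        exact cone_subdivision hκ hL₁0 hdet hsub m3 ha hb h
  have hfin : ∀ ξ' : Fin 2 → ℝ, (ξ' = ξ ∨ ξ' = -ξ) → cross U₁ ξ' ≤ 0 →
      ∃ ℓ : (Fin 2 → ℝ) →ₗ[ℝ] ℝ, ∀ ε > 0, ∃ h ∈ H, ℓ (h.1 *ᵥ U₂) ≠ 0 ∧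
        |cross (h.1 *ᵥ U₂) ξ| ≤ ε * |ℓ (h.1 *ᵥ U₂)| := by
    intro ξ' hξξ hξ'
    obtain ⟨ℓ, hℓ⟩ := hpos ξ' hξ'
    refine ⟨ℓ, fun ε hε => ?_⟩
    obtain ⟨q, hq, h0, hle⟩ := hℓ ε hε
    have habs : ∀ v : Fin 2 → ℝ, |cross v ξ'| = |cross v ξ| := by
      intro v
      rcases hξξ with rfl | rfl
      · rfl
      · rw [cneg, abs_neg]
    have cneg' : ∀ v : Fin 2 → ℝ, |cross (-v) ξ| = |cross v ξ| := by
      intro v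
      rw [csymm, cneg, abs_neg, abs_neg, csymm, abs_neg]
    rw [habs, ← abs_of_pos h0] at hle
    obtain ⟨h, hh, hq1 | hq1⟩ := horb q hq
    · rw [hq1] at h0 hle
      exact ⟨h, hh, h0.ne', hle⟩
    · rw [hq1, map_neg] at h0
      rw [hq1, map_neg, abs_neg, cneg'] at hle
      exact ⟨h, hh, by intro h'; rw [h'] at h0; simp at h0, hle⟩
  rcases le_total (cross U₁ ξ) 0 with h | h
  · exact hfin ξ (Or.inl rfl) h
  · exact hfin (-ξ) (Or.inr rfl) (by rw [cneg]; linarith)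

/-! ### Real points, the disc coordinate and the real orbit -/

/-- The complexification of a real vector. -/
def toC (v : Fin 2 → ℝ) : Fin 2 → ℂ := fun i => (v i : ℂ)

theorem map_mulVec_toC (h : SL(2, ℝ)) (v : Fin 2 → ℝ) :
    (Matrix.SpecialLinearGroup.map Complex.ofRealHom h).1 *ᵥ toC v = toC (h.1 *ᵥ v) := by
  ext i
  simp only [toC]
  rw [mulVec_apply_fin_two, mulVec_apply_fin_two]
  push_cast
  rfl

theorem real_denom_ne_zero {w : ℂ} (hw : w.im ≠ 0) {v : Fin 2 → ℝ} (hv : v ≠ 0) :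
    toC v 0 - w * toC v 1 ≠ 0 := by
  intro h
  have him := congrArg Complex.im h
  have hre := congrArg Complex.re h
  simp only [toC, Complex.sub_im, Complex.mul_im, Complex.ofReal_im, Complex.ofReal_re,
    Complex.sub_re, Complex.mul_re, Complex.zero_im, Complex.zero_re, mul_zero, zero_add,
    zero_sub, sub_zero, neg_eq_zero, mul_eq_zero, hw, false_or] at him hre
  apply hv
  ext i; fin_cases i
  · simpa [him] using hre
  · exact him

theorem norm_discCoord_real {w : ℂ} (hw : w.im ≠ 0) {v : Fin 2 → ℝ} (hv : v ≠ 0) :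
    ‖discCoord w (toC v)‖ = 1 := by
  have h : toC v 0 - conj w * toC v 1 = conj (toC v 0 - w * toC v 1) := by
    simp [toC]
  rw [discCoord, norm_div, h, Complex.norm_conj, div_self]
  exact norm_ne_zero_iff.2 (real_denom_ne_zero hw hv)

/-- For real `v` the numerator of `discCoord` is the conjugate of the denominator, so a denominator
`e` with `conj e = c e` is needed: take half the argument of `c`, negated. Since `w` is not real,
`v` is recovered from `e = v 0 - w * v 1`. -/
theorem exists_real_discCoord {w : ℂ} (hw : w.im ≠ 0) {c : ℂ} (hc : ‖c‖ = 1) :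
    ∃ v : Fin 2 → ℝ, v ≠ 0 ∧ discCoord w (toC v) = c := by
  set e : ℂ := Complex.exp (-(c.arg / 2 : ℝ) * Complex.I) with he
  have he0 : e ≠ 0 := Complex.exp_ne_zero _
  have hce : conj e = c * e := by
    have h1 : c = Complex.exp (c.arg * Complex.I) := by
      conv_lhs => rw [← Complex.norm_mul_exp_arg_mul_I c, hc]
      simp
    have h2 : ∀ a : ℝ, conj (Complex.exp (-(a / 2 : ℝ) * Complex.I)) =
        Complex.exp (a * Complex.I) * Complex.exp (-(a / 2 : ℝ) * Complex.I) := by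
      intro a
      rw [← Complex.exp_conj, ← Complex.exp_add]
      congr 1
      simp only [map_mul, map_neg, Complex.conj_ofReal, Complex.conj_I]
      push_cast
      ring
    rw [he, h2, ← h1]
  set v : Fin 2 → ℝ := ![e.re + w.re * (-e.im / w.im), -e.im / w.im] with hv
  have hd : toC v 0 - w * toC v 1 = e := by
    apply Complex.ext <;> simp [toC, hv]; field_simp
  have hd' : toC v 0 - conj w * toC v 1 = conj e := by
    rw [← hd]; simp [toC]
  refine ⟨v, ?_, ?_⟩
  · intro h0
    apply he0
    rw [← hd, h0]
    simp [toC]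
  · rw [discCoord, hd, hd', hce, mul_div_cancel_right₀ _ he0]

theorem discCoord_sub {w : ℂ} {v v' : Fin 2 → ℂ} (hv : v 0 - w * v 1 ≠ 0)
    (hv' : v' 0 - w * v' 1 ≠ 0) : discCoord w v - discCoord w v' =
      -(w - conj w) * cross v v' / ((v 0 - w * v 1) * (v' 0 - w * v' 1)) := by
  rw [discCoord, discCoord, div_sub_div _ _ hv hv']
  congr 1
  simp only [cross]; ring

/-- For non-real `w` the denominator of `discCoord` is a norm on the real plane. This turns the
density estimate relative to `ℓ` into one in the disc coordinate. The summand `1` keeps `B` positive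
when `ℓ = 0`. -/
theorem abs_linear_le {w : ℂ} (hw : 0 < w.im) (ℓ : (Fin 2 → ℝ) →ₗ[ℝ] ℝ) :
    ∃ B > 0, ∀ v : Fin 2 → ℝ, |ℓ v| ≤ B * ‖toC v 0 - w * toC v 1‖ := by
  refine ⟨|ℓ ![1, 0]| * (1 + ‖w‖ / w.im) + |ℓ ![0, 1]| * (1 / w.im) + 1, by positivity, ?_⟩
  intro v
  set N := ‖toC v 0 - w * toC v 1‖ with hN
  have h1 : |v 1| ≤ 1 / w.im * N := by
    have := Complex.abs_im_le_norm (toC v 0 - w * toC v 1)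
    simp only [toC, Complex.sub_im, Complex.mul_im, Complex.ofReal_im, Complex.ofReal_re, mul_zero,
      zero_add, zero_sub, abs_neg, abs_mul, abs_of_pos hw] at this
    rw [one_div_mul_eq_div, le_div_iff₀ hw, mul_comm]
    exact this
  have h0 : |v 0| ≤ (1 + ‖w‖ / w.im) * N := by
    have e : ‖toC v 0‖ ≤ N + ‖w‖ * |v 1| := by
      calc ‖toC v 0‖ = ‖(toC v 0 - w * toC v 1) + w * toC v 1‖ := by ring_nf
        _ ≤ N + ‖w * toC v 1‖ := norm_add_le _ _
        _ = N + ‖w‖ * |v 1| := by rw [norm_mul]; simp [toC]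
    have e0 : ‖toC v 0‖ = |v 0| := by simp [toC]
    rw [e0] at e
    calc |v 0| ≤ N + ‖w‖ * (1 / w.im * N) := e.trans (by gcongr)
      _ = _ := by ring
  have hv : v = v 0 • ![1, 0] + v 1 • ![0, 1] := by
    ext i; fin_cases i <;> simp
  have hℓ : ℓ v = v 0 * ℓ ![1, 0] + v 1 * ℓ ![0, 1] := by
    conv_lhs => rw [hv]
    rw [map_add, map_smul, map_smul, smul_eq_mul, smul_eq_mul]
  calc |ℓ v| ≤ |v 0| * |ℓ ![1, 0]| + |v 1| * |ℓ ![0, 1]| := by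
        rw [hℓ, ← abs_mul, ← abs_mul]; exact abs_add_le _ _
    _ ≤ (1 + ‖w‖ / w.im) * N * |ℓ ![1, 0]| + 1 / w.im * N * |ℓ ![0, 1]| := by gcongr
    _ ≤ _ := by nlinarith [norm_nonneg (toC v 0 - w * toC v 1)]

/-- The bending half-turn with real parameter. -/
noncomputable def bendTurnReal (t : ℝ) : SL(2, ℝ) :=
  ⟨!![0, -Real.exp (-(t / 2)); Real.exp (t / 2), 0], by
    rw [Matrix.det_fin_two_of, Real.exp_neg]
    field_simp
    ring⟩

theorem bendTurn_ofReal (t : ℝ) :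
    bendTurn t = Matrix.SpecialLinearGroup.map Complex.ofRealHom (bendTurnReal t) := by
  ext i j
  change bendTurn t i j = ((bendTurnReal t i j : ℝ) : ℂ)
  fin_cases i <;> fin_cases j <;> simp [bendTurn, bendTurnReal]

/-- The real matrices that occur in the family at the real parameter `t`. -/
noncomputable def realPoints (lam : ℝ) (hlam : 0 < lam) (t : ℝ) : Subgroup SL(2, ℝ) :=
  ((motionGroup lam hlam).map (Pi.evalMonoidHom (fun _ : ℂ => SL(2, ℂ)) (t : ℂ))).comap
    (Matrix.SpecialLinearGroup.map Complex.ofRealHom)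

theorem mem_realPoints {lam : ℝ} {hlam : 0 < lam} {t : ℝ} {h : SL(2, ℝ)} :
    h ∈ realPoints lam hlam t ↔ ∃ g ∈ motionGroup lam hlam,
      g t = Matrix.SpecialLinearGroup.map Complex.ofRealHom h := Iff.rfl

theorem constSL_mem {lam : ℝ} {hlam : 0 < lam} {h : SL(2, ℝ)} (hh : h ∈ pantsGroup lam hlam) :
    constSL h ∈ motionGroup lam hlam :=
  Subgroup.subset_closure (Or.inl ⟨h, hh, rfl⟩)

theorem bendTurn_mem {lam : ℝ} {hlam : 0 < lam} : bendTurn ∈ motionGroup lam hlam :=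
  Subgroup.subset_closure (Or.inr rfl)

theorem diagS_mem {lam : ℝ} {hlam : 0 < lam} : diagS lam ∈ pantsGroup lam hlam :=
  Subgroup.subset_closure (Or.inl ⟨by simp [diagS], by simp [diagS], 1, by
    simp [diagS, abs_of_pos (Real.exp_pos lam)]⟩)

theorem neg_one_mem {lam : ℝ} {hlam : 0 < lam} : -1 ∈ pantsGroup lam hlam :=
  Subgroup.subset_closure (Or.inl ⟨by simp, by simp, 0, by simp⟩)

theorem halfTurn_mem {lam : ℝ} {hlam : 0 < lam} : halfTurn lam hlam ∈ pantsGroup lam hlam :=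
  Subgroup.subset_closure (Or.inr rfl)

theorem exists_real_of_mem {lam : ℝ} {hlam : 0 < lam} {g : ℂ → SL(2, ℂ)}
    (hg : g ∈ motionGroup lam hlam) (t : ℝ) :
    ∃ h : SL(2, ℝ), g t = Matrix.SpecialLinearGroup.map Complex.ofRealHom h := by
  have hle : motionGroup lam hlam ≤ (Matrix.SpecialLinearGroup.map (n := Fin 2)
      Complex.ofRealHom).range.comap (Pi.evalMonoidHom (fun _ : ℂ => SL(2, ℂ)) (t : ℂ)) := by
    rw [motionGroup, Subgroup.closure_le]
    rintro g (⟨h, -, rfl⟩ | hg)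
    · exact ⟨h, rfl⟩
    · rw [Set.mem_singleton_iff.1 hg]
      exact ⟨bendTurnReal t, (bendTurn_ofReal t).symm⟩
  obtain ⟨h, hh⟩ := hle hg
  exact ⟨h, hh.symm⟩

/-- The real cusp vector. -/
noncomputable def cuspVecReal (lam : ℝ) : Fin 2 → ℝ := ![Real.exp lam, 1]

theorem toC_cuspVecReal (lam : ℝ) : toC (cuspVecReal lam) = cuspVec lam := by
  ext i; fin_cases i <;> simp [toC, cuspVecReal, cuspVec]

theorem cuspVecReal_ne_zero (lam : ℝ) : cuspVecReal lam ≠ 0 := by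
  intro h
  have := congrFun h 1
  simp [cuspVecReal] at this

theorem sl2_mulVec_ne_zero_real (g : SL(2, ℝ)) {v : Fin 2 → ℝ} (hv : v ≠ 0) : g.1 *ᵥ v ≠ 0 := by
  intro h
  apply hv
  have : (g⁻¹ * g).1 *ᵥ v = 0 := by
    rw [Matrix.SpecialLinearGroup.coe_mul, ← Matrix.mulVec_mulVec, h, Matrix.mulVec_zero]
  simpa using this

/-- The orbit of the cusp is dense in the circle, for real parameters. -/
theorem real_orbit_dense {lam : ℝ} (hlam : 0 < lam) (t : ℝ) (ξ : Fin 2 → ℝ) :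
    ∃ ℓ : (Fin 2 → ℝ) →ₗ[ℝ] ℝ, ∀ ε > 0, ∃ h ∈ realPoints lam hlam t,
      ℓ (h.1 *ᵥ cuspVecReal lam) ≠ 0 ∧
        |cross (h.1 *ᵥ cuspVecReal lam) ξ| ≤ ε * |ℓ (h.1 *ᵥ cuspVecReal lam)| := by
  have hp := Real.exp_pos (lam / 2)
  have hq := Real.exp_pos (t / 2)
  have hs := Real.sinh_pos_iff.2 hlam
  have e1 : Real.exp lam = Real.exp (lam / 2) ^ 2 := by rw [← Real.exp_nat_mul]; congr 1; ring
  have e2 : Real.exp (-lam) = (Real.exp (lam / 2) ^ 2)⁻¹ := by rw [Real.exp_neg, e1]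
  have hsinh : Real.sinh lam = (Real.exp (lam / 2) ^ 2 - (Real.exp (lam / 2) ^ 2)⁻¹) / 2 := by
    rw [Real.sinh_eq, e1, e2]
  have hcosh : Real.cosh lam = (Real.exp (lam / 2) ^ 2 + (Real.exp (lam / 2) ^ 2)⁻¹) / 2 := by
    rw [Real.cosh_eq, e1, e2]
  have hp1 : 1 < Real.exp (lam / 2) := Real.one_lt_exp_iff.2 (by linarith)
  set p := Real.exp (lam / 2) with hpdef
  set q := Real.exp (t / 2) with hqdef
  have hT : (halfTurn lam hlam).1 = !![1 / Real.sinh lam, -Real.cosh lam / Real.sinh lam;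
      Real.cosh lam / Real.sinh lam, -1 / Real.sinh lam] := rfl
  have hB : (bendTurnReal t).1 = !![0, -q⁻¹; q, 0] := by
    change !![0, -Real.exp (-(t / 2)); Real.exp (t / 2), 0] = _
    rw [Real.exp_neg]
  have hS : (diagS lam).1 = !![p ^ 2, 0; 0, (p ^ 2)⁻¹] := by
    change !![Real.exp lam, 0; 0, Real.exp (-lam)] = _
    rw [e1, e2]
  have hBS : (bendTurnReal t * diagS lam).1 = !![0, -q⁻¹ * (p ^ 2)⁻¹; q * p ^ 2, 0] := by
    rw [Matrix.SpecialLinearGroup.coe_mul, hB, hS]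
    ext i j; fin_cases i <;> fin_cases j <;> simp [Matrix.mul_apply, Fin.sum_univ_two]
  have mem : ∀ h ∈ pantsGroup lam hlam, h ∈ realPoints lam hlam t := fun h hh =>
    mem_realPoints.2 ⟨constSL h, constSL_mem hh, rfl⟩
  have memB : bendTurnReal t ∈ realPoints lam hlam t :=
    mem_realPoints.2 ⟨bendTurn, bendTurn_mem, bendTurn_ofReal t⟩
  have hs' : p ^ 2 - (p ^ 2)⁻¹ ≠ 0 := by
    intro h; rw [hsinh, h] at hs; simp at hs
  have hp4 : p ^ 4 - 1 ≠ 0 := by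
    have : 1 < p ^ 4 := one_lt_pow₀ hp1 (by norm_num)
    linarith
  have hsf : Real.sinh lam = (p ^ 4 - 1) / (2 * p ^ 2) := by rw [hsinh]; field_simp
  have hcf : Real.cosh lam = (p ^ 4 + 1) / (2 * p ^ 2) := by rw [hcosh]; field_simp
  -- The ideal triangle has vertices `exp (-λ)`, `exp λ` and `-exp (-λ - t)`. Its sides are reversed
  -- by `f`, `e` and `e S`, and the vectors are scaled so that the exchanges hold exactly up to
  -- sign. The vector `U₂` represents the cusp.
  obtain ⟨ℓ, hℓ⟩ := triangle_orbit_dense (H := realPoints lam hlam t) (E₁ := bendTurnReal t)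
    (E₂ := bendTurnReal t * diagS lam) (E₃ := halfTurn lam hlam) memB
    (Subgroup.mul_mem _ memB (mem _ diagS_mem)) (mem _ halfTurn_mem) (mem _ neg_one_mem)
    (U₁ := ![p⁻¹, p]) (U₂ := ![p, p⁻¹]) (U₃ := ![q⁻¹ * p⁻¹, -(q * p)])
    (by
      simp only [cross, Matrix.cons_val_zero, Matrix.cons_val_one]
      have : p⁻¹ < p := (inv_lt_one_of_one_lt₀ hp1).trans hp1
      have h2 : 0 < p⁻¹ := inv_pos.2 hp
      nlinarith)
    (by
      simp only [cross, Matrix.cons_val_zero, Matrix.cons_val_one]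
      have : 0 < p * (q * p) + q⁻¹ * p⁻¹ * p⁻¹ := by positivity
      linarith)
    (by
      simp only [cross, Matrix.cons_val_zero, Matrix.cons_val_one]
      have : 0 < p⁻¹ * (q * p) + q⁻¹ * p⁻¹ * p := by positivity
      linarith)
    (by
      rw [hT, hsf, hcf]
      ext i; fin_cases i <;> simp [Matrix.mulVec, dotProduct, Fin.sum_univ_two] <;>
        field_simp <;> ring)
    (by
      rw [hT, hsf, hcf]
      ext i; fin_cases i <;> simp [Matrix.mulVec, dotProduct, Fin.sum_univ_two] <;>
        field_simp <;> ring)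
    (by
      rw [hB]
      ext i; fin_cases i <;> simp [Matrix.mulVec, dotProduct, Fin.sum_univ_two])
    (by
      rw [hB]
      ext i; fin_cases i <;> simp [Matrix.mulVec, dotProduct, Fin.sum_univ_two] <;> field_simp)
    (by
      rw [hBS]
      ext i; fin_cases i <;> simp [Matrix.mulVec, dotProduct, Fin.sum_univ_two] <;> field_simp)
    (by
      rw [hBS]
      ext i; fin_cases i <;> simp [Matrix.mulVec, dotProduct, Fin.sum_univ_two] <;> field_simp)
    (ξ := ξ)
  have hU : cuspVecReal lam = p • ![p, p⁻¹] := by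
    ext i; fin_cases i
    · simp [cuspVecReal, e1, pow_two]
    · simp [cuspVecReal, hp.ne']
  refine ⟨ℓ, fun ε hε => ?_⟩
  obtain ⟨h, hh, h0, hle⟩ := hℓ ε hε
  refine ⟨h, hh, ?_, ?_⟩
  · rw [hU, Matrix.mulVec_smul, map_smul, smul_eq_mul]
    exact mul_ne_zero hp.ne' h0
  · rw [hU, Matrix.mulVec_smul, map_smul, smul_eq_mul, abs_mul, abs_of_pos hp]
    have : cross (p • (h.1 *ᵥ ![p, p⁻¹])) ξ = p * cross (h.1 *ᵥ ![p, p⁻¹]) ξ := by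
      simp only [cross, Pi.smul_apply, smul_eq_mul]; ring
    rw [this, abs_mul, abs_of_pos hp]
    nlinarith

/-- In the coordinate `discCoord`, the closure of the orbit of the cusp is the unit circle. -/
theorem closure_real_orbit {lam : ℝ} (hlam : 0 < lam) (t : ℝ) :
    closure (Set.range fun g : motionGroup lam hlam =>
      discCoord (turnPoint lam) ((g.1 t).1 *ᵥ cuspVec lam)) = Metric.sphere 0 1 := by
  have hw := turnPoint_im_pos hlam
  have hreal : ∀ g ∈ motionGroup lam hlam, ∃ v : Fin 2 → ℝ, v ≠ 0 ∧
      (g t).1 *ᵥ cuspVec lam = toC v := by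
    intro g hg
    obtain ⟨h, hh⟩ := exists_real_of_mem hg t
    refine ⟨h.1 *ᵥ cuspVecReal lam, sl2_mulVec_ne_zero_real h (cuspVecReal_ne_zero lam), ?_⟩
    rw [hh, ← toC_cuspVecReal, map_mulVec_toC]
  apply subset_antisymm
  · refine closure_minimal ?_ Metric.isClosed_sphere
    rintro _ ⟨g, rfl⟩
    obtain ⟨v, hv, h⟩ := hreal g.1 g.2
    simp only [h, mem_sphere_zero_iff_norm]
    exact norm_discCoord_real hw.ne' hv
  · intro c hc
    obtain ⟨ξ, hξ, rfl⟩ := exists_real_discCoord hw.ne' (mem_sphere_zero_iff_norm.1 hc)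
    obtain ⟨ℓ, hℓ⟩ := real_orbit_dense hlam t ξ
    obtain ⟨B, hB, hBℓ⟩ := abs_linear_le hw ℓ
    rw [Metric.mem_closure_iff]
    intro ε hε
    have hξ0 := norm_pos_iff.2 (real_denom_ne_zero hw.ne' hξ)
    set W := ‖turnPoint lam - conj (turnPoint lam)‖ with hW
    obtain ⟨h, hh, h0, hle⟩ := hℓ (ε * ‖toC ξ 0 - turnPoint lam * toC ξ 1‖ / (2 * B * (W + 1)))
      (by positivity)
    obtain ⟨g, hg, hgh⟩ := mem_realPoints.1 hh
    refine ⟨_, ⟨⟨g, hg⟩, rfl⟩, ?_⟩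
    have hv : (g t).1 *ᵥ cuspVec lam = toC (h.1 *ᵥ cuspVecReal lam) := by
      rw [hgh, ← toC_cuspVecReal, map_mulVec_toC]
    simp only [hv]
    have hv0 := sl2_mulVec_ne_zero_real h (cuspVecReal_ne_zero lam)
    have hd := hBℓ (h.1 *ᵥ cuspVecReal lam)
    generalize h.1 *ᵥ cuspVecReal lam = v at *
    have hcr : ‖cross (toC v) (toC ξ)‖ = |cross v ξ| := by
      rw [← Real.norm_eq_abs, ← Complex.norm_real]
      congr 1
      simp only [cross, toC]; push_cast; ring
    rw [dist_comm, dist_eq_norm, discCoord_sub (real_denom_ne_zero hw.ne' hv0)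
      (real_denom_ne_zero hw.ne' hξ), norm_div, norm_mul, norm_mul, norm_neg, hcr, ← hW]
    have hv0' := norm_pos_iff.2 (real_denom_ne_zero hw.ne' hv0)
    generalize ‖toC v 0 - turnPoint lam * toC v 1‖ = Nv at *
    generalize ‖toC ξ 0 - turnPoint lam * toC ξ 1‖ = Nx at *
    have hW0 : 0 ≤ W := norm_nonneg _
    rw [div_lt_iff₀ (by positivity)]
    calc W * |cross v ξ| ≤ W * (ε * Nx / (2 * B * (W + 1)) * (B * Nv)) := by gcongr; exact hle.trans (by gcongr)
      _ = ε * (Nv * Nx) * (W / (2 * (W + 1))) := by field_simp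
      _ < ε * (Nv * Nx) * 1 := by
          gcongr
          rw [div_lt_one (by positivity)]; linarith
      _ = ε * (Nv * Nx) := mul_one _

/-! ### The correspondence between the real line and the limit circle -/

/-- The point of the Riemann sphere with homogeneous coordinate vector `v`. -/
noncomputable def sph (v : Fin 2 → ℂ) : OnePoint ℂ := toSphere (v 0) (v 1)

theorem apply_ne_zero_or {R : Type*} [Zero R] {v : Fin 2 → R} (hv : v ≠ 0) : v 0 ≠ 0 ∨ v 1 ≠ 0 := by
  by_contra! h
  apply hv
  ext i; fin_cases i
  exacts [h.1, h.2]

theorem mk_smul_sph (A : SL(2, ℂ)) {v : Fin 2 → ℂ} (hv : v ≠ 0) :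
    (QuotientGroup.mk A : PSL2C) • sph v = sph (A.1 *ᵥ v) := by
  rw [sph, sph, mk_smul_toSphere A (apply_ne_zero_or hv), mulVec_apply_fin_two,
    mulVec_apply_fin_two]

theorem sph_eq_iff {v w : Fin 2 → ℂ} (hv : v ≠ 0) (hw : w ≠ 0) :
    sph v = sph w ↔ cross v w = 0 := by
  rw [sph, sph, toSphere_eq_iff (apply_ne_zero_or hv) (apply_ne_zero_or hw), cross, sub_eq_zero]

theorem sph_smul {μ : ℂ} (hμ : μ ≠ 0) (v : Fin 2 → ℂ) : sph (μ • v) = sph v :=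
  toSphere_mul μ _ _ hμ

theorem exists_sph_eq (z : OnePoint ℂ) : ∃ v : Fin 2 → ℂ, v ≠ 0 ∧ sph v = z := by
  obtain ⟨x, y, h, rfl⟩ := exists_toSphere_eq z
  refine ⟨![x, y], ?_, rfl⟩
  intro h0
  have h1 := congrFun h0 0
  have h2 := congrFun h0 1
  simp only [Matrix.cons_val_zero, Matrix.cons_val_one, Pi.zero_apply] at h1 h2
  simp [h1, h2] at h

theorem continuousOn_sph : ContinuousOn sph {v | v ≠ 0} := fun v hv =>
  (ContinuousAt.comp (f := fun v : Fin 2 → ℂ => (v 0, v 1))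
    (continuousAt_toSphere (apply_ne_zero_or hv)) (by fun_prop)).continuousWithinAt

theorem toC_ne_zero {v : Fin 2 → ℝ} (hv : v ≠ 0) : toC v ≠ 0 := by
  intro h
  apply hv
  ext i
  have := congrFun h i
  simpa [toC] using this

/-- The inverse of `discCoord w`, as a map to the Riemann sphere. -/
noncomputable def discToSphere (w F : ℂ) : OnePoint ℂ := toSphere (w * F - conj w) (F - 1)

theorem sub_conj_ne_zero {w : ℂ} (hw : w.im ≠ 0) : w - conj w ≠ 0 := by
  intro h
  have := congrArg Complex.im h
  simp only [Complex.sub_im, Complex.conj_im, Complex.zero_im] at this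
  apply hw; linarith

theorem discToSphere_aux {w : ℂ} (hw : w.im ≠ 0) (F : ℂ) : w * F - conj w ≠ 0 ∨ F - 1 ≠ 0 := by
  by_contra! h
  apply sub_conj_ne_zero hw
  linear_combination h.1 - w * h.2

theorem continuous_discToSphere {w : ℂ} (hw : w.im ≠ 0) : Continuous (discToSphere w) :=
  Continuous.toSphere (by fun_prop) (by fun_prop) (discToSphere_aux hw)

theorem injective_discToSphere {w : ℂ} (hw : w.im ≠ 0) : Function.Injective (discToSphere w) := by
  intro F F' h
  rw [discToSphere, discToSphere,
    toSphere_eq_iff (discToSphere_aux hw F) (discToSphere_aux hw F')] at h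
  have : (w - conj w) * (F - F') = 0 := by linear_combination -h
  exact sub_eq_zero.1 ((mul_eq_zero.1 this).resolve_left (sub_conj_ne_zero hw))

theorem discToSphere_discCoord {w : ℂ} (hw : w.im ≠ 0) {v : Fin 2 → ℂ} (hv : v 0 - w * v 1 ≠ 0) :
    discToSphere w (discCoord w v) = sph v := by
  have hc : (w - conj w) / (v 0 - w * v 1) ≠ 0 := div_ne_zero (sub_conj_ne_zero hw) hv
  rw [sph, ← toSphere_mul _ (v 0) (v 1) hc, discToSphere, discCoord]
  congr 1
  · rw [mul_div_assoc', div_mul_eq_mul_div, div_sub' hv, div_left_inj' hv]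
    ring
  · rw [div_mul_eq_mul_div, div_sub_one hv, div_left_inj' hv]
    ring

/-- The points of the Riemann sphere on the extended real line. -/
def realCircle : Set (OnePoint ℂ) := {x | ∃ v : Fin 2 → ℝ, v ≠ 0 ∧ sph (toC v) = x}

theorem discToSphere_image_sphere {w : ℂ} (hw : w.im ≠ 0) :
    discToSphere w '' Metric.sphere 0 1 = realCircle := by
  ext x
  constructor
  · rintro ⟨c, hc, rfl⟩
    obtain ⟨v, hv, rfl⟩ := exists_real_discCoord hw (mem_sphere_zero_iff_norm.1 hc)
    exact ⟨v, hv, (discToSphere_discCoord hw (real_denom_ne_zero hw hv)).symm⟩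
  · rintro ⟨v, hv, rfl⟩
    exact ⟨discCoord w (toC v), mem_sphere_zero_iff_norm.2 (norm_discCoord_real hw hv),
      discToSphere_discCoord hw (real_denom_ne_zero hw hv)⟩

theorem nonempty_homeomorph_of_injOn {X Y : Type*} [TopologicalSpace X] [TopologicalSpace Y]
    [T2Space Y] {K : Set X} (hK : IsCompact K) {f : X → Y} (hf : ContinuousOn f K)
    (hinj : Set.InjOn f K) : Nonempty (K ≃ₜ f '' K) := by
  have := isCompact_iff_compactSpace.1 hK
  refine ⟨Continuous.homeoOfEquivCompactToT2 (f := Equiv.Set.imageOfInjOn f K hinj) ?_⟩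
  exact Continuous.subtype_mk (continuousOn_iff_continuous_domRestrict.1 hf) _

theorem nonempty_sphere_homeomorph_circle :
    Nonempty (Metric.sphere (0 : ℂ) 1 ≃ₜ Circle) :=
  ⟨(Homeomorph.refl (Metric.sphere (0 : ℂ) 1) :)⟩

/-- The holomorphic motion of the limit circle: a compact correspondence between the extended
real line and the limit set, equivariant under the family of groups. -/
theorem exists_limit_correspondence {lam : ℝ} (hlam : 0 < lam) {θ : ℝ}
    (hθ : θ ∈ Set.Ioo 0 Real.pi) (hcos : Real.cos (θ / 2) = Real.tanh lam) {τ : ℂ}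
    (hτ : |τ.im| < θ) :
    ∃ Γ : Set (OnePoint ℂ × OnePoint ℂ), IsCompact Γ ∧ Set.InjOn Prod.fst Γ ∧
      Set.InjOn Prod.snd Γ ∧ Prod.fst '' Γ = realCircle ∧ Nonempty (Prod.snd '' Γ ≃ₜ Circle) ∧
      Γ = closure (Set.range fun g : motionGroup lam hlam =>
        (sph ((g.1 τ.re).1 *ᵥ cuspVec lam), sph ((g.1 τ).1 *ᵥ cuspVec lam))) ∧
      ∀ g ∈ motionGroup lam hlam, ∀ q ∈ Γ,
        ((QuotientGroup.mk (g τ.re) : PSL2C) • q.1, (QuotientGroup.mk (g τ) : PSL2C) • q.2) ∈ Γ := by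
  obtain ⟨hne, hcpt, hi1, hi2⟩ := orbit_graph_closure hlam hθ hcos hτ
  have hw := (turnPoint_im_pos hlam).ne'
  set w := turnPoint lam with hwdef
  set A := Set.range fun g : motionGroup lam hlam =>
      (discCoord w ((g.1 τ.re).1 *ᵥ cuspVec lam), discCoord w ((g.1 τ).1 *ᵥ cuspVec lam)) with hA
  set Φ := Prod.map (discToSphere w) (discToSphere w) with hΦ
  have hΦc : Continuous Φ := (continuous_discToSphere hw).prodMap (continuous_discToSphere hw)
  have hB : Φ '' A = Set.range fun g : motionGroup lam hlam =>
        (sph ((g.1 τ.re).1 *ᵥ cuspVec lam), sph ((g.1 τ).1 *ᵥ cuspVec lam)) := by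
    rw [hA, ← Set.range_comp]
    congr 1
    funext g
    refine Prod.ext ?_ ?_
    · exact discToSphere_discCoord hw (hne g.1 g.2 _ (by simp))
    · exact discToSphere_discCoord hw (hne g.1 g.2 _ le_rfl)
  have hcl : Φ '' closure A = closure (Φ '' A) := image_closure_of_isCompact hcpt hΦc.continuousOn
  have hfst : Prod.fst '' closure A = Metric.sphere 0 1 := by
    rw [image_closure_of_isCompact hcpt continuous_fst.continuousOn, hA, ← Set.range_comp]
    exact closure_real_orbit hlam τ.re
  have hinj := injective_discToSphere hw
  refine ⟨Φ '' closure A, hcpt.image hΦc, ?_, ?_, ?_, ?_, ?_, ?_⟩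
  · rintro _ ⟨a, ha, rfl⟩ _ ⟨b, hb, rfl⟩ h
    rw [hi1 ha hb (hinj h)]
  · rintro _ ⟨a, ha, rfl⟩ _ ⟨b, hb, rfl⟩ h
    rw [hi2 ha hb (hinj h)]
  · rw [← discToSphere_image_sphere hw, ← hfst, Set.image_image, Set.image_image]
    rfl
  -- Both projections of the compact graph are injective, hence homeomorphisms onto their images;
  -- the first image is the unit circle.
  · have e1 := nonempty_homeomorph_of_injOn hcpt continuous_fst.continuousOn hi1
    have e2 := nonempty_homeomorph_of_injOn hcpt (f := fun a => discToSphere w a.2)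
      ((continuous_discToSphere hw).comp continuous_snd).continuousOn
      (fun a ha b hb h => hi2 ha hb (hinj h))
    rw [hfst] at e1
    have : Prod.snd '' (Φ '' closure A) = (fun a : ℂ × ℂ => discToSphere w a.2) '' closure A := by
      rw [Set.image_image]; rfl
    rw [this]
    obtain ⟨e1⟩ := e1
    obtain ⟨e2⟩ := e2
    obtain ⟨e3⟩ := nonempty_sphere_homeomorph_circle
    exact ⟨e2.symm.trans (e1.trans e3)⟩
  · rw [hcl, hB]
  · rw [hcl, hB]
    intro g hg q hq
    have hc : Continuous fun q : OnePoint ℂ × OnePoint ℂ =>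
        ((QuotientGroup.mk (g τ.re) : PSL2C) • q.1, (QuotientGroup.mk (g τ) : PSL2C) • q.2) := by
      fun_prop
    refine closure_mono ?_ (image_closure_subset_closure_image hc ⟨q, hq, rfl⟩)
    rintro _ ⟨_, ⟨k, rfl⟩, rfl⟩
    refine ⟨⟨g * k.1, Subgroup.mul_mem _ hg k.2⟩, ?_⟩
    refine Prod.ext ?_ ?_
    · simp only
      rw [mk_smul_sph _ (sl2_mulVec_ne_zero _ (cuspVec_ne_zero lam)), mul_apply_mulVec]
    · simp only
      rw [mk_smul_sph _ (sl2_mulVec_ne_zero _ (cuspVec_ne_zero lam)), mul_apply_mulVec]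

/-! ### Ping-pong at a real parameter, and discreteness at `τ` -/

/-- A ping-pong lemma. The set `D (i, true)` attracts `a i` and `D (i, false)` attracts its
inverse, where `E l` plays the role of the exterior of `D l`. Every non-trivial word moves one of
four given points from `D l` to `E l`. -/
theorem exists_ping_pong {R : Type*} [CommRing R] {a : Fin 2 → SL(2, R)}
    {D E : Fin 2 × Bool → Set (Fin 2 → R)} (hDE : ∀ l m, l ≠ m → D l ⊆ E m)
    (hpos : ∀ i, ∀ v ∈ E (i, false), (a i).1 *ᵥ v ∈ D (i, true))
    (hneg : ∀ i, ∀ v ∈ E (i, true), ((a i)⁻¹).1 *ᵥ v ∈ D (i, false))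
    {pt : Fin 2 × Bool → Fin 2 → R} (hpt : ∀ l, pt l ∈ D l) {w : FreeGroup (Fin 2)} (hw : w ≠ 1) :
    ∃ l, (FreeGroup.lift a w).1 *ᵥ pt l ∈ E l := by
  have step : ∀ (l : Fin 2 × Bool) (v : Fin 2 → R), v ∈ E (l.1, !l.2) →
      (FreeGroup.lift a (FreeGroup.mk [l])).1 *ᵥ v ∈ D l := by
    rintro ⟨i, b⟩ v hv
    cases b
    · have : FreeGroup.lift a (FreeGroup.mk [(i, false)]) = (a i)⁻¹ := by
        simp [FreeGroup.lift_mk]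
      rw [this]
      exact hneg i v hv
    · have : FreeGroup.lift a (FreeGroup.mk [(i, true)]) = a i := by
        simp [FreeGroup.lift_mk]
      rw [this]
      exact hpos i v hv
  -- A reduced word sends every `D m` into the set of its first letter, except possibly for one `m`,
  -- the inverse of the last letter.
  have main : ∀ (L : List (Fin 2 × Bool)) (l : Fin 2 × Bool), FreeGroup.IsReduced (l :: L) →
      ∃ x : Fin 2 × Bool, ∀ m, m ≠ x → ∀ v ∈ D m,
        (FreeGroup.lift a (FreeGroup.mk (l :: L))).1 *ᵥ v ∈ D l := by
    intro L
    induction L with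
    | nil =>
      intro l _
      exact ⟨(l.1, !l.2), fun m hm v hv => step l v (hDE m _ hm hv)⟩
    | cons l' L ih =>
      intro l hl
      rw [FreeGroup.isReduced_cons_cons] at hl
      obtain ⟨x, hx⟩ := ih l' hl.2
      refine ⟨x, fun m hm v hv => ?_⟩
      have h1 := hx m hm v hv
      have : FreeGroup.mk (l :: l' :: L) = FreeGroup.mk [l] * FreeGroup.mk (l' :: L) := by
        rw [FreeGroup.mul_mk]; rfl
      rw [this, map_mul, Matrix.SpecialLinearGroup.coe_mul, ← Matrix.mulVec_mulVec]
      refine step l _ (hDE l' _ ?_ h1)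
      rintro h
      have h2 := hl.1 (by rw [h])
      rw [h] at h2
      simp at h2
  have hne : w.toWord ≠ [] := by simpa using hw
  obtain ⟨l, L, hL⟩ := List.exists_cons_of_ne_nil hne
  obtain ⟨x, hx⟩ := main L l (hL ▸ FreeGroup.isReduced_toWord)
  rw [← hL, FreeGroup.mk_toWord] at hx
  -- With four letters there is one distinct from both the exceptional letter and the first letter
  -- `l`; its point ends in `D l`, which lies in `E m`.
  obtain ⟨m, hm1, hm2⟩ : ∃ m : Fin 2 × Bool, m ≠ x ∧ m ≠ l := by
    have : ∀ x l : Fin 2 × Bool, ∃ m, m ≠ x ∧ m ≠ l := by decide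
    exact this x l
  exact ⟨m, hDE l m hm2.symm (hx m hm1 _ (hpt m))⟩

/-- The four intervals, in homogeneous coordinates, into which four points of the real projective
line cut it. -/
def intervalForm (e : Fin 4 → ℝ) : Fin 2 × Bool → (Fin 2 → ℝ) → ℝ
  | (0, true), v => (v 0 - e 0 * v 1) * (v 0 - e 3 * v 1)
  | (0, false), v => -((v 0 - e 1 * v 1) * (v 0 - e 2 * v 1))
  | (1, true), v => -((v 0 - e 0 * v 1) * (v 0 - e 1 * v 1))
  | (1, false), v => -((v 0 - e 2 * v 1) * (v 0 - e 3 * v 1))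

theorem intervalForm_smul (e : Fin 4 → ℝ) (l : Fin 2 × Bool) (c : ℝ) (v : Fin 2 → ℝ) :
    intervalForm e l (c • v) = c ^ 2 * intervalForm e l v := by
  obtain ⟨i, b⟩ := l
  fin_cases i <;> cases b <;> simp only [intervalForm, Pi.smul_apply, smul_eq_mul] <;> ring

theorem continuous_intervalForm (e : Fin 4 → ℝ) (l : Fin 2 × Bool) :
    Continuous (intervalForm e l) := by
  obtain ⟨i, b⟩ := l
  fin_cases i <;> cases b <;> unfold intervalForm <;> fun_prop

/-- The four linear factors are strictly monotone in the index, in a direction given by the sign of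
`v 1`, or all equal when `v 1 = 0`. So at most one of the four products can be positive, and then
the others are negative. -/
theorem intervalForm_neg {e : Fin 4 → ℝ} (h01 : e 0 < e 1) (h12 : e 1 < e 2) (h23 : e 2 < e 3)
    {l m : Fin 2 × Bool} (hlm : l ≠ m) {v : Fin 2 → ℝ} (hv : 0 < intervalForm e l v) :
    intervalForm e m v < 0 := by
  have aux : ∀ {f g h k : ℝ}, (g < f ∧ h < g ∧ k < h) ∨ (f < g ∧ g < h ∧ h < k) ∨
      (f = g ∧ g = h ∧ h = k) → ∀ Q : Fin 2 × Bool → ℝ, Q (0, true) = f * k →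
      Q (0, false) = -(g * h) → Q (1, true) = -(f * g) → Q (1, false) = -(h * k) →
      0 < Q l → Q m < 0 := by
    intro f g h k hc Q q1 q2 q3 q4 hl
    obtain ⟨i, b⟩ := l
    obtain ⟨j, c⟩ := m
    fin_cases i <;> cases b <;> fin_cases j <;> cases c <;>
      first
      | exact absurd rfl hlm
      | (simp only [Fin.zero_eta, Fin.mk_one, q1, q2, q3, q4, neg_pos, neg_lt_zero, mul_pos_iff,
          mul_neg_iff] at hl ⊢
         rcases hc with hc | hc | hc <;> rcases hl with hl | hl <;>
           first
           | (exfalso; linarith)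
           | (left; constructor <;> linarith)
           | (right; constructor <;> linarith))
  refine aux (f := v 0 - e 0 * v 1) (g := v 0 - e 1 * v 1) (h := v 0 - e 2 * v 1)
    (k := v 0 - e 3 * v 1) ?_ (fun l => intervalForm e l v) rfl rfl rfl rfl hv
  rcases lt_trichotomy (v 1) 0 with h | h | h
  · exact Or.inr (Or.inl ⟨by nlinarith, by nlinarith, by nlinarith⟩)
  · exact Or.inr (Or.inr (by simp [h]))
  · exact Or.inl ⟨by nlinarith, by nlinarith, by nlinarith⟩

/-- The end points of the four intervals of the ping-pong. -/
noncomputable def pingPongPoints (lam t : ℝ) : Fin 4 → ℝ :=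
  ![-Real.exp (lam - t), -Real.exp (-lam - t), Real.exp (-lam), Real.exp lam]

/-- The generators at real parameters. -/
noncomputable def realGens (lam : ℝ) (hlam : 0 < lam) (t : ℝ) : Fin 2 → SL(2, ℝ) :=
  ![diagS lam, bendTurnReal t * halfTurn lam hlam]

theorem pingPongPoints_lt {lam : ℝ} (hlam : 0 < lam) (t : ℝ) :
    pingPongPoints lam t 0 < pingPongPoints lam t 1 ∧
      pingPongPoints lam t 1 < pingPongPoints lam t 2 ∧
        pingPongPoints lam t 2 < pingPongPoints lam t 3 := by
  have h1 : Real.exp (-lam - t) < Real.exp (lam - t) := Real.exp_lt_exp.2 (by linarith)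
  have h2 : Real.exp (-lam) < Real.exp lam := Real.exp_lt_exp.2 (by linarith)
  have h3 := Real.exp_pos (-lam - t)
  have h4 := Real.exp_pos (-lam)
  exact ⟨neg_lt_neg h1, (neg_neg_of_pos h3).trans h4, h2⟩

/-- Each generator pairs end points: `S` takes points `1, 2` to `0, 3`, and `T` takes `2, 3` to `1,
0`. The pulled-back quadratic form therefore has the roots of its partner, and the negative factor
says that the exterior of one interval goes to the interior of the other. -/
theorem intervalForm_gens {lam : ℝ} (hlam : 0 < lam) (t : ℝ) (i : Fin 2) :
    ∃ c > 0, ∀ v, intervalForm (pingPongPoints lam t) (i, true) ((realGens lam hlam t i).1 *ᵥ v) =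
      -c * intervalForm (pingPongPoints lam t) (i, false) v := by
  have hp := Real.exp_pos lam
  have hr := Real.exp_pos (t / 2)
  have hs := (Real.sinh_pos_iff.2 hlam).ne'
  have e1 : Real.exp (-lam) = (Real.exp lam)⁻¹ := Real.exp_neg _
  have e2 : Real.exp (-(t / 2)) = (Real.exp (t / 2))⁻¹ := Real.exp_neg _
  have e3 : Real.exp (lam - t) = Real.exp lam * (Real.exp (t / 2) ^ 2)⁻¹ := by
    rw [← Real.exp_nat_mul, ← Real.exp_neg, ← Real.exp_add]; congr 1; push_cast; ring
  have e4 : Real.exp (-lam - t) = (Real.exp lam)⁻¹ * (Real.exp (t / 2) ^ 2)⁻¹ := by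
    rw [← Real.exp_nat_mul, ← Real.exp_neg, ← Real.exp_neg, ← Real.exp_add]
    congr 1; push_cast; ring
  have hpt0 : pingPongPoints lam t 0 = -(Real.exp lam * (Real.exp (t / 2) ^ 2)⁻¹) := by
    rw [← e3]; rfl
  have hpt1 : pingPongPoints lam t 1 = -((Real.exp lam)⁻¹ * (Real.exp (t / 2) ^ 2)⁻¹) := by
    rw [← e4]; rfl
  have hpt2 : pingPongPoints lam t 2 = (Real.exp lam)⁻¹ := e1
  have hpt3 : pingPongPoints lam t 3 = Real.exp lam := rfl
  have hsp : 2 * Real.sinh lam = Real.exp lam - (Real.exp lam)⁻¹ := by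
    rw [Real.sinh_eq, e1]; ring
  have hcp : 2 * Real.cosh lam = Real.exp lam + (Real.exp lam)⁻¹ := by
    rw [Real.cosh_eq, e1]; ring
  set p := Real.exp lam with hpdef
  set r := Real.exp (t / 2) with hrdef
  fin_cases i
  · refine ⟨p ^ 2, by positivity, fun v => ?_⟩
    have h0 : ((diagS lam).1 *ᵥ v) 0 = p * v 0 := by
      rw [mulVec_apply_fin_two]
      change p * v 0 + 0 * v 1 = _
      ring
    have h1 : ((diagS lam).1 *ᵥ v) 1 = p⁻¹ * v 1 := by
      rw [mulVec_apply_fin_two, ← e1]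
      change 0 * v 0 + Real.exp (-lam) * v 1 = _
      ring
    change (((diagS lam).1 *ᵥ v) 0 - pingPongPoints lam t 0 * ((diagS lam).1 *ᵥ v) 1) *
      (((diagS lam).1 *ᵥ v) 0 - pingPongPoints lam t 3 * ((diagS lam).1 *ᵥ v) 1) = -p ^ 2 *
        -((v 0 - pingPongPoints lam t 1 * v 1) * (v 0 - pingPongPoints lam t 2 * v 1))
    rw [h0, h1, hpt0, hpt1, hpt2, hpt3]
    field_simp
  · refine ⟨(r ^ 2)⁻¹, by positivity, fun v => ?_⟩
    have hh0 : ((halfTurn lam hlam).1 *ᵥ v) 0 = (v 0 - Real.cosh lam * v 1) / Real.sinh lam := by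
      rw [mulVec_apply_fin_two]
      change 1 / Real.sinh lam * v 0 + -Real.cosh lam / Real.sinh lam * v 1 = _
      ring
    have hh1 : ((halfTurn lam hlam).1 *ᵥ v) 1 = (Real.cosh lam * v 0 - v 1) / Real.sinh lam := by
      rw [mulVec_apply_fin_two]
      change Real.cosh lam / Real.sinh lam * v 0 + -1 / Real.sinh lam * v 1 = _
      ring
    have h0 : ((bendTurnReal t * halfTurn lam hlam).1 *ᵥ v) 0 =
        -r⁻¹ * ((Real.cosh lam * v 0 - v 1) / Real.sinh lam) := by
      rw [Matrix.SpecialLinearGroup.coe_mul, ← Matrix.mulVec_mulVec, mulVec_apply_fin_two, hh0,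
        hh1, ← e2]
      change 0 * _ + -Real.exp (-(t / 2)) * _ = _
      ring
    have h1 : ((bendTurnReal t * halfTurn lam hlam).1 *ᵥ v) 1 =
        r * ((v 0 - Real.cosh lam * v 1) / Real.sinh lam) := by
      rw [Matrix.SpecialLinearGroup.coe_mul, ← Matrix.mulVec_mulVec, mulVec_apply_fin_two, hh0,
        hh1]
      change r * _ + 0 * _ = _
      ring
    change -((((bendTurnReal t * halfTurn lam hlam).1 *ᵥ v) 0 - pingPongPoints lam t 0 *
      ((bendTurnReal t * halfTurn lam hlam).1 *ᵥ v) 1) *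
      (((bendTurnReal t * halfTurn lam hlam).1 *ᵥ v) 0 - pingPongPoints lam t 1 *
      ((bendTurnReal t * halfTurn lam hlam).1 *ᵥ v) 1)) = -(r ^ 2)⁻¹ *
        -((v 0 - pingPongPoints lam t 2 * v 1) * (v 0 - pingPongPoints lam t 3 * v 1))
    have hs' : Real.sinh lam = (p - p⁻¹) / 2 := by linarith
    have hc' : Real.cosh lam = (p + p⁻¹) / 2 := by linarith
    have hA : ((bendTurnReal t * halfTurn lam hlam).1 *ᵥ v) 0 - pingPongPoints lam t 0 *
        ((bendTurnReal t * halfTurn lam hlam).1 *ᵥ v) 1 = r⁻¹ * (v 0 - p * v 1) := by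
      rw [h0, h1, hpt0]
      field_simp
      rw [hs', hc']
      field_simp
      ring
    have hB : ((bendTurnReal t * halfTurn lam hlam).1 *ᵥ v) 0 - pingPongPoints lam t 1 *
        ((bendTurnReal t * halfTurn lam hlam).1 *ᵥ v) 1 = -r⁻¹ * (v 0 - p⁻¹ * v 1) := by
      rw [h0, h1, hpt1]
      field_simp
      rw [hs', hc']
      field_simp
      ring
    rw [hA, hB, hpt2, hpt3]
    field_simp

/-- The words in the generators of the family of groups. -/
noncomputable def wordMap (lam : ℝ) (hlam : 0 < lam) : FreeGroup (Fin 2) →* (ℂ → SL(2, ℂ)) :=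
  FreeGroup.lift ![constSL (diagS lam), bendTurn * constSL (halfTurn lam hlam)]

theorem wordMap_mem {lam : ℝ} (hlam : 0 < lam) (w : FreeGroup (Fin 2)) :
    wordMap lam hlam w ∈ motionGroup lam hlam := by
  have h : (wordMap lam hlam).range ≤ motionGroup lam hlam := by
    rw [wordMap, FreeGroup.range_lift_eq_closure, Subgroup.closure_le]
    rintro _ ⟨i, rfl⟩
    fin_cases i
    · exact constSL_mem diagS_mem
    · exact Subgroup.mul_mem _ bendTurn_mem (constSL_mem halfTurn_mem)
  exact h ⟨w, rfl⟩

theorem wordMap_ofReal {lam : ℝ} (hlam : 0 < lam) (t : ℝ) (w : FreeGroup (Fin 2)) :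
    wordMap lam hlam w t =
      Matrix.SpecialLinearGroup.map Complex.ofRealHom (FreeGroup.lift (realGens lam hlam t) w) := by
  have : (Pi.evalMonoidHom (fun _ : ℂ => SL(2, ℂ)) (t : ℂ)).comp (wordMap lam hlam) =
      (Matrix.SpecialLinearGroup.map Complex.ofRealHom).comp
        (FreeGroup.lift (realGens lam hlam t)) := by
    ext1 i
    fin_cases i
    · simp [wordMap, realGens]; rfl
    · simp [wordMap, realGens, bendTurn_ofReal]; rfl
  exact DFunLike.congr_fun this w

theorem exists_pingPong_vec {lam : ℝ} (hlam : 0 < lam) (t : ℝ) (l : Fin 2 × Bool) :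
    ∃ v, 0 < intervalForm (pingPongPoints lam t) l v := by
  obtain ⟨h01, h12, h23⟩ := pingPongPoints_lt hlam t
  have mid : ∀ {a b : ℝ}, a < b → 0 < -(((a + b) / 2 - a * 1) * ((a + b) / 2 - b * 1)) := by
    intro a b h
    nlinarith [mul_pos (sub_pos.2 h) (sub_pos.2 h)]
  obtain ⟨i, b⟩ := l
  fin_cases i <;> cases b
  · exact ⟨![_, 1], mid h12⟩
  · refine ⟨![1, 0], ?_⟩
    simp [intervalForm]
  · exact ⟨![_, 1], mid h23⟩
  · exact ⟨![_, 1], mid h01⟩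

theorem exists_word_neg {lam : ℝ} (hlam : 0 < lam) (t : ℝ) {pt : Fin 2 × Bool → Fin 2 → ℝ}
    (hpt : ∀ l, 0 < intervalForm (pingPongPoints lam t) l (pt l)) {w : FreeGroup (Fin 2)}
    (hw : w ≠ 1) : ∃ l, intervalForm (pingPongPoints lam t) l
      ((FreeGroup.lift (realGens lam hlam t) w).1 *ᵥ pt l) < 0 := by
  obtain ⟨h01, h12, h23⟩ := pingPongPoints_lt hlam t
  refine exists_ping_pong (D := fun l => {v | 0 < intervalForm (pingPongPoints lam t) l v})
    (E := fun l => {v | intervalForm (pingPongPoints lam t) l v < 0})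
    (fun l m hlm v hv => intervalForm_neg h01 h12 h23 hlm hv) ?_ ?_ hpt hw
  · intro i v hv
    obtain ⟨c, hc, h⟩ := intervalForm_gens hlam t i
    change 0 < intervalForm _ _ _
    rw [h]
    exact mul_pos_of_neg_of_neg (neg_neg_of_pos hc) hv
  · intro i v hv
    obtain ⟨c, hc, h⟩ := intervalForm_gens hlam t i
    have h' := h (((realGens lam hlam t i)⁻¹).1 *ᵥ v)
    rw [Matrix.mulVec_mulVec, ← Matrix.SpecialLinearGroup.coe_mul, mul_inv_cancel,
      Matrix.SpecialLinearGroup.coe_one, Matrix.one_mulVec] at h'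
    change 0 < intervalForm _ _ _
    change intervalForm _ _ _ < 0 at hv
    rw [h'] at hv
    nlinarith

theorem isCompact_sph_image {Q : (Fin 2 → ℝ) → ℝ} (hQ : Continuous Q) :
    IsCompact ((fun v => sph (toC v)) '' {v | ‖v‖ = 1 ∧ Q v ≤ 0}) := by
  have h1 : IsCompact {v : Fin 2 → ℝ | ‖v‖ = 1 ∧ Q v ≤ 0} := by
    have : {v : Fin 2 → ℝ | ‖v‖ = 1 ∧ Q v ≤ 0} = Metric.sphere 0 1 ∩ Q ⁻¹' Set.Iic 0 := by
      ext v; simp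
    rw [this]
    exact (isCompact_sphere 0 1).inter_right (isClosed_Iic.preimage hQ)
  refine h1.image_of_continuousOn (continuousOn_sph.comp ?_ ?_)
  · unfold toC; fun_prop
  · rintro v ⟨hv, -⟩
    refine toC_ne_zero ?_
    rintro rfl
    simp at hv

/-- No ping-pong domains are needed at `τ`. At the real parameter every non-trivial word sends one
of four points into a compact set not containing that point. Equivariance and injectivity of `Γ`
give the same for the partner points at `τ`, and the elements of `PSL(2, ℂ)` moving no partner point
into its compact set form a neighbourhood of the identity. -/
theorem exists_nhds_words {lam : ℝ} (hlam : 0 < lam) {t : ℝ} {τ : ℂ}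
    {Γ : Set (OnePoint ℂ × OnePoint ℂ)} (hΓ : IsCompact Γ) (hinj : Set.InjOn Prod.snd Γ)
    (hfst : Prod.fst '' Γ = realCircle)
    (hinv : ∀ g ∈ motionGroup lam hlam, ∀ q ∈ Γ,
        ((QuotientGroup.mk (g t) : PSL2C) • q.1, (QuotientGroup.mk (g τ) : PSL2C) • q.2) ∈ Γ) :
    ∃ N ∈ nhds (1 : PSL2C), ∀ w, (QuotientGroup.mk (wordMap lam hlam w τ) : PSL2C) ∈ N → w = 1 := by
  choose pt hpt using exists_pingPong_vec hlam t
  have hpt0 : ∀ l, pt l ≠ 0 := by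
    intro l h
    have := hpt l
    rw [h, ← zero_smul ℝ (0 : Fin 2 → ℝ), intervalForm_smul] at this
    simp at this
  have hy : ∀ l, ∃ y, (sph (toC (pt l)), y) ∈ Γ := by
    intro l
    have : sph (toC (pt l)) ∈ Prod.fst '' Γ := by
      rw [hfst]; exact ⟨pt l, hpt0 l, rfl⟩
    obtain ⟨⟨x, y⟩, h, rfl⟩ := this
    exact ⟨y, h⟩
  choose y hy using hy
  set K : Fin 2 × Bool → Set (OnePoint ℂ) := fun l =>
    (fun v => sph (toC v)) '' {v | ‖v‖ = 1 ∧ intervalForm (pingPongPoints lam t) l v ≤ 0} with hK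
  have hKmem : ∀ l v, v ≠ 0 → intervalForm (pingPongPoints lam t) l v ≤ 0 → sph (toC v) ∈ K l := by
    intro l v hv hQ
    have hn := norm_pos_iff.2 hv
    refine ⟨‖v‖⁻¹ • v, ⟨by rw [norm_smul, norm_inv, norm_norm, inv_mul_cancel₀ hn.ne'], ?_⟩, ?_⟩
    · rw [intervalForm_smul]
      exact mul_nonpos_of_nonneg_of_nonpos (by positivity) hQ
    · have : toC (‖v‖⁻¹ • v) = ((‖v‖⁻¹ : ℝ) : ℂ) • toC v := by
        ext i; simp [toC]
      simp only [this]
      exact sph_smul (by exact_mod_cast (inv_pos.2 hn).ne') _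
  have hKc : ∀ l, IsCompact (Prod.snd '' (Γ ∩ Prod.fst ⁻¹' K l)) := fun l =>
    (hΓ.inter_right ((isCompact_sph_image
      (continuous_intervalForm _ l)).isClosed.preimage continuous_fst)).image continuous_snd
  refine ⟨{h | ∀ l, h • y l ∉ Prod.snd '' (Γ ∩ Prod.fst ⁻¹' K l)}, ?_, ?_⟩
  · rw [Set.ofPred_forall]
    refine (isOpen_iInter_of_finite fun l => ?_).mem_nhds (Set.mem_iInter.2 fun l => ?_)
    · exact (hKc l).isClosed.isOpen_compl.preimage (continuous_smul_sphere (y l))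
    · rintro ⟨⟨x, y'⟩, ⟨hxy, v, ⟨hv1, hv2⟩, hvx⟩, hyy⟩
      simp only [one_smul] at hyy
      have h1 := congrArg Prod.fst (hinj hxy (hy l) hyy)
      simp only at h1 hvx
      have hv0 : v ≠ 0 := by
        rintro rfl; simp at hv1
      rw [h1, sph_eq_iff (toC_ne_zero hv0) (toC_ne_zero (hpt0 l))] at hvx
      have hcr : cross (pt l) v = 0 := by
        have : ((cross (pt l) v : ℝ) : ℂ) = -cross (toC v) (toC (pt l)) := by
          simp only [cross, toC]; push_cast; ring
        rw [hvx, neg_zero] at this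
        exact_mod_cast this
      obtain ⟨μ, hμ, hμv⟩ := eq_smul_of_cross_eq_zero (hpt0 l) hv0 hcr
      have := hpt l
      rw [hμv, intervalForm_smul] at this
      exact absurd this (not_lt.2 (mul_nonpos_of_nonneg_of_nonpos (sq_nonneg μ) hv2))
  · intro w hw
    by_contra hne
    obtain ⟨l, hl⟩ := exists_word_neg hlam t hpt hne
    refine hw l ⟨_, ⟨hinv _ (wordMap_mem hlam w) _ (hy l), ?_⟩, rfl⟩
    simp only [Set.mem_preimage]
    rw [mk_smul_sph _ (toC_ne_zero (hpt0 l)), wordMap_ofReal, map_mulVec_toC]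
    exact hKmem l _ (sl2_mulVec_ne_zero_real _ (hpt0 l)) hl.le

/-! ### Limit sets of discrete groups -/

section LimitSet

open Filter Topology

theorem tendsto_mk_smul_sph {ι : Type*} {l : Filter ι} {A : ι → SL(2, ℂ)} {c : ι → ℂ}
    (hc : ∀ k, c k ≠ 0) {B : Matrix (Fin 2) (Fin 2) ℂ}
    (h : ∀ i j, Tendsto (fun k => c k * A k i j) l (𝓝 (B i j))) {v : Fin 2 → ℂ}
    (hv : B *ᵥ v ≠ 0) :
    Tendsto (fun k => (QuotientGroup.mk (A k) : PSL2C) • sph v) l (𝓝 (sph (B *ᵥ v))) := by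
  have hv0 : v ≠ 0 := by
    rintro rfl; simp at hv
  have hi : ∀ i, Tendsto (fun k => c k * ((A k).1 *ᵥ v) i) l (𝓝 ((B *ᵥ v) i)) := by
    intro i
    simp only [mulVec_apply_fin_two]
    have := ((h i 0).mul_const (v 0)).add ((h i 1).mul_const (v 1))
    refine this.congr fun k => ?_
    ring
  have := tendsto_toSphere (hi 0) (hi 1) (apply_ne_zero_or hv)
  refine this.congr fun k => ?_
  rw [toSphere_mul _ _ _ (hc k), mk_smul_sph _ hv0]
  rfl

/-- Two elements of `G` near the same `h` have quotient near `1`, hence are equal. A convergent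
filter on `G` would thus concentrate on at most one element, which a filter finer than `cofinite`
cannot do. -/
theorem not_le_nhds_of_discrete {H : Type*} [Group H] [TopologicalSpace H] [IsTopologicalGroup H]
    {G : Subgroup H} [hG : DiscreteTopology G] {l : Filter H} [l.NeBot] (hl : l ≤ cofinite)
    (hGl : (G : Set H) ∈ l) (h : H) : ¬ l ≤ 𝓝 h := by
  intro hle
  obtain ⟨V, hV, hVG⟩ : ∃ V ∈ 𝓝 (1 : H), ∀ g ∈ V, g ∈ G → g = 1 := by
    have h1 : ({1} : Set G) ∈ 𝓝 (1 : G) := by simp [nhds_discrete]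
    rw [nhds_subtype_eq_comap, mem_comap] at h1
    obtain ⟨V, hV, hV1⟩ := h1
    refine ⟨V, hV, fun g hg hgG => ?_⟩
    exact congrArg Subtype.val (Set.mem_singleton_iff.1 (hV1 (show (⟨g, hgG⟩ : G) ∈ _ from hg)))
  have hc : Tendsto (fun q : H × H => q.1⁻¹ * q.2) (𝓝 h ×ˢ 𝓝 h) (𝓝 1) := by
    rw [← nhds_prod_eq]
    have : Continuous fun q : H × H => q.1⁻¹ * q.2 := by fun_prop
    simpa using this.tendsto (h, h)
  obtain ⟨W, hW, hWV⟩ := mem_prod_same_iff.1 (hc hV)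
  have hmem : W ∩ G ∈ l := inter_mem (hle hW) hGl
  have hsub : (W ∩ G).Subsingleton := by
    rintro a ⟨ha, haG⟩ b ⟨hb, hbG⟩
    have := hVG _ (hWV (Set.mk_mem_prod ha hb)) (G.mul_mem (G.inv_mem haG) hbG)
    exact (inv_mul_eq_one.1 this)
  have hfin : (W ∩ G)ᶜ ∈ l := hl hsub.finite.compl_mem_cofinite
  have := inter_mem hmem hfin
  rw [Set.inter_compl_self] at this
  exact NeBot.ne inferInstance (empty_mem_iff_bot.1 this)

/-- Along an ultrafilter, elements of `SL(2, ℂ)` either converge, or converge after scaling to a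
non-zero singular matrix. -/
theorem exists_limit_matrix (𝒰 : Ultrafilter PSL2C) :
    (∃ h : PSL2C, (𝒰 : Filter PSL2C) ≤ 𝓝 h) ∨
      ∃ (A : PSL2C → SL(2, ℂ)) (c : PSL2C → ℂ) (B : Matrix (Fin 2) (Fin 2) ℂ),
        (∀ g, QuotientGroup.mk (A g) = g) ∧ (∀ g, c g ≠ 0) ∧
          (∀ i j, Tendsto (fun g => c g * A g i j) 𝒰 (𝓝 (B i j))) ∧ B ≠ 0 ∧
            B 0 0 * B 1 1 - B 0 1 * B 1 0 = 0 := by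
  choose A hA using QuotientGroup.mk_surjective (s := Subgroup.center SL(2, ℂ))
  set f : PSL2C → Fin 2 → Fin 2 → ℂ := fun g i j => A g i j with hf
  have hdet : ∀ g, f g 0 0 * f g 1 1 - f g 0 1 * f g 1 0 = 1 := by
    intro g
    have := (A g).det_coe
    rwa [Matrix.det_fin_two] at this
  have hn : ∀ g, 0 < ‖f g‖ := by
    intro g
    refine norm_pos_iff.2 fun h => ?_
    have := hdet g
    simp [h] at this
  set c : PSL2C → ℂ := fun g => ((‖f g‖⁻¹ : ℝ) : ℂ) with hc
  have hc0 : ∀ g, c g ≠ 0 := fun g => by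
    simpa [hc] using (hn g).ne'
  have hcn : ∀ g, ‖c g‖ = ‖f g‖⁻¹ := fun g => by simp [hc]
  set u : PSL2C → Fin 2 → Fin 2 → ℂ := fun g => c g • f g with hu
  have hu1 : ∀ g, u g ∈ Metric.sphere (0 : Fin 2 → Fin 2 → ℂ) 1 := by
    intro g
    rw [mem_sphere_zero_iff_norm, hu]
    simp only
    rw [norm_smul, hcn, inv_mul_cancel₀ (hn g).ne']
  obtain ⟨B, hB1, hB⟩ := (isCompact_sphere (0 : Fin 2 → Fin 2 → ℂ) 1).ultrafilter_le_nhds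
    (𝒰.map u) (by
      rw [le_principal_iff, Ultrafilter.coe_map, mem_map]
      exact Filter.univ_mem' hu1)
  have hlim : ∀ i j, Tendsto (fun g => c g * A g i j) 𝒰 (𝓝 (B i j)) := by
    intro i j
    have h1 : Tendsto u 𝒰 (𝓝 B) := hB
    exact tendsto_pi_nhds.1 (tendsto_pi_nhds.1 h1 i) j
  have hB0 : B ≠ 0 := by
    rintro rfl
    simp at hB1
  by_cases hδ : B 0 0 * B 1 1 - B 0 1 * B 1 0 = 0
  -- When the limit has non-zero determinant, `c g ^ 2` tends to that determinant; the positive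
  -- scalars `c g` then converge to a non-zero limit, and dividing by them gives convergence of the
  -- matrices themselves.
  · exact Or.inr ⟨A, c, B, hA, hc0, hlim, hB0, hδ⟩
  · left
    have hsq : Tendsto (fun g => c g ^ 2) 𝒰 (𝓝 (B 0 0 * B 1 1 - B 0 1 * B 1 0)) := by
      have := ((hlim 0 0).mul (hlim 1 1)).sub ((hlim 0 1).mul (hlim 1 0))
      refine this.congr fun g => ?_
      linear_combination c g ^ 2 * hdet g
    have hnorm : Tendsto (fun g => ‖f g‖⁻¹) 𝒰
        (𝓝 (Real.sqrt ‖B 0 0 * B 1 1 - B 0 1 * B 1 0‖)) := by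
      refine (hsq.norm.sqrt).congr fun g => ?_
      rw [norm_pow, hcn, Real.sqrt_sq (inv_nonneg.2 (hn g).le)]
    set ρ := Real.sqrt ‖B 0 0 * B 1 1 - B 0 1 * B 1 0‖ with hρ
    have hρ0 : ρ ≠ 0 := (Real.sqrt_pos.2 (norm_pos_iff.2 hδ)).ne'
    have hclim : Tendsto (fun g => (c g)⁻¹) 𝒰 (𝓝 ((ρ : ℂ)⁻¹)) :=
      ((Complex.continuous_ofReal.tendsto ρ).comp hnorm).inv₀ (by exact_mod_cast hρ0)
    have hAlim : ∀ i j, Tendsto (fun g => A g i j) 𝒰 (𝓝 ((ρ : ℂ)⁻¹ * B i j)) := by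
      intro i j
      refine (hclim.mul (hlim i j)).congr fun g => ?_
      rw [inv_mul_cancel_left₀ (hc0 g)]
    have hdetlim : (Matrix.of fun i j => (ρ : ℂ)⁻¹ * B i j).det = 1 := by
      rw [Matrix.det_fin_two]
      simp only [Matrix.of_apply]
      refine tendsto_nhds_unique
        (((hAlim 0 0).mul (hAlim 1 1)).sub ((hAlim 0 1).mul (hAlim 1 0))) ?_
      refine tendsto_const_nhds.congr fun g => ?_
      exact (hdet g).symm
    refine ⟨QuotientGroup.mk ⟨_, hdetlim⟩, ?_⟩
    have h1 : Tendsto A 𝒰 (𝓝 (⟨_, hdetlim⟩ : SL(2, ℂ))) := by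
      refine tendsto_subtype_rng.2 (tendsto_pi_nhds.2 fun i => tendsto_pi_nhds.2 fun j => ?_)
      exact hAlim i j
    have h2 : Tendsto (fun g => (QuotientGroup.mk (A g) : PSL2C)) 𝒰
        (𝓝 (QuotientGroup.mk ⟨_, hdetlim⟩)) :=
      (QuotientGroup.continuous_mk.tendsto _).comp h1
    simp only [hA] at h2
    exact h2

/-- The limit set of a discrete group is contained in every closed invariant set with at least two
points. -/
theorem kleinianLimitSet_subset {G : Subgroup PSL2C} [DiscreteTopology G] {Λ : Set (OnePoint ℂ)}
    (hcl : IsClosed Λ) (hinv : ∀ g ∈ G, ∀ x ∈ Λ, g • x ∈ Λ) (hnt : Λ.Nontrivial) :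
    kleinianLimitSet G ⊆ Λ := by
  rintro x ⟨z, hz⟩
  -- Infinitely many `g` in `G` bring `z` near `x`, so an ultrafilter finer than `F` yields pairwise
  -- distinct elements along which `g • z` tends to `x`.
  set F := cofinite ⊓ (comap (fun g : PSL2C => g • z) (𝓝 x) ⊓ 𝓟 (G : Set PSL2C)) with hF
  have hne : F.NeBot := by
    rw [hF, inf_neBot_iff]
    intro s hs s' hs'
    obtain ⟨U, hU, hUs⟩ := mem_comap.1 (mem_inf_principal.1 hs')
    obtain ⟨g, ⟨hgG, hgU⟩, hgs⟩ := (hz U hU).exists_notMem_finite (mem_cofinite.1 hs)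
    exact ⟨g, not_not.1 hgs, hUs hgU hgG⟩
  set 𝒰 := Ultrafilter.of F
  have h𝒰 : (𝒰 : Filter PSL2C) ≤ F := Ultrafilter.of_le F
  have hcof : (𝒰 : Filter PSL2C) ≤ cofinite := h𝒰.trans inf_le_left
  have hG : (G : Set PSL2C) ∈ (𝒰 : Filter PSL2C) :=
    le_principal_iff.1 (h𝒰.trans (inf_le_right.trans inf_le_right))
  have hx : Tendsto (fun g : PSL2C => g • z) 𝒰 (𝓝 x) :=
    tendsto_iff_comap.2 (h𝒰.trans (inf_le_right.trans inf_le_left))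
  rcases exists_limit_matrix 𝒰 with ⟨h, hh⟩ | ⟨A, c, B, hA, hc, hlim, hB0, hdet⟩
  · exact absurd hh (not_le_nhds_of_discrete hcof hG h)
  have mem_of_tendsto : ∀ {y a : OnePoint ℂ}, y ∈ Λ → Tendsto (fun g : PSL2C => g • y) 𝒰 (𝓝 a) →
      a ∈ Λ := fun {y a} hy ha =>
    hcl.mem_of_tendsto ha (mem_of_superset hG fun g hg => hinv g hg y hy)
  have mem_of_tendsto_inv : ∀ {y a : OnePoint ℂ}, y ∈ Λ →
      Tendsto (fun g : PSL2C => g⁻¹ • y) 𝒰 (𝓝 a) → a ∈ Λ := fun {y a} hy ha =>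
    hcl.mem_of_tendsto ha (mem_of_superset hG fun g hg => hinv _ (G.inv_mem hg) y hy)
  have hconv : ∀ v, B *ᵥ v ≠ 0 → Tendsto (fun g : PSL2C => g • sph v) 𝒰 (𝓝 (sph (B *ᵥ v))) := by
    intro v hv
    have := tendsto_mk_smul_sph hc hlim hv
    simpa only [hA] using this
  -- The adjugate of `B`, to which the scaled inverses converge. As `B` and `B'` are singular, each
  -- sends all vectors outside its kernel to one point of the sphere, and the image of `B'` is the
  -- kernel of `B`.
  set B' : Matrix (Fin 2) (Fin 2) ℂ := !![B 1 1, -B 0 1; -B 1 0, B 0 0] with hB'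
  have hconv' : ∀ v, B' *ᵥ v ≠ 0 →
      Tendsto (fun g : PSL2C => g⁻¹ • sph v) 𝒰 (𝓝 (sph (B' *ᵥ v))) := by
    intro v hv
    have := tendsto_mk_smul_sph (l := (𝒰 : Filter PSL2C)) (A := fun g => (A g)⁻¹) hc (B := B') ?_ hv
    · simpa only [QuotientGroup.mk_inv, hA] using this
    · intro i j
      simp only [Matrix.SpecialLinearGroup.SL2_inv_expl]
      fin_cases i <;> fin_cases j
      · simpa [hB'] using hlim 1 1
      · simpa [hB'] using (hlim 0 1).neg
      · simpa [hB'] using (hlim 1 0).neg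
      · simpa [hB'] using hlim 0 0
  have hB'0 : B' ≠ 0 := by
    intro h
    apply hB0
    have e00 : B' 0 0 = 0 := by rw [h]; rfl
    have e01 : B' 0 1 = 0 := by rw [h]; rfl
    have e10 : B' 1 0 = 0 := by rw [h]; rfl
    have e11 : B' 1 1 = 0 := by rw [h]; rfl
    simp only [hB', Matrix.of_apply, Matrix.cons_val_zero, Matrix.cons_val_one, Matrix.cons_val',
      Matrix.cons_val_fin_one, neg_eq_zero] at e00 e01 e10 e11
    ext i j
    fin_cases i <;> fin_cases j <;> assumption
  have hexists : ∀ C : Matrix (Fin 2) (Fin 2) ℂ, C ≠ 0 → ∃ v : Fin 2 → ℂ, sph v ∈ Λ ∧ C *ᵥ v ≠ 0 := by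
    intro C hC
    obtain ⟨y, hy, y', hy', hne⟩ := hnt
    obtain ⟨v, hv, rfl⟩ := exists_sph_eq y
    obtain ⟨v', hv', rfl⟩ := exists_sph_eq y'
    by_contra! hcon
    have h1 := hcon v hy
    have h2 := hcon v' hy'
    apply hC
    have hcr : cross v v' ≠ 0 := fun h => hne ((sph_eq_iff hv hv').2 h)
    ext i j
    have e1 := congrFun h1 i
    have e2 := congrFun h2 i
    rw [mulVec_apply_fin_two, Pi.zero_apply] at e1 e2
    unfold cross at hcr
    have : ∀ j, (v 0 * v' 1 - v' 0 * v 1) * C i j = 0 :=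
      Fin.forall_fin_two.2 ⟨by linear_combination v' 1 * e1 - v 1 * e2,
        by linear_combination v 0 * e2 - v' 0 * e1⟩
    exact (mul_eq_zero.1 (this j)).resolve_left hcr
  obtain ⟨vz, hvz, rfl⟩ := exists_sph_eq z
  -- If `z` is the kernel of `B`, it is a limit of inverses applied to a point of `Λ`, so it is in
  -- `Λ`, and so is `x`. Otherwise `x` is the image of `B`, a limit of translates of a point of `Λ`.
  -- Two points in `Λ` guarantee one outside the relevant kernel.
  by_cases hz0 : B *ᵥ vz = 0
  · obtain ⟨v, hv, hBv⟩ := hexists B' hB'0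
    have h1 := mem_of_tendsto_inv hv (hconv' v hBv)
    have h2 : sph (B' *ᵥ v) = sph vz := by
      rw [sph_eq_iff hBv hvz]
      have e0 := congrFun hz0 0
      have e1 := congrFun hz0 1
      rw [mulVec_apply_fin_two, Pi.zero_apply] at e0 e1
      rw [cross, mulVec_apply_fin_two, mulVec_apply_fin_two]
      simp only [hB', Matrix.of_apply, Matrix.cons_val_zero, Matrix.cons_val_one, Matrix.cons_val',
        Matrix.cons_val_fin_one]
      linear_combination v 0 * e1 - v 1 * e0
    rw [h2] at h1
    exact mem_of_tendsto h1 hx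
  · obtain ⟨v, hv, hBv⟩ := hexists B hB0
    have h1 := mem_of_tendsto hv (hconv v hBv)
    have h2 : sph (B *ᵥ v) = sph (B *ᵥ vz) := by
      rw [sph_eq_iff hBv hz0, cross]
      simp only [mulVec_apply_fin_two]
      linear_combination (v 0 * vz 1 - vz 0 * v 1) * hdet
    rw [tendsto_nhds_unique hx (hconv vz hz0), ← h2]
    exact h1

/-- A non-trivial connected `T1` space has no isolated points, so neighbourhoods in the circle are
infinite. -/
theorem infinite_inter_of_homeomorph_circle {X : Type*} [TopologicalSpace X] {Λ : Set X}
    (e : Λ ≃ₜ Circle) {x : X} (hx : x ∈ Λ) {U : Set X} (hU : U ∈ 𝓝 x) : (U ∩ Λ).Infinite := by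
  have hnt : Nontrivial Circle := by
    refine ⟨1, Circle.exp Real.pi, fun h => ?_⟩
    have := congrArg (fun z : Circle => (z : ℂ)) h
    simp only [Circle.coe_one, Circle.coe_exp, Complex.exp_pi_mul_I] at this
    norm_num at this
  have hnb := ConnectedSpace.neBot_nhdsWithin_compl_of_nontrivial_of_t1space (e ⟨x, hx⟩)
  have hc : Continuous fun c => (e.symm c : X) := by fun_prop
  have h1 : (fun c => (e.symm c : X)) ⁻¹' U ∈ 𝓝 (e ⟨x, hx⟩) := by
    apply hc.continuousAt.preimage_mem_nhds
    simpa using hU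
  have h2 := infinite_of_mem_nhds _ h1
  refine (h2.image (f := fun c => (e.symm c : X)) ?_).mono ?_
  · exact (Subtype.val_injective.comp e.symm.injective).injOn
  · rintro _ ⟨c, hc, rfl⟩
    exact ⟨hc, (e.symm c).2⟩

/-- Perfect sets in the closure of an orbit are contained in the limit set. -/
theorem subset_kleinianLimitSet {G : Subgroup PSL2C} {Λ : Set (OnePoint ℂ)} {p : OnePoint ℂ}
    (hp : Λ ⊆ closure {x | ∃ g ∈ G, g • p = x})
    (hperf : ∀ x ∈ Λ, ∀ U ∈ 𝓝 x, (U ∩ Λ).Infinite) : Λ ⊆ kleinianLimitSet G := by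
  intro x hx
  refine ⟨p, fun U hU hfin => ?_⟩
  have hfin' : (interior U ∩ {x | ∃ g ∈ G, g • p = x}).Finite := by
    refine (hfin.image fun g : PSL2C => g • p).subset ?_
    rintro _ ⟨hgU, g, hg, rfl⟩
    exact ⟨g, ⟨hg, interior_subset hgU⟩, rfl⟩
  refine hperf x hx (interior U) (interior_mem_nhds.2 hU) (hfin'.subset ?_)
  refine (Set.inter_subset_inter_right _ hp).trans ((isOpen_interior.inter_closure).trans ?_)
  rw [hfin'.isClosed.closure_eq]

end LimitSet

/-! ### Removing the auxiliary involutions -/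

section Orbit

open Pointwise

variable {H X : Type*} [Group H] [MulAction H X]

/-- Conjugation by `e` inverts both generators `s` and `e f`. -/
theorem conj_mem_closure_pair {s e f : H} (he : e * e = 1) (hf : f * f = 1)
    (hes : e * s * e = s⁻¹) {g : H} (hg : g ∈ Subgroup.closure {s, e * f}) :
    e * g * e ∈ Subgroup.closure {s, e * f} := by
  induction hg using Subgroup.closure_induction with
  | mem x hx =>
    rcases hx with rfl | hx
    · rw [hes]
      exact Subgroup.inv_mem _ (Subgroup.subset_closure (by simp))
    · rw [Set.mem_singleton_iff.1 hx]
      have : e * (e * f) * e = (e * f)⁻¹ := by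
        rw [_root_.mul_inv_rev, ← mul_assoc, he, one_mul, inv_eq_of_mul_eq_one_left he,
          inv_eq_of_mul_eq_one_left hf]
      rw [this]
      exact Subgroup.inv_mem _ (Subgroup.subset_closure (by simp))
  | one => rw [mul_one, he]; exact Subgroup.one_mem _
  | mul x y _ _ hx hy =>
    have : e * (x * y) * e = (e * x * e) * (e * y * e) := by
      calc e * (x * y) * e = e * x * (1 * y * e) := by group
        _ = _ := by rw [← he]; group
    rw [this]
    exact Subgroup.mul_mem _ hx hy
  | inv x _ hx =>
    have : e * x⁻¹ * e = (e * x * e)⁻¹ := by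
      rw [_root_.mul_inv_rev, _root_.mul_inv_rev, inv_eq_of_mul_eq_one_left he, mul_assoc]
    rw [this]
    exact Subgroup.inv_mem _ hx

/-- The orbit of `p` under the subgroup `⟨s, e f⟩` of `⟨s, e, f⟩` is stable under the latter. -/
theorem mem_stabilizer_orbit {s e f : H} (he : e * e = 1) (hf : f * f = 1)
    (hes : e * s * e = s⁻¹) {p : X} (hp : (s * f) • p = p) {O : Set X}
    (hO : O = {x | ∃ g ∈ Subgroup.closure {s, e * f}, g • p = x}) :
    s ∈ MulAction.stabilizer H O ∧ e ∈ MulAction.stabilizer H O ∧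
      f ∈ MulAction.stabilizer H O := by
  have hGO : Subgroup.closure {s, e * f} ≤ MulAction.stabilizer H O := by
    intro h hh
    rw [MulAction.mem_stabilizer_set]
    intro x
    rw [hO]
    constructor
    · rintro ⟨g, hg, hgx⟩
      exact ⟨h⁻¹ * g, Subgroup.mul_mem _ (Subgroup.inv_mem _ hh) hg, by
        rw [mul_smul, hgx, inv_smul_smul]⟩
    · rintro ⟨g, hg, rfl⟩
      exact ⟨h * g, Subgroup.mul_mem _ hh hg, mul_smul _ _ _⟩
  have hs : s ∈ Subgroup.closure {s, e * f} := Subgroup.subset_closure (by simp)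
  have hT : e * f ∈ Subgroup.closure {s, e * f} := Subgroup.subset_closure (by simp)
  have hfp : f • p = s⁻¹ • p := by
    rw [eq_inv_smul_iff, ← mul_smul, hp]
  -- This is why the smaller group suffices: `p` is fixed by `s f`, so `e • p = (e f) • (f • p) = (e
  -- f s⁻¹) • p` is already in its orbit.
  have hep : e • p = (e * f * s⁻¹) • p := by
    rw [mul_smul, ← hfp, ← mul_smul, mul_assoc, hf, mul_one]
  have heO : ∀ x ∈ O, e • x ∈ O := by
    rw [hO]
    rintro _ ⟨g, hg, rfl⟩
    refine ⟨e * g * e * (e * f * s⁻¹), Subgroup.mul_mem _ (conj_mem_closure_pair he hf hes hg)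
      (Subgroup.mul_mem _ hT (Subgroup.inv_mem _ hs)), ?_⟩
    rw [mul_smul, ← hep, ← mul_smul, mul_assoc, he, mul_one, mul_smul]
  have hestab : e ∈ MulAction.stabilizer H O := by
    rw [MulAction.mem_stabilizer_set]
    refine fun x => ⟨fun h => ?_, heO x⟩
    have := heO _ h
    rwa [← mul_smul, he, one_smul] at this
  refine ⟨hGO hs, hestab, ?_⟩
  have : f = e * (e * f) := by rw [← mul_assoc, he, one_mul]
  rw [this]
  exact Subgroup.mul_mem _ hestab (hGO hT)

/-- As `e` inverts `s`, it cancels out of the commutator. What remains involves only `f` and `s`, so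
it does not depend on the bending parameter. -/
theorem commutator_eq_sq {s e f : H} (he : e * e = 1) (hf : f * f = 1) (hes : e * s * e = s⁻¹) :
    (e * f)⁻¹ * s⁻¹ * (e * f) * s = (f * s) * (f * s) := by
  rw [_root_.mul_inv_rev, inv_eq_of_mul_eq_one_left he, inv_eq_of_mul_eq_one_left hf, ← hes]
  calc f * e * (e * s * e) * (e * f) * s = f * (e * e) * s * (e * e) * f * s := by group
    _ = _ := by rw [he]; group

end Orbit

/-! ### The normalised generators in `PSL(2, ℂ)` -/

theorem mk_eq_of_eq_neg {A B : SL(2, ℂ)} (h : A = -B) :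
    (QuotientGroup.mk A : PSL2C) = QuotientGroup.mk B := by
  rw [QuotientGroup.eq, h]
  refine Subgroup.mem_center_iff.2 fun C => ?_
  simp

/-- Evaluation at `τ`, followed by the projection to `PSL(2, ℂ)`. -/
noncomputable def evalPSL (τ : ℂ) : (ℂ → SL(2, ℂ)) →* PSL2C :=
  (QuotientGroup.mk' (Subgroup.center SL(2, ℂ))).comp
    (Pi.evalMonoidHom (fun _ : ℂ => SL(2, ℂ)) τ)

theorem evalPSL_apply (τ : ℂ) (g : ℂ → SL(2, ℂ)) : evalPSL τ g = QuotientGroup.mk (g τ) := rfl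

theorem evalPSL_neg_one (τ : ℂ) {g : ℂ → SL(2, ℂ)} (h : g τ = -1) : evalPSL τ g = 1 := by
  rw [evalPSL_apply, mk_eq_of_eq_neg h, QuotientGroup.mk_one]

theorem evalPSL_bend_sq (τ : ℂ) : evalPSL τ bendTurn * evalPSL τ bendTurn = 1 := by
  rw [← map_mul]
  apply evalPSL_neg_one
  ext i j
  rw [Pi.mul_apply, mul_entries]
  fin_cases i <;> fin_cases j <;> simp [bendTurn, ← Complex.exp_add]

theorem evalPSL_half_sq {lam : ℝ} (hlam : 0 < lam) (τ : ℂ) :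
    evalPSL τ (constSL (halfTurn lam hlam)) * evalPSL τ (constSL (halfTurn lam hlam)) = 1 := by
  rw [← map_mul, ← map_mul, halfTurn_mul_self]
  apply evalPSL_neg_one
  ext i j
  rw [constSL_apply]
  fin_cases i <;> fin_cases j <;> simp

theorem diagS_inv (lam : ℝ) : (diagS lam)⁻¹ = diagS (-lam) := by
  refine inv_eq_of_mul_eq_one_right ?_
  ext i j
  rw [mul_entries]
  fin_cases i <;> fin_cases j <;> simp [diagS, ← Real.exp_add]

theorem evalPSL_bend_conj (lam : ℝ) (τ : ℂ) :
    evalPSL τ bendTurn * evalPSL τ (constSL (diagS lam)) * evalPSL τ bendTurn =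
      (evalPSL τ (constSL (diagS lam)))⁻¹ := by
  rw [← map_inv, ← map_mul, ← map_mul, ← map_inv, diagS_inv, evalPSL_apply, evalPSL_apply]
  apply mk_eq_of_eq_neg
  ext i j
  rw [Pi.mul_apply, Pi.mul_apply, mul_entries, mul_entries, mul_entries,
    Matrix.SpecialLinearGroup.coe_neg, Matrix.neg_apply, constSL_apply, constSL_apply,
    constSL_apply, constSL_apply, constSL_apply]
  fin_cases i <;> fin_cases j <;>
    simp [bendTurn, diagS, ← Complex.exp_add]

theorem evalPSL_cusp {lam : ℝ} (hlam : 0 < lam) (τ : ℂ) :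
    (evalPSL τ (constSL (diagS lam)) * evalPSL τ (constSL (halfTurn lam hlam))) •
      sph (cuspVec lam) = sph (cuspVec lam) := by
  rw [← map_mul, ← map_mul, evalPSL_apply, mk_smul_sph _ (cuspVec_ne_zero lam)]
  congr 1
  rw [← toC_cuspVecReal]
  refine (map_mulVec_toC _ _).trans ?_
  congr 1
  have hs := (Real.sinh_pos_iff.2 hlam).ne'
  have h1 : Real.sinh lam = Real.exp lam - Real.cosh lam := by
    rw [← Real.cosh_add_sinh]; ring
  have h2 : Real.cosh lam * Real.exp lam - 1 = Real.exp lam * Real.sinh lam := by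
    have := Real.cosh_sq_sub_sinh_sq lam
    rw [h1] at this ⊢
    linear_combination this
  have e1 : Real.exp lam * Real.exp (-lam) = 1 := by rw [← Real.exp_add]; simp
  rw [Matrix.SpecialLinearGroup.coe_mul, ← Matrix.mulVec_mulVec]
  have hh : (halfTurn lam hlam).1 *ᵥ cuspVecReal lam = ![1, Real.exp lam] := by
    ext i; fin_cases i
    · rw [mulVec_apply_fin_two]
      change 1 / Real.sinh lam * Real.exp lam + -Real.cosh lam / Real.sinh lam * 1 = 1
      field_simp
      linarith
    · rw [mulVec_apply_fin_two]
      change Real.cosh lam / Real.sinh lam * Real.exp lam + -1 / Real.sinh lam * 1 = Real.exp lam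
      field_simp
      linarith
  rw [hh]
  ext i; fin_cases i
  · rw [mulVec_apply_fin_two]
    change Real.exp lam * 1 + 0 * Real.exp lam = Real.exp lam
    ring
  · rw [mulVec_apply_fin_two]
    change 0 * 1 + Real.exp (-lam) * Real.exp lam = 1
    linarith

/-- The real matrix `M = f S` has trace `2`, so Cayley–Hamilton gives `M ^ 2 = 2 M - 1`. The fixed
point equation of `M ^ 2` is then a non-zero multiple of `(v 0 - exp (-λ) * v 1) ^ 2 = 0`, with a
single root on the sphere. -/
theorem isParabolic_half_diag {lam : ℝ} (hlam : 0 < lam) (τ : ℂ) :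
    IsParabolicPSL ((evalPSL τ (constSL (halfTurn lam hlam)) * evalPSL τ (constSL (diagS lam))) *
      (evalPSL τ (constSL (halfTurn lam hlam)) * evalPSL τ (constSL (diagS lam)))) := by
  have hs := (Real.sinh_pos_iff.2 hlam).ne'
  have hC := (Real.cosh_pos lam).ne'
  have hp := (Real.exp_pos lam).ne'
  have h1 : Real.sinh lam = Real.exp lam - Real.cosh lam := by
    rw [← Real.cosh_add_sinh]; ring
  have h2 : 2 * Real.cosh lam = Real.exp lam + (Real.exp lam)⁻¹ := by
    rw [Real.cosh_eq, Real.exp_neg]; ring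
  set M := halfTurn lam hlam * diagS lam with hM
  have m00 : M 0 0 = Real.exp lam / Real.sinh lam := by
    rw [hM, mul_entries]
    change 1 / Real.sinh lam * Real.exp lam + -Real.cosh lam / Real.sinh lam * 0 = _
    ring
  have m01 : M 0 1 = -Real.cosh lam * (Real.exp lam)⁻¹ / Real.sinh lam := by
    rw [hM, mul_entries, ← Real.exp_neg]
    change 1 / Real.sinh lam * 0 + -Real.cosh lam / Real.sinh lam * Real.exp (-lam) = _
    ring
  have m10 : M 1 0 = Real.cosh lam * Real.exp lam / Real.sinh lam := by
    rw [hM, mul_entries]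
    change Real.cosh lam / Real.sinh lam * Real.exp lam + -1 / Real.sinh lam * 0 = _
    ring
  have m11 : M 1 1 = -(Real.exp lam)⁻¹ / Real.sinh lam := by
    rw [hM, mul_entries, ← Real.exp_neg]
    change Real.cosh lam / Real.sinh lam * 0 + -1 / Real.sinh lam * Real.exp (-lam) = _
    ring
  have htr : M 0 0 + M 1 1 = 2 := by
    rw [m00, m11]
    field_simp
    have h3 : 2 * Real.cosh lam * Real.exp lam = Real.exp lam ^ 2 + 1 := by
      rw [h2]; field_simp
    rw [h1]
    linear_combination h3
  have hdet := sl2_det M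
  have hcross : ∀ v : Fin 2 → ℂ, cross ((constSL (M * M) τ).1 *ᵥ v) v =
      -2 * (Real.cosh lam * Real.exp lam / Real.sinh lam : ℝ) *
        (v 0 - ((Real.exp lam)⁻¹ : ℝ) * v 1) ^ 2 := by
    intro v
    have hq : ∀ i j, (M * M) i j = 2 * M i j - (1 : SL(2, ℝ)) i j := by
      intro i j
      rw [mul_entries]
      fin_cases i <;> fin_cases j
      · simp; linear_combination M 0 0 * htr - hdet
      · simp; linear_combination M 0 1 * htr
      · simp; linear_combination M 1 0 * htr
      · simp; linear_combination M 1 1 * htr - hdet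
    rw [cross, mulVec_apply_fin_two, mulVec_apply_fin_two, constSL_apply, constSL_apply,
      constSL_apply, constSL_apply, hq, hq, hq, hq]
    have hd : M 0 0 - M 1 1 = 2 * (Real.cosh lam * Real.exp lam / Real.sinh lam) *
        (Real.exp lam)⁻¹ := by
      rw [m00, m11]
      field_simp
      have h3 : 2 * Real.cosh lam * Real.exp lam = Real.exp lam ^ 2 + 1 := by
        rw [h2]; field_simp
      linear_combination -h3
    have hb : M 0 1 = -(Real.cosh lam * Real.exp lam / Real.sinh lam) * (Real.exp lam)⁻¹ ^ 2 := by
      rw [m01]; field_simp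
    have hd' : ((M 0 0 : ℝ) : ℂ) = M 1 1 + 2 * (Real.cosh lam * Real.exp lam / Real.sinh lam : ℝ) *
        ((Real.exp lam)⁻¹ : ℝ) := by
      rw [sub_eq_iff_eq_add'.1 hd]; push_cast; ring
    simp only [Matrix.SpecialLinearGroup.coe_one, Matrix.one_apply_eq, Matrix.one_apply_ne,
      ne_eq, zero_ne_one, one_ne_zero, not_false_eq_true, Complex.ofReal_sub, Complex.ofReal_mul,
      Complex.ofReal_ofNat, Complex.ofReal_one, Complex.ofReal_zero]
    rw [hd', hb, m10]
    push_cast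
    ring
  have hfix : ∀ v : Fin 2 → ℂ, v ≠ 0 →
      ((QuotientGroup.mk (constSL (M * M) τ) : PSL2C) • sph v = sph v ↔
        v 0 = ((Real.exp lam)⁻¹ : ℝ) * v 1) := by
    intro v hv
    rw [mk_smul_sph _ hv, sph_eq_iff (sl2_mulVec_ne_zero _ hv) hv, hcross]
    have : (-2 * ((Real.cosh lam * Real.exp lam / Real.sinh lam : ℝ) : ℂ)) ≠ 0 := by
      refine mul_ne_zero (by norm_num) ?_
      exact_mod_cast div_ne_zero (mul_ne_zero hC hp) hs
    rw [mul_eq_zero, or_iff_right this, sq_eq_zero_iff, sub_eq_zero]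
  rw [← map_mul, ← map_mul, ← map_mul, ← map_mul, evalPSL_apply]
  have hv : (![(((Real.exp lam)⁻¹ : ℝ) : ℂ), 1] : Fin 2 → ℂ) ≠ 0 := by
    intro h
    have := congrFun h 1
    simp at this
  refine ⟨sph ![(((Real.exp lam)⁻¹ : ℝ) : ℂ), 1], (hfix _ hv).2 (by simp), ?_⟩
  intro z hz
  obtain ⟨v, hv0, rfl⟩ := exists_sph_eq z
  have := (hfix v hv0).1 hz
  rw [sph_eq_iff hv0 hv, cross]
  simp [this]

theorem diagS_zpow (lam : ℝ) (k : ℤ) : diagS lam ^ k = diagS (k * lam) := by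
  have hadd : ∀ a b, diagS (a + b) = diagS a * diagS b := by
    intro a b
    ext i j
    rw [mul_entries]
    fin_cases i <;> fin_cases j <;> simp [diagS, ← Real.exp_add, add_comm]
  let φ : Multiplicative ℝ →* SL(2, ℝ) := MonoidHom.mk' (fun a => diagS a.toAdd) fun a b =>
    hadd a.toAdd b.toAdd
  have h := map_zpow φ (Multiplicative.ofAdd lam) k
  rw [← ofAdd_zsmul] at h
  simpa [φ, zsmul_eq_mul] using h.symm

theorem evalPSL_diagGroup {lam : ℝ} (τ : ℂ) {d : SL(2, ℝ)} (hd : d ∈ diagGroup lam) :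
    ∃ k : ℤ, evalPSL τ (constSL d) = evalPSL τ (constSL (diagS lam)) ^ k := by
  obtain ⟨h01, h10, k, hk⟩ := hd
  have hdet := sl2_det d
  rw [h01, zero_mul, sub_zero] at hdet
  refine ⟨k, ?_⟩
  rw [← map_zpow, ← map_zpow, diagS_zpow]
  have key : ∀ ε : ℝ, ε * ε = 1 → d 0 0 = ε * Real.exp (k * lam) →
      d 1 1 = ε * Real.exp (-(k * lam)) := by
    intro ε hε h
    have : Real.exp (k * lam) * Real.exp (-(k * lam)) = 1 := by rw [← Real.exp_add]; simp
    rw [h] at hdet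
    linear_combination ε * Real.exp (-(k * lam)) * hdet - hε * d 1 1 - ε * ε * d 1 1 * this
  rcases abs_eq (Real.exp_pos _).le |>.1 hk with h | h
  · have h11 := key 1 (by norm_num) (by rw [h, one_mul])
    congr 2
    ext i j
    fin_cases i <;> fin_cases j <;> simp [diagS, h, h01, h10, h11]
  · have h11 := key (-1) (by norm_num) (by rw [h]; ring)
    apply mk_eq_of_eq_neg
    ext i j
    change constSL d τ i j = -constSL (diagS (k * lam)) τ i j
    rw [constSL_apply, constSL_apply]
    fin_cases i <;> fin_cases j <;> simp [diagS, h, h01, h10, h11]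

/-- The generator `S` in normalised coordinates. -/
noncomputable def normS (lam : ℝ) (τ : ℂ) : PSL2C := evalPSL τ (constSL (diagS lam))

/-- The generator `T` in normalised coordinates. -/
noncomputable def normT (lam : ℝ) (hlam : 0 < lam) (τ : ℂ) : PSL2C :=
  evalPSL τ bendTurn * evalPSL τ (constSL (halfTurn lam hlam))

-- The circle is built as the closure of an orbit of the larger group containing the involutions;
-- this identifies that orbit with one of the marked group, as `subset_kleinianLimitSet` requires.
open Pointwise in
theorem motionGroup_orbit {lam : ℝ} (hlam : 0 < lam) (τ : ℂ) {g : ℂ → SL(2, ℂ)}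
    (hg : g ∈ motionGroup lam hlam) :
    ∃ h ∈ Subgroup.closure {normS lam τ, normT lam hlam τ},
      h • sph (cuspVec lam) = evalPSL τ g • sph (cuspVec lam) := by
  set O := {x | ∃ h ∈ Subgroup.closure {normS lam τ, normT lam hlam τ},
    h • sph (cuspVec lam) = x} with hO
  obtain ⟨hs, he, hf⟩ := mem_stabilizer_orbit (evalPSL_bend_sq τ) (evalPSL_half_sq hlam τ)
    (evalPSL_bend_conj lam τ) (evalPSL_cusp hlam τ) hO
  have hle : motionGroup lam hlam ≤ (MulAction.stabilizer PSL2C O).comap (evalPSL τ) := by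
    rw [motionGroup, Subgroup.closure_le, Set.union_subset_iff, Set.singleton_subset_iff]
    refine ⟨?_, he⟩
    change (pantsGroup lam hlam).map constSL ≤ _
    rw [Subgroup.map_le_iff_le_comap, pantsGroup, Subgroup.closure_le, Set.union_subset_iff,
      Set.singleton_subset_iff]
    refine ⟨fun d hd => ?_, hf⟩
    obtain ⟨k, hk⟩ := evalPSL_diagGroup τ hd
    change evalPSL τ (constSL d) ∈ MulAction.stabilizer PSL2C O
    rw [hk]
    exact Subgroup.zpow_mem _ hs k
  have h := hle hg
  rw [Subgroup.mem_comap, MulAction.mem_stabilizer_set] at h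
  exact (h _).2 ⟨1, Subgroup.one_mem _, one_smul _ _⟩

theorem lift_norm {lam : ℝ} (hlam : 0 < lam) (τ : ℂ) (w : FreeGroup (Fin 2)) :
    FreeGroup.lift ![normS lam τ, normT lam hlam τ] w = evalPSL τ (wordMap lam hlam w) := by
  have : FreeGroup.lift ![normS lam τ, normT lam hlam τ] = (evalPSL τ).comp (wordMap lam hlam) := by
    ext1 i
    fin_cases i
    · simp [wordMap, normS]
    · simp [wordMap, normT]
  exact DFunLike.congr_fun this w

theorem range_lift_pair {H : Type*} [Group H] (S T : H) :
    (FreeGroup.lift ![S, T] : FreeGroup (Fin 2) →* H).range = Subgroup.closure {S, T} := by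
  rw [FreeGroup.range_lift_eq_closure]
  congr 1
  ext x
  simp only [Set.mem_range, Fin.exists_fin_two, Matrix.cons_val_zero, Matrix.cons_val_one,
    Set.mem_insert_iff, Set.mem_singleton_iff, eq_comm]

/-- If a neighbourhood of the identity contains no non-trivial word, the group is discrete. -/
theorem discreteTopology_of_words {H : Type*} [Group H] [TopologicalSpace H] [IsTopologicalGroup H]
    {S T : H} {N : Set H} (hN : N ∈ nhds 1) (h : ∀ w, FreeGroup.lift ![S, T] w ∈ N → w = 1) :
    DiscreteTopology (Subgroup.closure {S, T}) := by
  apply discreteTopology_of_isOpen_singleton_one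
  have : ({1} : Set (Subgroup.closure {S, T})) = Subtype.val ⁻¹' interior N := by
    ext x
    constructor
    · rintro rfl
      exact mem_interior_iff_mem_nhds.2 hN
    · intro hx
      obtain ⟨w, hw⟩ : (x : H) ∈ (FreeGroup.lift ![S, T] : FreeGroup (Fin 2) →* H).range := by
        rw [range_lift_pair]; exact x.2
      have hw1 := h w (hw ▸ interior_subset hx)
      rw [hw1, map_one] at hw
      exact Subtype.ext hw.symm
  rw [this]
  exact isOpen_interior.preimage continuous_subtype_val

/-- The theorem in normalised coordinates. -/
theorem isQuasiFuchsian_norm {lam : ℝ} (hlam : 0 < lam) {θ : ℝ}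
    (hθ : θ ∈ Set.Ioo 0 Real.pi) (hcos : Real.cos (θ / 2) = Real.tanh lam) {τ : ℂ}
    (hτ : |τ.im| < θ) :
    IsQuasiFuchsianPuncturedTorusGroup (normS lam τ) (normT lam hlam τ) := by
  obtain ⟨Γ, hΓ, -, hinj, hfst, ⟨e⟩, hcl, hinv⟩ := exists_limit_correspondence hlam hθ hcos hτ
  obtain ⟨N, hN, hNw⟩ := exists_nhds_words hlam hΓ hinj hfst hinv
  have hNw' : ∀ w, FreeGroup.lift ![normS lam τ, normT lam hlam τ] w ∈ N → w = 1 := by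
    intro w hw
    rw [lift_norm] at hw
    exact hNw w hw
  have hdisc := discreteTopology_of_words hN hNw'
  refine ⟨⟨hdisc, ?_, ?_⟩, ?_⟩
  · rw [injective_iff_map_eq_one]
    intro w hw
    exact hNw' w (hw ▸ mem_of_mem_nhds hN)
  · rw [normS, normT, commutator_eq_sq (evalPSL_bend_sq τ) (evalPSL_half_sq hlam τ)
      (evalPSL_bend_conj lam τ)]
    exact isParabolic_half_diag hlam τ
  · have hclosed : IsClosed (Prod.snd '' Γ) := (hΓ.image continuous_snd).isClosed
    have hperf := fun x (hx : x ∈ Prod.snd '' Γ) U (hU : U ∈ nhds x) =>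
      infinite_inter_of_homeomorph_circle e hx hU
    have hG : ∀ g ∈ Subgroup.closure {normS lam τ, normT lam hlam τ}, ∀ x ∈ Prod.snd '' Γ,
        g • x ∈ Prod.snd '' Γ := by
      rintro g hg _ ⟨q, hq, rfl⟩
      rw [← range_lift_pair] at hg
      obtain ⟨w, rfl⟩ := hg
      rw [lift_norm]
      exact ⟨_, hinv _ (wordMap_mem hlam w) q hq, rfl⟩
    have hne : (Prod.snd '' Γ).Nonempty := ⟨_, (e.symm 1).2⟩
    have hnt : (Prod.snd '' Γ).Nontrivial := by
      obtain ⟨x, hx⟩ := hne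
      exact ((hperf x hx Set.univ Filter.univ_mem).mono Set.inter_subset_right).nontrivial
    have hdense : Prod.snd '' Γ ⊆ closure {x | ∃ g ∈ Subgroup.closure
        {normS lam τ, normT lam hlam τ}, g • sph (cuspVec lam) = x} := by
      rw [hcl]
      refine (image_closure_subset_closure_image continuous_snd).trans (closure_mono ?_)
      rintro _ ⟨_, ⟨g, rfl⟩, rfl⟩
      obtain ⟨h, hh, hhg⟩ := motionGroup_orbit hlam τ g.2
      refine ⟨h, hh, ?_⟩
      rw [hhg, evalPSL_apply, mk_smul_sph _ (cuspVec_ne_zero lam)]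
    have heq : kleinianLimitSet (Subgroup.closure {normS lam τ, normT lam hlam τ}) =
        Prod.snd '' Γ :=
      subset_antisymm (kleinianLimitSet_subset hclosed hG hnt)
        (subset_kleinianLimitSet hdense hperf)
    rw [heq]
    exact ⟨e⟩

/-! ### Conjugation to the given generators -/

theorem kleinianLimitSet_map_conj (Q : PSL2C) (G : Subgroup PSL2C) :
    kleinianLimitSet (G.map (MulAut.conj Q).toMonoidHom) =
      (fun z => Q • z) '' kleinianLimitSet G := by
  have main : ∀ (Q : PSL2C) (G : Subgroup PSL2C) (x : OnePoint ℂ), x ∈ kleinianLimitSet G →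
      Q • x ∈ kleinianLimitSet (G.map (MulAut.conj Q).toMonoidHom) := by
    rintro Q G x ⟨z, hz⟩
    refine ⟨Q • z, fun U hU => ?_⟩
    have h1 := hz _ ((continuous_const_smul Q).continuousAt.preimage_mem_nhds hU)
    refine (h1.image (f := MulAut.conj Q) (MulAut.conj Q).injective.injOn).mono ?_
    rintro _ ⟨g, ⟨hg, hgU⟩, rfl⟩
    refine ⟨⟨g, hg, rfl⟩, ?_⟩
    rw [MulAut.conj_apply, ← mul_smul, inv_mul_cancel_right, mul_smul]
    exact hgU
  ext x
  constructor
  · intro hx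
    refine ⟨Q⁻¹ • x, ?_, smul_inv_smul _ _⟩
    have := main Q⁻¹ _ x hx
    rw [Subgroup.map_map] at this
    convert this
    rw [eq_comm]
    convert Subgroup.map_id G
    ext g
    simp
  · rintro ⟨y, hy, rfl⟩
    exact main Q G y hy

/-- Being quasi-Fuchsian is invariant under conjugation. -/
theorem IsQuasiFuchsianPuncturedTorusGroup.conj {S T : PSL2C}
    (h : IsQuasiFuchsianPuncturedTorusGroup S T) (Q : PSL2C) :
    IsQuasiFuchsianPuncturedTorusGroup (Q * S * Q⁻¹) (Q * T * Q⁻¹) := by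
  have hcl : Subgroup.closure {Q * S * Q⁻¹, Q * T * Q⁻¹} =
      (Subgroup.closure {S, T}).map (MulAut.conj Q).toMonoidHom := by
    rw [MonoidHom.map_closure, Set.image_pair]
    rfl
  refine ⟨⟨?_, ?_, ?_⟩, ?_⟩
  · have := h.discrete
    have hmem : ∀ x ∈ Subgroup.closure {Q * S * Q⁻¹, Q * T * Q⁻¹},
        Q⁻¹ * x * Q ∈ Subgroup.closure {S, T} := by
      rw [hcl]
      rintro _ ⟨g, hg, rfl⟩
      have : Q⁻¹ * (MulAut.conj Q).toMonoidHom g * Q = g := by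
        change Q⁻¹ * (Q * g * Q⁻¹) * Q = g
        group
      rw [this]
      exact hg
    refine DiscreteTopology.of_continuous_injective (β := Subgroup.closure {S, T})
      (f := fun x => ⟨Q⁻¹ * x.1 * Q, hmem x.1 x.2⟩) ?_ ?_
    · exact Continuous.subtype_mk (by fun_prop) _
    · intro x y hxy
      have := congrArg Subtype.val hxy
      exact Subtype.ext (mul_left_cancel (mul_right_cancel this))
  · have : (FreeGroup.lift ![Q * S * Q⁻¹, Q * T * Q⁻¹] : FreeGroup (Fin 2) →* PSL2C) =
        (MulAut.conj Q).toMonoidHom.comp (FreeGroup.lift ![S, T]) := by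
      ext1 i
      fin_cases i <;> simp
    rw [this]
    exact (MulAut.conj Q).injective.comp h.free
  · have hc : (Q * T * Q⁻¹)⁻¹ * (Q * S * Q⁻¹)⁻¹ * (Q * T * Q⁻¹) * (Q * S * Q⁻¹) =
        Q * (T⁻¹ * S⁻¹ * T * S) * Q⁻¹ := by group
    rw [hc]
    obtain ⟨z, hz, hu⟩ := h.parabolic
    refine ⟨Q • z, ?_, fun y hy => ?_⟩
    · simp only at hz ⊢
      rw [← mul_smul, inv_mul_cancel_right, mul_smul, hz]
    · rw [← hu (Q⁻¹ • y), smul_inv_smul]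
      simp only at hy ⊢
      rw [← mul_smul, eq_inv_smul_iff, ← mul_smul, ← mul_assoc, hy]
  · obtain ⟨e⟩ := h.limitSet_circle
    rw [hcl, kleinianLimitSet_map_conj]
    exact ⟨((Homeomorph.smul Q).image _).symm.trans e⟩

/-- The matrix whose columns are proportional to the eigenvectors of `S`. -/
noncomputable def eigenMat (k r : ℂ) (h : 2 * k * (r * r) = 1) : SL(2, ℂ) :=
  ⟨!![r * k, -(r * k); r, r], by rw [Matrix.det_fin_two_of]; linear_combination h⟩

/-- The lift of `genS` to `SL(2, ℂ)`. -/
noncomputable def liftS (lam : ℝ) : SL(2, ℂ) := ⟨matS lam, det_matS lam⟩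

/-- The lift of `genT` to `SL(2, ℂ)`. -/
noncomputable def liftT (lam : ℝ) (hlam : 0 < lam) (τ : ℂ) : SL(2, ℂ) :=
  ⟨matT lam τ, det_matT lam hlam τ⟩

/-- The fixed points of the given `S` are `± coth (λ / 2)`, so `eigenMat` with `k = coth (λ / 2)`
diagonalises it. For `T` the matrix identity holds only up to sign, which disappears in `PSL(2, ℂ)`.
-/
theorem exists_conj {lam : ℝ} (hlam : 0 < lam) (τ : ℂ) :
    ∃ Q : PSL2C, Q * normS lam τ * Q⁻¹ = genS lam ∧ Q * normT lam hlam τ * Q⁻¹ = genT lam hlam τ := by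
  set x : ℂ := Complex.exp (lam / 2) with hx
  set y : ℂ := Complex.exp (τ / 2) with hy
  have hx0 : x ≠ 0 := Complex.exp_ne_zero _
  have hy0 : y ≠ 0 := Complex.exp_ne_zero _
  have hxr : x = (Real.exp (lam / 2) : ℝ) := by rw [hx]; push_cast; rfl
  have hx1 : x ^ 2 - 1 ≠ 0 := by
    rw [hxr]
    have : 1 < Real.exp (lam / 2) ^ 2 := one_lt_pow₀ (Real.one_lt_exp_iff.2 (by linarith)) two_ne_zero
    exact_mod_cast (sub_pos.2 this).ne'
  have hx2 : x ^ 2 + 1 ≠ 0 := by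
    rw [hxr]
    have : 0 < Real.exp (lam / 2) ^ 2 + 1 := by positivity
    exact_mod_cast this.ne'
  set k : ℂ := (x ^ 2 + 1) / (x ^ 2 - 1) with hk
  have hk0 : k ≠ 0 := div_ne_zero hx2 hx1
  -- The scale of the eigenvectors that gives determinant one; a complex square root is enough.
  obtain ⟨r, hr⟩ : ∃ r : ℂ, 2 * k * (r * r) = 1 := by
    obtain ⟨r, hr⟩ := IsAlgClosed.exists_pow_nat_eq ((2 * k)⁻¹) (n := 2) two_pos
    refine ⟨r, ?_⟩
    rw [← pow_two, hr, mul_inv_cancel₀ (mul_ne_zero two_ne_zero hk0)]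
  have ex : Complex.exp lam = x ^ 2 := by
    rw [hx, ← Complex.exp_nat_mul]; congr 1; push_cast; ring
  have ex' : Complex.exp (-lam) = (x ^ 2)⁻¹ := by rw [Complex.exp_neg, ex]
  have exh' : Complex.exp (-(lam / 2)) = x⁻¹ := by rw [Complex.exp_neg]
  have ey' : Complex.exp (-(τ / 2)) = y⁻¹ := by rw [Complex.exp_neg]
  have cC : Complex.cosh lam = (x ^ 2 + (x ^ 2)⁻¹) / 2 := by rw [Complex.cosh, ex, ex']
  have cs : Complex.sinh lam = (x ^ 2 - (x ^ 2)⁻¹) / 2 := by rw [Complex.sinh, ex, ex']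
  have ccoth : Complex.cosh (lam / 2) / Complex.sinh (lam / 2) = k := by
    rw [Complex.cosh, Complex.sinh, exh', ← hx, hk]
    have : x - x⁻¹ ≠ 0 := by
      intro h; apply hx1
      have := congrArg (· * x) h
      field_simp at this
      simpa using this
    field_simp
  have ctanh : Complex.sinh (lam / 2) / Complex.cosh (lam / 2) = k⁻¹ := by
    rw [← ccoth, inv_div]
  have ycosh : Complex.cosh (τ / 2) = (y + y⁻¹) / 2 := by rw [Complex.cosh, ey']
  have ysinh : Complex.sinh (τ / 2) = (y - y⁻¹) / 2 := by rw [Complex.sinh, ey']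
  have hS : eigenMat k r hr * constSL (diagS lam) τ =
      liftS lam * eigenMat k r hr := by
    have d00 : constSL (diagS lam) τ 0 0 = x ^ 2 := by
      rw [← ex, constSL_apply]; simp [diagS]
    have d01 : constSL (diagS lam) τ 0 1 = 0 := by rw [constSL_apply]; simp [diagS]
    have d10 : constSL (diagS lam) τ 1 0 = 0 := by rw [constSL_apply]; simp [diagS]
    have d11 : constSL (diagS lam) τ 1 1 = (x ^ 2)⁻¹ := by
      rw [← ex', constSL_apply]; simp [diagS]
    ext i j
    rw [mul_entries, mul_entries]
    fin_cases i <;> fin_cases j <;>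
      simp only [Fin.zero_eta, Fin.mk_one, d00, d01, d10, d11, eigenMat, liftS, matS, Matrix.of_apply,
        Matrix.cons_val_zero, Matrix.cons_val_one, Matrix.cons_val', Matrix.cons_val_fin_one, cC,
        hk] <;> field_simp <;> ring
  have hT : eigenMat k r hr * (bendTurn * constSL (halfTurn lam hlam)) τ =
      -(liftT lam hlam τ * eigenMat k r hr) := by
    have hs0 : x ^ 4 - 1 ≠ 0 := by
      have : x ^ 4 - 1 = (x ^ 2 - 1) * (x ^ 2 + 1) := by ring
      rw [this]
      exact mul_ne_zero hx1 hx2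
    have cs' : Complex.sinh lam = (x ^ 4 - 1) / (2 * x ^ 2) := by rw [cs]; field_simp
    have cC' : Complex.cosh lam = (x ^ 4 + 1) / (2 * x ^ 2) := by rw [cC]; field_simp
    have h00 : constSL (halfTurn lam hlam) τ 0 0 = 2 * x ^ 2 / (x ^ 4 - 1) := by
      rw [constSL_apply]; simp [halfTurn, cs']
    have h01 : constSL (halfTurn lam hlam) τ 0 1 = -(x ^ 4 + 1) / (x ^ 4 - 1) := by
      rw [constSL_apply]; simp [halfTurn, cs', cC']; field_simp; ring
    have h10 : constSL (halfTurn lam hlam) τ 1 0 = (x ^ 4 + 1) / (x ^ 4 - 1) := by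
      rw [constSL_apply]; simp [halfTurn, cs', cC']; field_simp
    have h11 : constSL (halfTurn lam hlam) τ 1 1 = -(2 * x ^ 2) / (x ^ 4 - 1) := by
      rw [constSL_apply]; simp [halfTurn, cs']; field_simp
    have b00 : bendTurn τ 0 0 = 0 := by simp [bendTurn]
    have b01 : bendTurn τ 0 1 = -y⁻¹ := by rw [← ey']; simp [bendTurn]
    have b10 : bendTurn τ 1 0 = y := by simp [bendTurn, hy]
    have b11 : bendTurn τ 1 1 = 0 := by simp [bendTurn]
    ext i j
    rw [Matrix.SpecialLinearGroup.coe_neg, Matrix.neg_apply, Pi.mul_apply, mul_entries,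
      mul_entries, mul_entries, mul_entries]
    fin_cases i <;> fin_cases j <;>
      simp only [Fin.zero_eta, Fin.mk_one, h00, h01, h10, h11, b00, b01, b10, b11, eigenMat,
        liftT, matT,
        Matrix.of_apply, Matrix.cons_val_zero, Matrix.cons_val_one, Matrix.cons_val',
        Matrix.cons_val_fin_one, ccoth, ctanh, ycosh, ysinh, hk] <;> field_simp <;> ring
  refine ⟨QuotientGroup.mk (eigenMat k r hr), ?_, ?_⟩
  · rw [mul_inv_eq_iff_eq_mul]
    exact congrArg (QuotientGroup.mk' (Subgroup.center SL(2, ℂ))) hS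
  · rw [mul_inv_eq_iff_eq_mul, normT, ← map_mul]
    exact mk_eq_of_eq_neg hT

end

theorem theorem4p1 (lam : ℝ) (hlam : 0 < lam)
    (θ₀ : ℝ) (hθ₀ : θ₀ ∈ Set.Ioo 0 Real.pi) (hcos : Real.cos (θ₀ / 2) = Real.tanh lam)
    (τ : ℂ) (hτ : τ.im ∈ Set.Ioo (-θ₀) θ₀) :
    IsQuasiFuchsianPuncturedTorusGroup (genS lam) (genT lam hlam τ) := by
  obtain ⟨Q, hS, hT⟩ := exists_conj hlam τ
  rw [← hS, ← hT]
  exact (isQuasiFuchsian_norm hlam hθ₀ hcos (abs_lt.2 hτ)).conj Q
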